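/- **Setting.** Let $\Omega\subset\mathbb R^2$ be a bounded polygonal domain, triangulated by a conforming (regular in the sense of Ciarlet) initial mesh $\mathcal T_0$: finitely many nondegenerate closed triangles with pairwise disjoint interiors, any two of which meet in a common edge, a common vertex or not at all, and $\Omega$ is the interior of their union. (This covers all open, bounded, simply connected polygonal Lipschitz domains.) In each triangle of $\mathcal T_0$ a refinement edge is chosen. Let $\mathbb T$ be the set of all conforming triangulations obtained from $\mathcal T_0$ by finitely many newest vertex bisections. Write $(\cdot,\cdot)$, $\|\cdot\|$ for the inner product and norm of $L^2(\Omega)$ and $L^2(\Omega)^2$, and put $a(\sigma,\tau)=(\sigma,\tau)$, $b(\tau,v)=(\operatorname{div}\tau,v)$. Let $k\ge 0$. For $\mathcal T_h\in\mathbb T$ let $M_h\subset L^2(\Omega)$ be the space of functions which are polynomials of degree at most $k$ on each triangle, and let $\Sigma_h\subset H(\operatorname{div};\Omega)$ be the corresponding Raviart–Thomas space (locally $P_k^2+xP_k$), Brezzi–Douglas–Marini space (locally $P_{k+1}^2$) or Brezzi–Douglas–Fortin–Marini space (locally the fields in $P_{k+1}^2$ whose normal component on each edge is a polynomial of degree at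 most $k$). The same family and the same $k$ are used on all meshes. For $w_h\in M_h$ let $G_h(w_h)\in\Sigma_h$ solve $a(G_h(w_h),\tau_h)+b(\tau_h,w_h)=0$ for all $\tau_h\in\Sigma_h$; similarly let $G(w)\in H(\operatorname{div};\Omega)$ solve $a(G(w),\tau)+b(\tau,w)=0$ for all $\tau\in H(\operatorname{div};\Omega)$. Let $(\lambda_{h,j},\sigma_{h,j},u_{h,j})$, $1\le j\le N(h)=\dim M_h$, be solutions of the discrete eigenvalue problem $$a(\sigma_{h,j},\tau_h)+b(\tau_h,u_{h,j})=0\quad\forall\tau_h\in\Sigma_h,\qquad b(\sigma_{h,j},v_h)=-\lambda_{h,j}(u_{h,j},v_h)\quad\forall v_h\in M_h,$$ with $0<\lambda_{h,1}\le\dots\le\lambda_{h,N(h)}$ and $\{u_{h,j}\}_j$ an orthonormal basis of $M_h$. Fix $J=\{n+1,\dots,n+m\}$ (independent of the mesh), let $W_h=\operatorname{span}\{u_{h,j}: j\in J,\ j\le N(h)\}$, and let $P^W_h$ be the $L^2$-orthogonal projection onto $W_h$. For $\lambda\in\mathbb R$ and $g\in L^2(\Omega)$ let $T^\lambda_hg\in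 M_h$ solve $b(G_h(T^\lambda_hg),v_h)=-(\lambda g,v_h)$ for all $v_h\in M_h$, and put $\Lambda_h g=P^W_hT^\lambda_hg$. For $T\in\mathcal T_h$ let $h_T$ be its diameter and $\mathcal E(T)$ the set of its edges; for $E\in\mathcal E(T)$ let $h_E$ be its length and $t_E$ a unit tangent, and let $[\cdot]_E\cdot t_E$ be the jump of the tangential trace if $E$ is an internal edge and the tangential trace if $E$ is a boundary edge. Let $\operatorname{curl}\psi=\partial_2\psi_1-\partial_1\psi_2$. For $g_h\in M_h$ put $$|g_h|_{\eta,T}^2=\|h_T(G_h(g_h)-\nabla g_h)\|_T^2+\|h_T\operatorname{curl}G_h(g_h)\|_T^2+\sum_{E\in\mathcal E(T)}h_E\|[G_h(g_h)]_E\cdot t_E\|_E^2,$$ where $\|\cdot\|_T$, $\|\cdot\|_E$ are the $L^2$ norms on $T$ and $E$. Finally put $$\mu_h(u;\mathcal T_h)^2=\sum_{T\in\mathcal T_h}|\Lambda_hu|_{\eta,T}^2,\qquad d(u,\Lambda_hu)=\sqrt{\|u-\Lambda_hu\|^2+\|G(u)-G_h(\Lambda_hu)\|^2}.$$ **Proposition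 (Efficiency).** Let $(\sigma,u)$ be an eigenpair with eigenvalue $\lambda$ of the mixed Dirichlet Laplace problem: $\sigma\in H(\operatorname{div};\Omega)$, $u\in L^2(\Omega)$, $\|u\|=1$, and $$a(\sigma,\tau)+b(\tau,u)=0\quad\forall\tau\in H(\operatorname{div};\Omega),\qquad b(\sigma,v)=-\lambda(u,v)\quad\forall v\in L^2(\Omega).$$ Then there is a constant $C_{\mathrm{eff}}>0$, independent of $h$, such that for every $\mathcal T_h\in\mathbb T$ and every choice of the discrete eigenpairs on $\mathcal T_h$ as above $$\mu_h(u;\mathcal T_h)\le C_{\mathrm{eff}}\,d(u,\Lambda_hu).$$ -/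

import Mathlib

open MeasureTheory
open scoped ContDiff RealInnerProductSpace

noncomputable section

namespace MixedFEM

/-! ### Function spaces -/

/-- The Euclidean plane. -/
abbrev Plane : Type := EuclideanSpace ℝ (Fin 2)

/-- `L²(Ω)`. -/
abbrev L2 (Ω : Set Plane) : Type := Lp ℝ 2 (volume.restrict Ω)

/-- `L²(Ω)²`. -/
abbrev L2v (Ω : Set Plane) : Type := Lp Plane 2 (volume.restrict Ω)

/-- `d ∈ L²(Ω)` is the weak divergence of the vector field `τ ∈ L²(Ω)²` in `Ω`. -/
def HasWeakDiv (Ω : Set Plane) (τ : L2v Ω) (d : L2 Ω) : Prop :=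
  ∀ φ : Plane → ℝ, ContDiff ℝ ∞ φ → HasCompactSupport φ → tsupport φ ⊆ Ω →
    ∫ x in Ω, ⟪τ x, gradient φ x⟫ = - ∫ x in Ω, d x * φ x

/-- The gradient of a test function is square integrable. -/
theorem memLp_gradient (Ω : Set Plane) {φ : Plane → ℝ} (hφ : ContDiff ℝ ∞ φ)
    (hc : HasCompactSupport φ) : MemLp (gradient φ) 2 (volume.restrict Ω) := by
  have h1 : Continuous (gradient φ) := by
    have : Continuous (fderiv ℝ φ) := hφ.continuous_fderiv (by simp)
    exact (InnerProductSpace.toDual ℝ Plane).symm.continuous.comp this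
  have h2 : HasCompactSupport (gradient φ) := by
    refine (hc.fderiv (𝕜 := ℝ)).comp_left (g := (InnerProductSpace.toDual ℝ Plane).symm) ?_
    simp
  exact (h1.memLp_of_hasCompactSupport (μ := volume) h2).restrict Ω

/-- The pairing of an `L²` field with the gradient of a test function is integrable. -/
theorem integrable_inner_gradient (Ω : Set Plane) (τ : L2v Ω) {φ : Plane → ℝ}
    (hφ : ContDiff ℝ ∞ φ) (hc : HasCompactSupport φ) :
    Integrable (fun x => ⟪τ x, gradient φ x⟫) (volume.restrict Ω) := by
  have h := memLp_gradient Ω hφ hc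
  refine (L2.integrable_inner (𝕜 := ℝ) τ h.toLp).congr ?_
  filter_upwards [h.coeFn_toLp] with x hx
  rw [hx]

/-- The pairing of an `L²` function with a test function is integrable. -/
theorem integrable_mul_test (Ω : Set Plane) (d : L2 Ω) {φ : Plane → ℝ}
    (hφ : ContDiff ℝ ∞ φ) (hc : HasCompactSupport φ) :
    Integrable (fun x => d x * φ x) (volume.restrict Ω) :=
  (Lp.memLp d).integrable_mul
    ((hφ.continuous.memLp_of_hasCompactSupport (μ := volume) (p := 2) hc).restrict Ω)

theorem HasWeakDiv.zero (Ω : Set Plane) : HasWeakDiv Ω 0 0 := by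
  intro φ hφ hc _
  have h1 : ∫ x in Ω, ⟪(0 : L2v Ω) x, gradient φ x⟫ = 0 := by
    rw [integral_eq_zero_of_ae]
    filter_upwards [Lp.coeFn_zero Plane 2 (volume.restrict Ω)] with x hx
    rw [hx]
    simp only [Pi.zero_apply, inner_zero_left]
  have h2 : ∫ x in Ω, (0 : L2 Ω) x * φ x = 0 := by
    rw [integral_eq_zero_of_ae]
    filter_upwards [Lp.coeFn_zero ℝ 2 (volume.restrict Ω)] with x hx
    rw [hx]
    simp only [Pi.zero_apply, zero_mul]
  rw [h1, h2, neg_zero]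

theorem HasWeakDiv.add {Ω : Set Plane} {τ τ' : L2v Ω} {d d' : L2 Ω}
    (h : HasWeakDiv Ω τ d) (h' : HasWeakDiv Ω τ' d') : HasWeakDiv Ω (τ + τ') (d + d') := by
  intro φ hφ hc hs
  have h1 : ∫ x in Ω, ⟪(τ + τ') x, gradient φ x⟫
      = (∫ x in Ω, ⟪τ x, gradient φ x⟫) + ∫ x in Ω, ⟪τ' x, gradient φ x⟫ := by
    rw [← integral_add (integrable_inner_gradient Ω τ hφ hc)
      (integrable_inner_gradient Ω τ' hφ hc)]
    refine integral_congr_ae ?_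
    filter_upwards [Lp.coeFn_add τ τ'] with x hx
    rw [hx, Pi.add_apply, inner_add_left]
  have h2 : ∫ x in Ω, (d + d') x * φ x
      = (∫ x in Ω, d x * φ x) + ∫ x in Ω, d' x * φ x := by
    rw [← integral_add (integrable_mul_test Ω d hφ hc) (integrable_mul_test Ω d' hφ hc)]
    refine integral_congr_ae ?_
    filter_upwards [Lp.coeFn_add d d'] with x hx
    rw [hx, Pi.add_apply, add_mul]
  rw [h1, h2, h φ hφ hc hs, h' φ hφ hc hs]
  ring

theorem HasWeakDiv.smul {Ω : Set Plane} {τ : L2v Ω} {d : L2 Ω} (c : ℝ)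
    (h : HasWeakDiv Ω τ d) : HasWeakDiv Ω (c • τ) (c • d) := by
  intro φ hφ hc hs
  have h1 : ∫ x in Ω, ⟪(c • τ) x, gradient φ x⟫ = c * ∫ x in Ω, ⟪τ x, gradient φ x⟫ := by
    rw [← integral_const_mul]
    refine integral_congr_ae ?_
    filter_upwards [Lp.coeFn_smul c τ] with x hx
    rw [hx, Pi.smul_apply, real_inner_smul_left]
  have h2 : ∫ x in Ω, (c • d) x * φ x = c * ∫ x in Ω, d x * φ x := by
    rw [← integral_const_mul]
    refine integral_congr_ae ?_
    filter_upwards [Lp.coeFn_smul c d] with x hx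
    rw [hx, Pi.smul_apply, smul_eq_mul, mul_assoc]
  rw [h1, h2, h φ hφ hc hs]
  ring

/-- `H(div; Ω)`. -/
def Hdiv (Ω : Set Plane) : Submodule ℝ (L2v Ω) where
  carrier := {τ | ∃ d, HasWeakDiv Ω τ d}
  zero_mem' := ⟨0, HasWeakDiv.zero Ω⟩
  add_mem' := by
    rintro τ τ' ⟨d, h⟩ ⟨d', h'⟩
    exact ⟨d + d', h.add h'⟩
  smul_mem' := by
    rintro c τ ⟨d, h⟩
    exact ⟨c • d, h.smul c⟩

open Classical in
/-- The weak divergence of `τ ∈ H(div; Ω)` (and zero for other fields). -/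
def weakDiv (Ω : Set Plane) (τ : L2v Ω) : L2 Ω :=
  if h : ∃ d, HasWeakDiv Ω τ d then h.choose else 0

theorem HasWeakDiv.unique {Ω : Set Plane} (hΩ : IsOpen Ω) {τ : L2v Ω} {d d' : L2 Ω}
    (h : HasWeakDiv Ω τ d) (h' : HasWeakDiv Ω τ d') : d = d' := by
  have key : ∀ᵐ x ∂(volume.restrict Ω), x ∈ Ω → d x - d' x = 0 := by
    refine hΩ.ae_eq_zero_of_integral_contDiff_smul_eq_zero (f := fun x => d x - d' x) ?_ ?_
    · have h1 : LocallyIntegrable (fun x => d x - d' x) (volume.restrict Ω) :=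
        ((Lp.memLp d).sub (Lp.memLp d')).locallyIntegrable (by norm_num)
      exact h1.locallyIntegrableOn Ω
    · intro g hg hc hs
      have e1 := h g hg hc hs
      have e2 := h' g hg hc hs
      have e3 : ∫ x in Ω, g x • (d x - d' x)
          = (∫ x in Ω, d x * g x) - ∫ x in Ω, d' x * g x := by
        rw [← integral_sub (integrable_mul_test Ω d hg hc) (integrable_mul_test Ω d' hg hc)]
        refine integral_congr_ae (Filter.Eventually.of_forall fun x => ?_)
        simp only [smul_eq_mul]
        ring
      rw [e3]
      linarith
  refine Lp.ext ?_
  filter_upwards [key, ae_restrict_mem hΩ.measurableSet] with x hx hxΩ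
  linarith [hx hxΩ]

theorem HasWeakDiv.weakDiv_eq {Ω : Set Plane} (hΩ : IsOpen Ω) {τ : L2v Ω} {d : L2 Ω}
    (h : HasWeakDiv Ω τ d) : weakDiv Ω τ = d := by
  have hex : ∃ d, HasWeakDiv Ω τ d := ⟨d, h⟩
  unfold weakDiv
  rw [dif_pos hex]
  exact hex.choose_spec.unique hΩ h

/-! ### The mixed eigenvalue problem, continuous and discrete

`S` is `H(div; Ω)` or a discrete subspace of it, `M` is `L²(Ω)` or a discrete subspace of it. -/

/-- `a(σ, τ) = (σ, τ)`. -/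
def aForm (Ω : Set Plane) (σ τ : L2v Ω) : ℝ := ⟪σ, τ⟫

/-- `b(τ, v) = (div τ, v)`. -/
def bForm (Ω : Set Plane) (τ : L2v Ω) (v : L2 Ω) : ℝ := ⟪weakDiv Ω τ, v⟫

/-- `(σ, u)` is a (normalized) eigenpair with eigenvalue `lam` of the mixed problem on `S × M`. -/
structure IsEigenpair (Ω : Set Plane) (S : Submodule ℝ (L2v Ω)) (M : Submodule ℝ (L2 Ω))
    (lam : ℝ) (σ : L2v Ω) (u : L2 Ω) : Prop where
  mem_S : σ ∈ S
  mem_M : u ∈ M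
  norm_eq : ‖u‖ = 1
  eq_a : ∀ τ ∈ S, aForm Ω σ τ + bForm Ω τ u = 0
  eq_b : ∀ v ∈ M, bForm Ω σ v = - lam * ⟪u, v⟫

/-- `s = G(w)`: `s ∈ S` solves `a(s, τ) + b(τ, w) = 0` for all `τ ∈ S`. -/
def IsG (Ω : Set Plane) (S : Submodule ℝ (L2v Ω)) (w : L2 Ω) (s : L2v Ω) : Prop :=
  s ∈ S ∧ ∀ τ ∈ S, aForm Ω s τ + bForm Ω τ w = 0

theorem IsG.unique {Ω : Set Plane} {S : Submodule ℝ (L2v Ω)} {w : L2 Ω} {s s' : L2v Ω}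
    (h : IsG Ω S w s) (h' : IsG Ω S w s') : s = s' := by
  have hm : s - s' ∈ S := S.sub_mem h.1 h'.1
  have e1 := h.2 _ hm
  have e2 := h'.2 _ hm
  have e3 : ⟪s - s', s - s'⟫ = 0 := by
    rw [inner_sub_left]
    simp only [aForm] at e1 e2
    linarith
  exact sub_eq_zero.mp (inner_self_eq_zero.mp e3)

open Classical in
/-- The operator `G` on `S`: for `S = H(div; Ω)` this is `G`, for `S = Σ_h` it is `G_h`. -/
def gradOp (Ω : Set Plane) (S : Submodule ℝ (L2v Ω)) (w : L2 Ω) : L2v Ω :=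
  if h : ∃ s, IsG Ω S w s then h.choose else 0

theorem IsG.gradOp_eq {Ω : Set Plane} {S : Submodule ℝ (L2v Ω)} {w : L2 Ω} {s : L2v Ω}
    (h : IsG Ω S w s) : gradOp Ω S w = s := by
  have hex : ∃ s, IsG Ω S w s := ⟨s, h⟩
  unfold gradOp
  rw [dif_pos hex]
  exact hex.choose_spec.unique h

/-- `t = T^λ_h g`: `t ∈ M` solves, together with `s = G(t) ∈ S`, the mixed source problem
with datum `λ g`. -/
def IsSourceSol (Ω : Set Plane) (S : Submodule ℝ (L2v Ω)) (M : Submodule ℝ (L2 Ω))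
    (lam : ℝ) (g t : L2 Ω) : Prop :=
  t ∈ M ∧ ∃ s, IsG Ω S t s ∧ ∀ v ∈ M, bForm Ω s v = - ⟪lam • g, v⟫

open Classical in
/-- The solution operator `T^λ_h`. -/
def sourceOp (Ω : Set Plane) (S : Submodule ℝ (L2v Ω)) (M : Submodule ℝ (L2 Ω))
    (lam : ℝ) (g : L2 Ω) : L2 Ω :=
  if h : ∃ t, IsSourceSol Ω S M lam g t then h.choose else 0

/-- An enumeration of the eigenpairs `(λ_j, σ_j, u_j)` of the discrete problem on `S × M`, with
ascending positive eigenvalues and with `u_1, …, u_N` an orthonormal basis of `M`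
(so that `N = dim M`). Index `j : Fin N` stands for the eigenpair with number `j + 1`. -/
structure DiscreteEigensystem (Ω : Set Plane) (S : Submodule ℝ (L2v Ω))
    (M : Submodule ℝ (L2 Ω)) where
  N : ℕ
  lam : Fin N → ℝ
  σ : Fin N → L2v Ω
  u : Fin N → L2 Ω
  lam_pos : ∀ j, 0 < lam j
  lam_mono : Monotone lam
  orthonormal : Orthonormal ℝ u
  span_eq : Submodule.span ℝ (Set.range u) = M
  eigenpair : ∀ j, IsEigenpair Ω S M (lam j) (σ j) (u j)

theorem bForm_sum {Ω : Set Plane} (hΩ : IsOpen Ω) {N : ℕ} (c : Fin N → ℝ) (σ : Fin N → L2v Ω)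
    (hσ : ∀ j, σ j ∈ Hdiv Ω) (v : L2 Ω) :
    bForm Ω (∑ j, c j • σ j) v = ∑ j, c j * bForm Ω (σ j) v := by
  choose d hd using hσ
  have h : HasWeakDiv Ω (∑ j, c j • σ j) (∑ j, c j • d j) := by
    classical
    induction (Finset.univ : Finset (Fin N)) using Finset.induction_on with
    | empty => exact HasWeakDiv.zero Ω
    | insert j t hj ih =>
      rw [Finset.sum_insert hj, Finset.sum_insert hj]
      exact ((hd j).smul (c j)).add ih
  simp only [bForm]
  rw [h.weakDiv_eq hΩ, sum_inner]
  refine Finset.sum_congr rfl fun j _ => ?_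
  rw [(hd j).weakDiv_eq hΩ, real_inner_smul_left]

/-- The discrete source problem is uniquely solvable, so that `sourceOp` is its solution. -/
theorem DiscreteEigensystem.existsUnique_sourceSol {Ω : Set Plane} (hΩ : IsOpen Ω)
    {S : Submodule ℝ (L2v Ω)} {M : Submodule ℝ (L2 Ω)} (hS : S ≤ Hdiv Ω)
    (D : DiscreteEigensystem Ω S M) (lam : ℝ) (g : L2 Ω) :
    ∃! t, IsSourceSol Ω S M lam g t := by
  have coef : ∀ t, IsSourceSol Ω S M lam g t → ∀ j, D.lam j * ⟪D.u j, t⟫ = ⟪lam • g, D.u j⟫ := by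
    rintro t ⟨ht, s, hs, hb⟩ j
    have e1 := (D.eigenpair j).eq_b t ht
    have e2 := hs.2 _ (D.eigenpair j).mem_S
    have e3 := (D.eigenpair j).eq_a s hs.1
    have e4 := hb _ (D.eigenpair j).mem_M
    have e5 : aForm Ω s (D.σ j) = aForm Ω (D.σ j) s := real_inner_comm _ _
    linarith
  refine existsUnique_of_exists_of_unique ?_ ?_
  · set c : Fin D.N → ℝ := fun j => ⟪lam • g, D.u j⟫ / D.lam j with hc
    have hsum : ∀ v ∈ M, ∀ w : L2 Ω, (∀ j, ⟪w, D.u j⟫ = 0) → ⟪w, v⟫ = 0 := by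
      intro v hv w hw
      rw [← D.span_eq] at hv
      induction hv using Submodule.span_induction with
      | mem x hx =>
        obtain ⟨j, rfl⟩ := hx
        exact hw j
      | zero => exact inner_zero_right _
      | add x y _ _ hx hy => rw [inner_add_right, hx, hy, add_zero]
      | smul a x _ hx => rw [real_inner_smul_right, hx, mul_zero]
    refine ⟨∑ j, c j • D.u j, Submodule.sum_mem _ fun j _ =>
      Submodule.smul_mem _ _ (D.eigenpair j).mem_M, ∑ j, c j • D.σ j,
      ⟨Submodule.sum_mem _ fun j _ => Submodule.smul_mem _ _ (D.eigenpair j).mem_S, ?_⟩, ?_⟩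
    · intro τ hτ
      simp only [aForm, bForm, sum_inner, inner_sum, real_inner_smul_left, real_inner_smul_right]
      rw [← Finset.sum_add_distrib]
      refine Finset.sum_eq_zero fun j _ => ?_
      have e := (D.eigenpair j).eq_a τ hτ
      simp only [aForm, bForm] at e
      rw [← mul_add, e, mul_zero]
    · intro v hv
      rw [bForm_sum hΩ c D.σ (fun j => hS (D.eigenpair j).mem_S) v]
      have e : ∀ j, c j * bForm Ω (D.σ j) v = - ⟪⟪lam • g, D.u j⟫ • D.u j, v⟫ := by
        intro j
        rw [(D.eigenpair j).eq_b v hv, real_inner_smul_left, hc]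
        have := (D.lam_pos j).ne'
        field_simp
      rw [Finset.sum_congr rfl fun j _ => e j, Finset.sum_neg_distrib, ← sum_inner]
      congr 1
      rw [← sub_eq_zero, ← inner_sub_left]
      refine hsum v hv _ fun i => ?_
      rw [inner_sub_left, sum_inner, sub_eq_zero]
      have horth := orthonormal_iff_ite.mp D.orthonormal
      simp only [real_inner_smul_left, horth]
      simp
  · intro t t' ht ht'
    have h0 : ∀ j, ⟪D.u j, t - t'⟫ = 0 := by
      intro j
      have e1 := coef t ht j
      have e2 := coef t' ht' j
      rw [inner_sub_right, sub_eq_zero]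
      exact mul_left_cancel₀ (D.lam_pos j).ne' (e1.trans e2.symm)
    have hmem : t - t' ∈ Submodule.span ℝ (Set.range D.u) := by
      rw [D.span_eq]
      exact M.sub_mem ht.1 ht'.1
    have hall : ∀ x ∈ Submodule.span ℝ (Set.range D.u), ⟪x, t - t'⟫ = 0 := by
      intro x hx
      induction hx using Submodule.span_induction with
      | mem x hx =>
        obtain ⟨j, rfl⟩ := hx
        exact h0 j
      | zero => exact inner_zero_left _
      | add x y _ _ hx hy => rw [inner_add_left, hx, hy, add_zero]
      | smul a x _ hx => rw [real_inner_smul_left, hx, mul_zero]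
    exact sub_eq_zero.mp (inner_self_eq_zero.mp (hall _ hmem))

/-- The discrete cluster space `W_h = span {u_{h,j} | j ∈ J}` with `J = {n + 1, …, n + m}`. -/
def DiscreteEigensystem.clusterSpace {Ω : Set Plane} {S : Submodule ℝ (L2v Ω)}
    {M : Submodule ℝ (L2 Ω)} (D : DiscreteEigensystem Ω S M) (n m : ℕ) :
    Submodule ℝ (L2 Ω) :=
  Submodule.span ℝ
    (Set.range fun j : {j : Fin D.N // (j : ℕ) + 1 ∈ Finset.Icc (n + 1) (n + m)} => D.u j)

instance {Ω : Set Plane} {S : Submodule ℝ (L2v Ω)} {M : Submodule ℝ (L2 Ω)}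
    (D : DiscreteEigensystem Ω S M) (n m : ℕ) : FiniteDimensional ℝ (D.clusterSpace n m) :=
  FiniteDimensional.span_of_finite ℝ (Set.finite_range _)

/-- `Λ_h = P^W_h ∘ T^λ_h`, where `P^W_h` is the `L²`-orthogonal projection onto `W_h`. -/
def DiscreteEigensystem.Lam {Ω : Set Plane} {S : Submodule ℝ (L2v Ω)}
    {M : Submodule ℝ (L2 Ω)} (D : DiscreteEigensystem Ω S M) (n m : ℕ) (lam : ℝ) (g : L2 Ω) :
    L2 Ω :=
  (D.clusterSpace n m).starProjection (sourceOp Ω S M lam g)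

/-! ### Triangles and meshes -/

/-- A triangle with vertices `T 0`, `T 1`, `T 2`. Its newest vertex is `T 2`, its refinement edge
is the opposite edge, from `T 0` to `T 1`. -/
abbrev Tri : Type := Fin 3 → Plane

namespace Tri

/-- The closed triangle. -/
def carrier (T : Tri) : Set Plane := convexHull ℝ (Set.range T)

/-- `h_T`. -/
def diam (T : Tri) : ℝ := Metric.diam T.carrier

/-- First endpoint of the edge opposite to vertex `i`. -/
def edgeA (T : Tri) (i : Fin 3) : Plane := T (i + 1)

/-- Second endpoint of the edge opposite to vertex `i`. -/
def edgeB (T : Tri) (i : Fin 3) : Plane := T (i + 2)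

/-- The length `h_E` of the edge opposite to vertex `i`. -/
def edgeLen (T : Tri) (i : Fin 3) : ℝ := dist (T.edgeA i) (T.edgeB i)

/-- A unit tangent `t_E` of the edge opposite to vertex `i`. -/
def tangent (T : Tri) (i : Fin 3) : Plane := (T.edgeLen i)⁻¹ • (T.edgeB i - T.edgeA i)

/-- A child of `T` under newest vertex bisection. The new vertex is the newest one. -/
def child₁ (T : Tri) : Tri := ![T 0, T 2, midpoint ℝ (T 0) (T 1)]

/-- The other child of `T` under newest vertex bisection. -/
def child₂ (T : Tri) : Tri := ![T 1, T 2, midpoint ℝ (T 0) (T 1)]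

end Tri

/-- Regularity of a triangulation in the sense of Ciarlet: the triangles are nondegenerate, and two
different ones have disjoint interiors and meet in the convex hull of their common
vertices (that is, in a common edge, a common vertex, or not at all). -/
structure IsConforming (𝒯 : Finset Tri) : Prop where
  nondegenerate : ∀ T ∈ 𝒯, AffineIndependent ℝ T
  disjoint_interior : ∀ T ∈ 𝒯, ∀ T' ∈ 𝒯, T ≠ T' →
    Disjoint (interior T.carrier) (interior T'.carrier)
  inter_eq : ∀ T ∈ 𝒯, ∀ T' ∈ 𝒯, T ≠ T' →
    T.carrier ∩ T'.carrier = convexHull ℝ (Set.range T ∩ Set.range T')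

/-- `𝒯` is a conforming triangulation of the polygonal domain `Ω`. -/
structure IsTriangulation (Ω : Set Plane) (𝒯 : Finset Tri) : Prop where
  conforming : IsConforming 𝒯
  interior_eq : interior (⋃ T ∈ 𝒯, T.carrier) = Ω

open Classical in
/-- `𝒯` arises from `𝒯₀` by finitely many newest vertex bisections of single triangles. -/
inductive BisectionRefines (𝒯₀ : Finset Tri) : Finset Tri → Prop
  | refl : BisectionRefines 𝒯₀ 𝒯₀
  | step {𝒯 : Finset Tri} {T : Tri} (h : BisectionRefines 𝒯₀ 𝒯) (hT : T ∈ 𝒯) :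
      BisectionRefines 𝒯₀ (insert T.child₁ (insert T.child₂ (𝒯.erase T)))

/-- The set `𝕋` of admissible meshes: the conforming triangulations that arise from the initial
mesh by newest vertex bisection. -/
def admissibleMeshes (𝒯₀ : Finset Tri) : Set (Finset Tri) :=
  {𝒯 | BisectionRefines 𝒯₀ 𝒯 ∧ IsConforming 𝒯}

/-! ### Mixed finite elements -/

/-- Polynomials in the two coordinates. -/
abbrev Poly : Type := MvPolynomial (Fin 2) ℝ

/-- The value of a polynomial at a point of the plane. -/
def Poly.evalAt (p : Poly) (x : Plane) : ℝ := MvPolynomial.eval (fun i => x i) p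

/-- The value of a polynomial vector field at a point of the plane. -/
def vecAt (q : Fin 2 → Poly) (x : Plane) : Plane := !₂[(q 0).evalAt x, (q 1).evalAt x]

/-- `P_k`: polynomials of total degree at most `k`. -/
def polyLE (k : ℕ) : Submodule ℝ Poly := MvPolynomial.restrictTotalDegree (Fin 2) ℝ k

/-- `P_k²`. -/
def vecLE (k : ℕ) : Submodule ℝ (Fin 2 → Poly) := Submodule.pi Set.univ fun _ => polyLE k

/-- The local Raviart–Thomas space `P_k² + x P_k`. -/
def rtLocal (k : ℕ) : Submodule ℝ (Fin 2 → Poly) where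
  carrier := {q | ∃ p ∈ vecLE k, ∃ r ∈ polyLE k, ∀ i, q i = p i + MvPolynomial.X i * r}
  zero_mem' := ⟨0, Submodule.zero_mem _, 0, Submodule.zero_mem _, by simp⟩
  add_mem' := by
    rintro q q' ⟨p, hp, r, hr, h⟩ ⟨p', hp', r', hr', h'⟩
    refine ⟨p + p', Submodule.add_mem _ hp hp', r + r', Submodule.add_mem _ hr hr', fun i => ?_⟩
    simp only [Pi.add_apply, h i, h' i]
    ring
  smul_mem' := by
    rintro c q ⟨p, hp, r, hr, h⟩
    refine ⟨c • p, Submodule.smul_mem _ c hp, c • r, Submodule.smul_mem _ c hr, fun i => ?_⟩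
    simp only [Pi.smul_apply, h i, smul_add, mul_smul_comm]

/-- The fields in `P_{k+1}²` whose normal component on each edge of `T` is a polynomial
of degree at most `k` along that edge (local space of Brezzi–Douglas–Fortin–Marini). -/
def bdfmLocal (k : ℕ) (T : Tri) : Submodule ℝ (Fin 2 → Poly) where
  carrier := {q | q ∈ vecLE (k + 1) ∧ ∀ i : Fin 3, ∃ r ∈ Polynomial.degreeLE ℝ (k : WithBot ℕ),
    ∀ s : ℝ, (vecAt q (AffineMap.lineMap (T.edgeA i) (T.edgeB i) s)) 0 * (T.tangent i) 1
      - (vecAt q (AffineMap.lineMap (T.edgeA i) (T.edgeB i) s)) 1 * (T.tangent i) 0 = r.eval s}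
  zero_mem' := ⟨Submodule.zero_mem _, fun i => ⟨0, Submodule.zero_mem _, fun s => by
    simp [vecAt, Poly.evalAt]⟩⟩
  add_mem' := by
    rintro q q' ⟨hq, h⟩ ⟨hq', h'⟩
    refine ⟨Submodule.add_mem _ hq hq', fun i => ?_⟩
    obtain ⟨r, hr, e⟩ := h i
    obtain ⟨r', hr', e'⟩ := h' i
    refine ⟨r + r', Submodule.add_mem _ hr hr', fun s => ?_⟩
    rw [Polynomial.eval_add, ← e s, ← e' s]
    simp only [vecAt, Poly.evalAt, Pi.add_apply, map_add, PiLp.toLp_apply, Matrix.cons_val_zero,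
      Matrix.cons_val_one]
    ring
  smul_mem' := by
    rintro c q ⟨hq, h⟩
    refine ⟨Submodule.smul_mem _ c hq, fun i => ?_⟩
    obtain ⟨r, hr, e⟩ := h i
    refine ⟨c • r, Submodule.smul_mem _ c hr, fun s => ?_⟩
    rw [Polynomial.eval_smul, ← e s]
    simp only [vecAt, Poly.evalAt, Pi.smul_apply, MvPolynomial.smul_eval, PiLp.toLp_apply,
      Matrix.cons_val_zero, Matrix.cons_val_one, smul_eq_mul]
    ring

/-- The standard families of mixed finite elements on triangles:
Raviart–Thomas, Brezzi–Douglas–Marini, Brezzi–Douglas–Fortin–Marini. -/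
inductive Family : Type
  | RT
  | BDM
  | BDFM

/-- The local space for the vector variable. The divergences of its elements are in `P_k`. -/
def localSpace : Family → ℕ → Tri → Submodule ℝ (Fin 2 → Poly)
  | Family.RT, k, _ => rtLocal k
  | Family.BDM, k, _ => vecLE (k + 1)
  | Family.BDFM, k, T => bdfmLocal k T

/-- The polynomial `p` represents `v ∈ L²(Ω)` on the triangle `T`. -/
def RepOn (Ω : Set Plane) (T : Tri) (v : L2 Ω) (p : Poly) : Prop :=
  ∀ᵐ x ∂(volume.restrict Ω), x ∈ T.carrier → v x = p.evalAt x

/-- The polynomial field `q` represents `τ ∈ L²(Ω)²` on the triangle `T`. -/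
def VecRepOn (Ω : Set Plane) (T : Tri) (τ : L2v Ω) (q : Fin 2 → Poly) : Prop :=
  ∀ᵐ x ∂(volume.restrict Ω), x ∈ T.carrier → τ x = vecAt q x

/-- `M_h`: the functions in `L²(Ω)` that are in `P_k` on each triangle. -/
def Mh (Ω : Set Plane) (k : ℕ) (𝒯 : Finset Tri) : Submodule ℝ (L2 Ω) where
  carrier := {v | ∀ T ∈ 𝒯, ∃ p ∈ polyLE k, RepOn Ω T v p}
  zero_mem' := fun T _ => ⟨0, Submodule.zero_mem _, by
    filter_upwards [Lp.coeFn_zero ℝ 2 (volume.restrict Ω)] with x hx _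
    rw [hx]
    simp [Poly.evalAt]⟩
  add_mem' := by
    intro v v' h h' T hT
    obtain ⟨p, hp, e⟩ := h T hT
    obtain ⟨p', hp', e'⟩ := h' T hT
    refine ⟨p + p', Submodule.add_mem _ hp hp', ?_⟩
    filter_upwards [Lp.coeFn_add v v', e, e'] with x hx ex ex' hxT
    rw [hx, Pi.add_apply, ex hxT, ex' hxT]
    simp [Poly.evalAt]
  smul_mem' := by
    intro c v h T hT
    obtain ⟨p, hp, e⟩ := h T hT
    refine ⟨c • p, Submodule.smul_mem _ c hp, ?_⟩
    filter_upwards [Lp.coeFn_smul c v, e] with x hx ex hxT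
    rw [hx, Pi.smul_apply, ex hxT]
    simp [Poly.evalAt, MvPolynomial.smul_eval]

/-- The fields in `L²(Ω)²` that are in the local space of the chosen family on each triangle. -/
def brokenSpace (Ω : Set Plane) (fam : Family) (k : ℕ) (𝒯 : Finset Tri) :
    Submodule ℝ (L2v Ω) where
  carrier := {τ | ∀ T ∈ 𝒯, ∃ q ∈ localSpace fam k T, VecRepOn Ω T τ q}
  zero_mem' := fun T _ => ⟨0, Submodule.zero_mem _, by
    filter_upwards [Lp.coeFn_zero Plane 2 (volume.restrict Ω)] with x hx _
    rw [hx]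
    ext i
    fin_cases i <;> simp [vecAt, Poly.evalAt]⟩
  add_mem' := by
    intro v v' h h' T hT
    obtain ⟨p, hp, e⟩ := h T hT
    obtain ⟨p', hp', e'⟩ := h' T hT
    refine ⟨p + p', Submodule.add_mem _ hp hp', ?_⟩
    filter_upwards [Lp.coeFn_add v v', e, e'] with x hx ex ex' hxT
    rw [hx, Pi.add_apply, ex hxT, ex' hxT]
    ext i
    fin_cases i <;> simp [vecAt, Poly.evalAt]
  smul_mem' := by
    intro c v h T hT
    obtain ⟨p, hp, e⟩ := h T hT
    refine ⟨c • p, Submodule.smul_mem _ c hp, ?_⟩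
    filter_upwards [Lp.coeFn_smul c v, e] with x hx ex hxT
    rw [hx, Pi.smul_apply, ex hxT]
    ext i
    fin_cases i <;> simp [vecAt, Poly.evalAt, MvPolynomial.smul_eval]

/-- `Σ_h`: the fields in `H(div; Ω)` that are in the local space on each triangle. -/
def Sh (Ω : Set Plane) (fam : Family) (k : ℕ) (𝒯 : Finset Tri) : Submodule ℝ (L2v Ω) :=
  Hdiv Ω ⊓ brokenSpace Ω fam k 𝒯

/-! ### Distance and error indicator -/

/-- The distance `d(v, w_h)` of `v ∈ L²(Ω)` and a discrete function `w_h` (where `G_h` is used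
for the second argument), with `S = Σ_h`. -/
def errDist (Ω : Set Plane) (S : Submodule ℝ (L2v Ω)) (v w : L2 Ω) : ℝ :=
  Real.sqrt (‖v - w‖ ^ 2
    + aForm Ω (gradOp Ω (Hdiv Ω) v - gradOp Ω S w) (gradOp Ω (Hdiv Ω) v - gradOp Ω S w))

open Classical in
/-- The restriction to `T` of a piecewise polynomial function, as a polynomial. -/
def polyOn (Ω : Set Plane) (T : Tri) (v : L2 Ω) : Poly :=
  if h : ∃ p, RepOn Ω T v p then h.choose else 0

open Classical in
/-- The restriction to `T` of a piecewise polynomial field, as a pair of polynomials. -/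
def vecOn (Ω : Set Plane) (T : Tri) (τ : L2v Ω) : Fin 2 → Poly :=
  if h : ∃ q, VecRepOn Ω T τ q then h.choose else 0

/-- `∇ p`. -/
def polyGrad (p : Poly) : Fin 2 → Poly := fun i => MvPolynomial.pderiv i p

/-- The scalar curl `∂₂ q₁ - ∂₁ q₂`. -/
def polyCurl (q : Fin 2 → Poly) : Poly := MvPolynomial.pderiv 1 (q 0) - MvPolynomial.pderiv 0 (q 1)

open Classical in
/-- The triangles of the mesh, other than `T`, that share the edge of `T` opposite to vertex `i`.
In a conforming triangulation this is one triangle for an internal edge, none for a boundary edge. -/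
def neighbors (𝒯 : Finset Tri) (T : Tri) (i : Fin 3) : Finset Tri :=
  𝒯.filter fun T' => T' ≠ T ∧ T.edgeA i ∈ Set.range T' ∧ T.edgeB i ∈ Set.range T'

/-- `[τ]_E · t_E` at `x ∈ E`, `E` the edge of `T` opposite to vertex `i`: the jump of the tangential
trace on internal edges, the tangential trace on boundary edges. -/
def tangentialJump (Ω : Set Plane) (𝒯 : Finset Tri) (τ : L2v Ω) (T : Tri) (i : Fin 3)
    (x : Plane) : ℝ :=
  ⟪vecAt (vecOn Ω T τ) x, T.tangent i⟫
    - ∑ T' ∈ neighbors 𝒯 T i, ⟪vecAt (vecOn Ω T' τ) x, T.tangent i⟫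

/-- `‖f‖_E²` with respect to arc length, `E` the edge of `T` opposite to vertex `i`. -/
def edgeNormSq (T : Tri) (i : Fin 3) (f : Plane → ℝ) : ℝ :=
  T.edgeLen i * ∫ s in (0 : ℝ)..1, f (AffineMap.lineMap (T.edgeA i) (T.edgeB i) s) ^ 2

/-- `|g|_{η,T}²` for `g ∈ M_h`, with `S = Σ_h`. -/
def etaSq (Ω : Set Plane) (S : Submodule ℝ (L2v Ω)) (𝒯 : Finset Tri) (g : L2 Ω) (T : Tri) : ℝ :=
  (∫ x in T.carrier,
      ‖T.diam • (vecAt (vecOn Ω T (gradOp Ω S g)) x - vecAt (polyGrad (polyOn Ω T g)) x)‖ ^ 2)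
    + (∫ x in T.carrier, (T.diam * (polyCurl (vecOn Ω T (gradOp Ω S g))).evalAt x) ^ 2)
    + ∑ i : Fin 3, T.edgeLen i * edgeNormSq T i (tangentialJump Ω 𝒯 (gradOp Ω S g) T i)

/-- The seminorm `|g|_{η,T}`. -/
def etaSeminorm (Ω : Set Plane) (S : Submodule ℝ (L2v Ω)) (𝒯 : Finset Tri) (g : L2 Ω)
    (T : Tri) : ℝ :=
  Real.sqrt (etaSq Ω S 𝒯 g T)

/-- The theoretical error indicator `μ_h(u; T) = |Λ_h u|_{η,T}` on a triangle. -/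
def muLocal {Ω : Set Plane} {S : Submodule ℝ (L2v Ω)} {M : Submodule ℝ (L2 Ω)}
    (D : DiscreteEigensystem Ω S M) (𝒯 : Finset Tri) (n m : ℕ) (lam : ℝ) (u : L2 Ω)
    (T : Tri) : ℝ :=
  etaSeminorm Ω S 𝒯 (D.Lam n m lam u) T

/-- The theoretical error estimator `μ_h(u; ℳ)` for a set `ℳ` of triangles of the mesh `𝒯`. -/
def mu {Ω : Set Plane} {S : Submodule ℝ (L2v Ω)} {M : Submodule ℝ (L2 Ω)}
    (D : DiscreteEigensystem Ω S M) (𝒯 : Finset Tri) (n m : ℕ) (lam : ℝ) (u : L2 Ω)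
    (ℳ : Finset Tri) : ℝ :=
  Real.sqrt (∑ T ∈ ℳ, muLocal D 𝒯 n m lam u T ^ 2)

end MixedFEM

end

/-!
The estimator is a sum of residuals of `G_h(w)`, each of which vanishes for the exact field
`G(u)`: the latter is a weak gradient of `u`, hence curl free with continuous tangential traces. A
residual is tested with itself times a bubble function, and integration by parts turns the result
into an integral against the error. Equivalence of norms on polynomials of bounded degree on the
reference triangle removes the bubble function, and the inverse estimates on a triangle `T` lose
only powers of `h_T² / |T|`. Newest vertex bisection halves both the area of a triangle and a
quadratic form in its edges comparable to `h_T²`, so this ratio stays bounded on all meshes.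
Finally every triangle has at most three neighbors, so the local bounds add up.
-/

noncomputable section

namespace MixedFEM

/-! ### The reference triangle and polynomials -/

/-- The cross product of two plane vectors, that is, their determinant. -/
def cross (v w : Plane) : ℝ := v 0 * w 1 - v 1 * w 0

/-- The closed reference triangle with vertices `(0, 0)`, `(1, 0)` and `(0, 1)`. -/
def refTri : Set Plane := {y | 0 ≤ y 0 ∧ 0 ≤ y 1 ∧ y 0 + y 1 ≤ 1}

/-- The open reference triangle. -/
def openRefTri : Set Plane := {y | 0 < y 0 ∧ 0 < y 1 ∧ y 0 + y 1 < 1}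

theorem plane_ext {x y : Plane} (h0 : x 0 = y 0) (h1 : x 1 = y 1) : x = y := by
  ext i
  fin_cases i
  exacts [h0, h1]

theorem plane_norm_sq (v : Plane) : ‖v‖ ^ 2 = v 0 ^ 2 + v 1 ^ 2 := by
  simp [EuclideanSpace.norm_sq_eq, Fin.sum_univ_two]

theorem plane_inner (v w : Plane) : ⟪v, w⟫ = v 0 * w 0 + v 1 * w 1 := by
  simp [PiLp.inner_apply, Fin.sum_univ_two, mul_comm]

theorem plane_eq_sum (v : Plane) :
    v = v 0 • EuclideanSpace.single 0 1 + v 1 • EuclideanSpace.single 1 1 := by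
  apply plane_ext <;> simp

theorem cross_ne_zero_of_linearIndependent {v w : Plane} (h : LinearIndependent ℝ ![v, w]) :
    cross v w ≠ 0 := by
  intro hc
  replace hc : v 0 * w 1 - v 1 * w 0 = 0 := hc
  rw [LinearIndependent.pair_iff] at h
  have hv (i : Fin 2) : v i = 0 := by
    refine neg_eq_zero.1 (h (w i) (-v i) ?_).2
    fin_cases i <;> apply plane_ext <;> simp <;> linarith
  have hv : v = 0 := plane_ext (hv 0) (hv 1)
  simpa [hv] using h 1 0

theorem isCompact_refTri : IsCompact refTri := by
  refine Metric.isCompact_of_isClosed_isBounded ?_ ?_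
  · have c0 : Continuous fun y : Plane => y 0 := by fun_prop
    have c1 : Continuous fun y : Plane => y 1 := by fun_prop
    exact (isClosed_le continuous_const c0).inter
      ((isClosed_le continuous_const c1).inter (isClosed_le (c0.add c1) continuous_const))
  · refine (Metric.isBounded_closedBall (x := (0 : Plane)) (r := 2)).subset ?_
    rintro y ⟨h0, h1, h2⟩
    rw [mem_closedBall_zero_iff]
    nlinarith [norm_nonneg y, plane_norm_sq y]

theorem convex_refTri : Convex ℝ refTri := by
  rintro x ⟨hx0, hx1, hx2⟩ y ⟨hy0, hy1, hy2⟩ a b ha hb hab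
  refine ⟨?_, ?_, ?_⟩ <;> simp only [PiLp.add_apply, PiLp.smul_apply, smul_eq_mul]
  · positivity
  · positivity
  · nlinarith

theorem isOpen_openRefTri : IsOpen openRefTri := by
  have c0 : Continuous fun y : Plane => y 0 := by fun_prop
  have c1 : Continuous fun y : Plane => y 1 := by fun_prop
  exact (isOpen_lt continuous_const c0).inter
    ((isOpen_lt continuous_const c1).inter (isOpen_lt (c0.add c1) continuous_const))

theorem openRefTri_subset_refTri : openRefTri ⊆ refTri :=
  fun _ ⟨h0, h1, h2⟩ => ⟨h0.le, h1.le, h2.le⟩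

namespace Tri

/-- Twice the signed area of a triangle. -/
def det (T : Tri) : ℝ := cross (T 1 - T 0) (T 2 - T 0)

/-- The affine map of the reference triangle onto `T`. -/
def toPlane (T : Tri) (y : Plane) : Plane := T 0 + (y 0 • (T 1 - T 0) + y 1 • (T 2 - T 0))

/-- The inverse of `Tri.toPlane`, by Cramer's rule; it is the zero map if `T` is degenerate. -/
def coord (T : Tri) (x : Plane) : Plane :=
  !₂[cross (x - T 0) (T 2 - T 0) / T.det, cross (T 1 - T 0) (x - T 0) / T.det]

/-- The linear part of `Tri.toPlane`. -/
def lin (T : Tri) : Plane →L[ℝ] Plane :=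
  (EuclideanSpace.proj (0 : Fin 2) : Plane →L[ℝ] ℝ).smulRight (T 1 - T 0)
    + (EuclideanSpace.proj (1 : Fin 2) : Plane →L[ℝ] ℝ).smulRight (T 2 - T 0)

theorem coord_toPlane {T : Tri} (h : T.det ≠ 0) (y : Plane) : T.coord (T.toPlane y) = y := by
  apply plane_ext
  all_goals
    change _ / _ = _
    rw [div_eq_iff h]
    simp [det, cross, toPlane]
    ring

theorem toPlane_coord {T : Tri} (h : T.det ≠ 0) (x : Plane) : T.toPlane (T.coord x) = x := by
  have hcramer : cross (x - T 0) (T 2 - T 0) • (T 1 - T 0)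
      + cross (T 1 - T 0) (x - T 0) • (T 2 - T 0) = T.det • (x - T 0) := by
    apply plane_ext <;> simp [det, cross] <;> ring
  change T 0 + ((_ / _) • _ + (_ / _) • _) = x
  rw [div_eq_inv_mul, div_eq_inv_mul, mul_smul, mul_smul, ← smul_add, hcramer,
    inv_smul_smul₀ h, add_sub_cancel]

theorem continuous_coord (T : Tri) : Continuous T.coord := by
  unfold coord cross
  fun_prop

theorem hasFDerivAt_toPlane (T : Tri) (y : Plane) : HasFDerivAt T.toPlane T.lin y :=
  T.lin.hasFDerivAt.const_add (T 0)

theorem contDiff_toPlane (T : Tri) {n : WithTop ℕ∞} : ContDiff ℝ n T.toPlane :=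
  contDiff_const.add T.lin.contDiff

theorem continuous_toPlane (T : Tri) : Continuous T.toPlane :=
  T.contDiff_toPlane.continuous (n := 0)

theorem det_lin (T : Tri) : T.lin.det = T.det := by
  rw [ContinuousLinearMap.det, ← LinearMap.det_toMatrix (EuclideanSpace.basisFun (Fin 2) ℝ).toBasis,
    Matrix.det_fin_two]
  simp [LinearMap.toMatrix_apply, lin, det, cross]
  ring

theorem toPlane_combo (T : Tri) (x y : Plane) {a b : ℝ} (hab : a + b = 1) :
    T.toPlane (a • x + b • y) = a • T.toPlane x + b • T.toPlane y := by
  obtain rfl : b = 1 - a := by linarith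
  apply plane_ext <;> simp [toPlane] <;> ring

theorem range_eq (T : Tri) : Set.range T = {T 0, T 1, T 2} := by
  ext x
  simp only [Set.mem_range, Fin.exists_fin_succ, Set.mem_insert_iff, Set.mem_singleton_iff]
  simp [eq_comm]

theorem carrier_eq_image (T : Tri) : T.carrier = T.toPlane '' refTri := by
  refine Set.Subset.antisymm (convexHull_min ?_ ?_) ?_
  · rw [range_eq]
    rintro x (rfl | rfl | rfl)
    · exact ⟨0, by simp [refTri], by simp [toPlane]⟩
    · exact ⟨!₂[1, 0], by simp [refTri], by simp [toPlane]⟩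
    · exact ⟨!₂[0, 1], by simp [refTri], by simp [toPlane]⟩
  · rintro _ ⟨x, hx, rfl⟩ _ ⟨y, hy, rfl⟩ a b ha hb hab
    exact ⟨a • x + b • y, convex_refTri hx hy ha hb hab, T.toPlane_combo x y hab⟩
  · rintro _ ⟨y, ⟨h0, h1, h2⟩, rfl⟩
    have hy : T.toPlane y = ∑ i, ![1 - y 0 - y 1, y 0, y 1] i • T i := by
      rw [Fin.sum_univ_three]
      apply plane_ext <;> simp [toPlane] <;> ring
    rw [hy]
    exact (convex_convexHull ℝ (Set.range T)).sum_mem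
      (by intro i _; fin_cases i <;> simp <;> linarith)
      (by simp [Fin.sum_univ_three]; ring) (fun i _ => subset_convexHull _ _ ⟨i, rfl⟩)

theorem mem_carrier_iff {T : Tri} (h : T.det ≠ 0) {x : Plane} :
    x ∈ T.carrier ↔ T.coord x ∈ refTri := by
  rw [carrier_eq_image]
  constructor
  · rintro ⟨y, hy, rfl⟩
    rwa [coord_toPlane h]
  · exact fun hx => ⟨_, hx, toPlane_coord h x⟩

theorem isCompact_carrier (T : Tri) : IsCompact T.carrier := by
  rw [carrier_eq_image]
  exact isCompact_refTri.image T.continuous_toPlane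

theorem convex_carrier (T : Tri) : Convex ℝ T.carrier := convex_convexHull _ _

theorem measurableSet_carrier (T : Tri) : MeasurableSet T.carrier :=
  T.isCompact_carrier.isClosed.measurableSet

theorem toPlane_mem_interior {T : Tri} (h : T.det ≠ 0) {y : Plane} (hy : y ∈ openRefTri) :
    T.toPlane y ∈ interior T.carrier := by
  refine mem_interior.2 ⟨T.coord ⁻¹' openRefTri, fun x hx =>
    (mem_carrier_iff h).2 (openRefTri_subset_refTri hx),
    isOpen_openRefTri.preimage T.continuous_coord, ?_⟩
  rwa [Set.mem_preimage, coord_toPlane h]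

theorem det_ne_zero {T : Tri} (hT : AffineIndependent ℝ T) : T.det ≠ 0 := by
  let f : Fin 2 → {i : Fin 3 // i ≠ 0} := ![⟨1, one_ne_zero⟩, ⟨2, by decide⟩]
  have h := ((affineIndependent_iff_linearIndependent_vsub ℝ T 0).1 hT).comp f (by decide)
  have hf : (fun i : {i : Fin 3 // i ≠ 0} => T i -ᵥ T 0) ∘ f = ![T 1 - T 0, T 2 - T 0] := by
    funext i
    fin_cases i <;> rfl
  exact cross_ne_zero_of_linearIndependent (hf ▸ h)

theorem integral_carrier {T : Tri} (h : T.det ≠ 0) (g : Plane → ℝ) :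
    ∫ x in T.carrier, g x = |T.det| * ∫ y in refTri, g (T.toPlane y) := by
  have hinj : Set.InjOn T.toPlane refTri :=
    (Function.LeftInverse.injective (coord_toPlane h)).injOn
  rw [carrier_eq_image, integral_image_eq_integral_abs_det_fderiv_smul volume
    isCompact_refTri.measurableSet (fun y _ => (T.hasFDerivAt_toPlane y).hasFDerivWithinAt) hinj]
  simp only [det_lin, smul_eq_mul, integral_const_mul]

end Tri

namespace Poly

@[simp] theorem evalAt_add (p q : Poly) (x : Plane) :
    Poly.evalAt (p + q) x = p.evalAt x + q.evalAt x := by simp [Poly.evalAt]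

@[simp] theorem evalAt_sub (p q : Poly) (x : Plane) :
    Poly.evalAt (p - q) x = p.evalAt x - q.evalAt x := by simp [Poly.evalAt]

@[simp] theorem evalAt_neg (p : Poly) (x : Plane) :
    Poly.evalAt (-p) x = -p.evalAt x := by simp [Poly.evalAt]

@[simp] theorem evalAt_mul (p q : Poly) (x : Plane) :
    Poly.evalAt (p * q) x = p.evalAt x * q.evalAt x := by simp [Poly.evalAt]

@[simp] theorem evalAt_pow (p : Poly) (n : ℕ) (x : Plane) :
    Poly.evalAt (p ^ n) x = p.evalAt x ^ n := by simp [Poly.evalAt]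

@[simp] theorem evalAt_smul (c : ℝ) (p : Poly) (x : Plane) :
    Poly.evalAt (c • p) x = c * p.evalAt x := by simp [Poly.evalAt, MvPolynomial.smul_eval]

@[simp] theorem evalAt_zero (x : Plane) : Poly.evalAt 0 x = 0 := by simp [Poly.evalAt]

@[simp] theorem evalAt_one (x : Plane) : Poly.evalAt 1 x = 1 := by simp [Poly.evalAt]

@[simp] theorem evalAt_C (c : ℝ) (x : Plane) : Poly.evalAt (MvPolynomial.C c) x = c := by
  simp [Poly.evalAt]

@[simp] theorem evalAt_X (i : Fin 2) (x : Plane) : Poly.evalAt (MvPolynomial.X i) x = x i := by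
  simp [Poly.evalAt]

theorem contDiff (p : Poly) {n : WithTop ℕ∞} : ContDiff ℝ n p.evalAt := by
  have h := AnalyticOnNhd.eval_continuousLinearMap' (𝕜 := ℝ)
    (fun i : Fin 2 => (EuclideanSpace.proj i : Plane →L[ℝ] ℝ)) p
  exact h.contDiff

theorem continuous (p : Poly) : Continuous p.evalAt := p.contDiff.continuous (n := 0)

theorem differentiableAt (p : Poly) (x : Plane) : DifferentiableAt ℝ p.evalAt x :=
  p.contDiff.differentiable (n := 1) one_ne_zero x

theorem fderiv_single (p : Poly) (x : Plane) (i : Fin 2) :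
    fderiv ℝ p.evalAt x (EuclideanSpace.single i 1)
      = Poly.evalAt (MvPolynomial.pderiv i p) x := by
  induction p using MvPolynomial.induction_on with
  | C a =>
    have e : Poly.evalAt (MvPolynomial.C a) = fun _ => a := by ext y; simp
    simp [e]
  | add p q hp hq =>
    have e : Poly.evalAt (p + q) = Poly.evalAt p + Poly.evalAt q := by ext y; simp
    rw [e, fderiv_add (differentiableAt p x) (differentiableAt q x)]
    simp [hp, hq]
  | mul_X p j hp =>
    have hX : HasFDerivAt (Poly.evalAt (MvPolynomial.X j))
        (EuclideanSpace.proj j : Plane →L[ℝ] ℝ) x := by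
      convert (EuclideanSpace.proj j : Plane →L[ℝ] ℝ).hasFDerivAt (x := x) using 1
      ext y; simp
    have e : Poly.evalAt (p * MvPolynomial.X j)
        = Poly.evalAt p * Poly.evalAt (MvPolynomial.X j) := by ext y; simp
    rw [e, ((differentiableAt p x).hasFDerivAt.mul hX).fderiv]
    simp [hp, MvPolynomial.pderiv_X, Pi.single_apply, mul_comm, eq_comm,
      apply_ite Poly.evalAt, ite_apply]

/-- Substitution of the affine map `y ↦ a + y₀ M₀ + y₁ M₁` into a polynomial. -/
def affSub (a : Plane) (M : Fin 2 → Plane) : Poly →ₐ[ℝ] Poly :=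
  MvPolynomial.aeval fun i => MvPolynomial.C (a i) + MvPolynomial.C (M 0 i) * MvPolynomial.X 0
    + MvPolynomial.C (M 1 i) * MvPolynomial.X 1

theorem affSub_X (a : Plane) (M : Fin 2 → Plane) (i : Fin 2) :
    affSub a M (MvPolynomial.X i) = MvPolynomial.C (a i)
      + MvPolynomial.C (M 0 i) * MvPolynomial.X 0 + MvPolynomial.C (M 1 i) * MvPolynomial.X 1 := by
  simp [affSub]

theorem totalDegree_affSub_X_le (a : Plane) (M : Fin 2 → Plane) (i : Fin 2) :
    (affSub a M (MvPolynomial.X i)).totalDegree ≤ 1 := by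
  have hmul (c : ℝ) (j : Fin 2) :
      (MvPolynomial.C c * MvPolynomial.X j : Poly).totalDegree ≤ 1 :=
    (MvPolynomial.totalDegree_mul _ _).trans (by simp)
  rw [affSub_X]
  refine (MvPolynomial.totalDegree_add _ _).trans (max_le ?_ (hmul _ _))
  exact (MvPolynomial.totalDegree_add _ _).trans (max_le (by simp) (hmul _ _))

theorem affSub_mem_polyLE (a : Plane) (M : Fin 2 → Plane) {p : Poly} {K : ℕ}
    (hp : p ∈ polyLE K) : affSub a M p ∈ polyLE K := by
  rw [polyLE, MvPolynomial.mem_restrictTotalDegree] at hp ⊢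
  have hmon (d : Fin 2 →₀ ℕ) (hd : d ∈ p.support) :
      (affSub a M (MvPolynomial.monomial d (p.coeff d))).totalDegree ≤ K := by
    rw [MvPolynomial.monomial_eq, map_mul, Finsupp.prod, map_prod]
    refine (MvPolynomial.totalDegree_mul _ _).trans ?_
    rw [← MvPolynomial.algebraMap_eq, AlgHom.commutes, MvPolynomial.algebraMap_eq,
      MvPolynomial.totalDegree_C, zero_add]
    refine (MvPolynomial.totalDegree_finsetProd _ _).trans ?_
    refine (Finset.sum_le_sum fun i _ => ?_).trans ((MvPolynomial.le_totalDegree hd).trans hp)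
    rw [map_pow]
    exact (MvPolynomial.totalDegree_pow _ _).trans
      (mul_le_of_le_one_right' (totalDegree_affSub_X_le a M i))
  rw [p.as_sum, map_sum]
  exact MvPolynomial.totalDegree_finsetSum_le hmon

theorem evalAt_affSub (a : Plane) (M : Fin 2 → Plane) (p : Poly) (y : Plane) :
    (affSub a M p).evalAt y = p.evalAt (a + y 0 • M 0 + y 1 • M 1) := by
  induction p using MvPolynomial.induction_on with
  | C c => simp [affSub]
  | add p q hp hq => simp [hp, hq]
  | mul_X p i hp => simp [hp, affSub_X, mul_comm]

theorem pderiv_affSub (a : Plane) (M : Fin 2 → Plane) (p : Poly) (j : Fin 2) :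
    MvPolynomial.pderiv j (affSub a M p)
      = MvPolynomial.C (M j 0) * affSub a M (MvPolynomial.pderiv 0 p)
        + MvPolynomial.C (M j 1) * affSub a M (MvPolynomial.pderiv 1 p) := by
  induction p using MvPolynomial.induction_on with
  | C c => simp [affSub]
  | add p q hp hq => simp only [map_add, hp, hq]; ring
  | mul_X p i hp =>
    rw [map_mul, Derivation.leibniz, hp, affSub_X]
    fin_cases i <;> fin_cases j <;> simp [MvPolynomial.pderiv_X, affSub_X] <;> ring

theorem pderiv_mem_polyLE {p : Poly} {K : ℕ} (hp : p ∈ polyLE K) (i : Fin 2) :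
    MvPolynomial.pderiv i p ∈ polyLE K := by
  rw [polyLE, MvPolynomial.mem_restrictTotalDegree] at hp ⊢
  conv_lhs => rw [p.as_sum, map_sum]
  refine MvPolynomial.totalDegree_finsetSum_le fun d hd => ?_
  rw [MvPolynomial.pderiv_monomial]
  exact (MvPolynomial.totalDegree_monomial_le _ _).trans
    ((Finsupp.degree_mono tsub_le_self).trans ((MvPolynomial.le_totalDegree hd).trans hp))

theorem eq_zero_of_forall_openRefTri {p : Poly} (h : ∀ y ∈ openRefTri, p.evalAt y = 0) :
    p = 0 := by
  refine MvPolynomial.funext_set (fun _ => Set.Ioo (0 : ℝ) (1 / 2))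
    (fun _ => Set.Ioo_infinite (by norm_num)) fun x hx => ?_
  obtain ⟨h0, h0'⟩ := hx 0 (Set.mem_univ _)
  obtain ⟨h1, h1'⟩ := hx 1 (Set.mem_univ _)
  simpa [Poly.evalAt] using h (WithLp.toLp 2 x) ⟨h0, h1, by change x 0 + x 1 < 1; linarith⟩

/-- The restriction of a polynomial to the line through `A` and `B`, in the parameter of
`AffineMap.lineMap A B`. -/
def onLine (A B : Plane) : Poly →ₐ[ℝ] Polynomial ℝ :=
  MvPolynomial.aeval fun i => Polynomial.C (A i) + Polynomial.C (B i - A i) * Polynomial.X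

theorem eval_onLine (A B : Plane) (p : Poly) (s : ℝ) :
    (onLine A B p).eval s = p.evalAt (AffineMap.lineMap A B s) := by
  induction p using MvPolynomial.induction_on with
  | C c => simp [onLine]
  | add p q hp hq => simp [hp, hq]
  | mul_X p i hp =>
    rw [map_mul, Polynomial.eval_mul, hp, evalAt_mul]
    simp [onLine, AffineMap.lineMap_apply, add_comm, mul_comm]

theorem onLine_mem_degreeLE (A B : Plane) {p : Poly} {K : ℕ} (hp : p ∈ polyLE K) :
    onLine A B p ∈ Polynomial.degreeLE ℝ (K : WithBot ℕ) := by
  have hlin : ∀ i : Fin 2,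
      (Polynomial.C (A i) + Polynomial.C (B i - A i) * Polynomial.X).natDegree ≤ 1 :=
    fun i => by compute_degree
  have h := MvPolynomial.aeval_natDegree_le p
    ((MvPolynomial.mem_restrictTotalDegree _ _ _).1 hp) _ hlin
  rw [mul_one] at h
  exact Polynomial.mem_degreeLE.2 (Polynomial.natDegree_le_iff_degree_le.1 h)

end Poly

@[simp] theorem vecAt_zero (q : Fin 2 → Poly) (x : Plane) : vecAt q x 0 = (q 0).evalAt x := rfl

@[simp] theorem vecAt_one (q : Fin 2 → Poly) (x : Plane) : vecAt q x 1 = (q 1).evalAt x := rfl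

theorem contDiff_vecAt (q : Fin 2 → Poly) {n : WithTop ℕ∞} : ContDiff ℝ n (vecAt q) := by
  refine contDiff_euclidean.2 fun i => ?_
  fin_cases i
  exacts [(q 0).contDiff, (q 1).contDiff]

theorem continuous_vecAt (q : Fin 2 → Poly) : Continuous (vecAt q) :=
  (contDiff_vecAt q).continuous (n := 0)

namespace Tri

/-- Transformation of a polynomial on `T` to the reference triangle. -/
def pull (T : Tri) : Poly →ₐ[ℝ] Poly := Poly.affSub (T 0) ![T 1 - T 0, T 2 - T 0]

/-- The derivative of `Tri.coord` in the direction of the `i`-th coordinate axis. -/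
def coordDir (T : Tri) (i : Fin 2) : Plane :=
  !₂[cross (EuclideanSpace.single i 1) (T 2 - T 0) / T.det,
    cross (T 1 - T 0) (EuclideanSpace.single i 1) / T.det]

/-- Transformation of a polynomial on the reference triangle to `T`, by substitution of
`Tri.coord`. -/
def push (T : Tri) : Poly →ₐ[ℝ] Poly := Poly.affSub (T.coord 0) T.coordDir

theorem evalAt_pull (T : Tri) (p : Poly) (y : Plane) :
    (T.pull p).evalAt y = p.evalAt (T.toPlane y) := by
  simp [pull, Poly.evalAt_affSub, toPlane, add_assoc]

theorem pull_mem_polyLE (T : Tri) {p : Poly} {K : ℕ} (hp : p ∈ polyLE K) : T.pull p ∈ polyLE K :=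
  Poly.affSub_mem_polyLE _ _ hp

theorem evalAt_push (T : Tri) (p : Poly) (x : Plane) :
    (T.push p).evalAt x = p.evalAt (T.coord x) := by
  rw [push, Poly.evalAt_affSub]
  congr 1
  apply plane_ext <;> simp [coord, coordDir, cross] <;> ring

theorem evalAt_pderiv_push (T : Tri) (p : Poly) (i : Fin 2) (x : Plane) :
    Poly.evalAt (MvPolynomial.pderiv i (T.push p)) x
      = T.coordDir i 0 * Poly.evalAt (MvPolynomial.pderiv 0 p) (T.coord x)
        + T.coordDir i 1 * Poly.evalAt (MvPolynomial.pderiv 1 p) (T.coord x) := by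
  simp [push, Poly.pderiv_affSub, ← evalAt_push]

end Tri

/-! ### Stokes' theorem on a triangle -/

theorem indicator_refTri (f : ℝ → ℝ → ℝ) (s t : ℝ) :
    ((fun p : ℝ × ℝ => (!₂[p.1, p.2] : Plane)) ⁻¹' refTri).indicator (fun p => f p.1 p.2) (s, t)
      = (Set.Icc 0 1).indicator (fun t => (Set.Icc 0 (1 - t)).indicator (f · t) s) t := by
  have h : (s, t) ∈ (fun p : ℝ × ℝ => (!₂[p.1, p.2] : Plane)) ⁻¹' refTri
      ↔ t ∈ Set.Icc 0 1 ∧ s ∈ Set.Icc 0 (1 - t) := by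
    change 0 ≤ s ∧ 0 ≤ t ∧ s + t ≤ 1 ↔ (0 ≤ t ∧ t ≤ 1) ∧ 0 ≤ s ∧ s ≤ 1 - t
    grind
  by_cases hst : (s, t) ∈ (fun p : ℝ × ℝ => (!₂[p.1, p.2] : Plane)) ⁻¹' refTri
  · rw [Set.indicator_of_mem hst, Set.indicator_of_mem (h.1 hst).1,
      Set.indicator_of_mem (h.1 hst).2]
  · rw [Set.indicator_of_notMem hst]
    symm
    simp only [Set.indicator_apply_eq_zero]
    exact fun ht hs => (hst (h.2 ⟨ht, hs⟩)).elim

theorem integral_refTri {g : Plane → ℝ} (hg : Continuous g) :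
    ∫ y in refTri, g y = ∫ t in (0 : ℝ)..1, ∫ s in (0 : ℝ)..(1 - t), g !₂[s, t] := by
  let Φ : ℝ × ℝ ≃ᵐ Plane :=
    MeasurableEquiv.finTwoArrow.symm.trans (MeasurableEquiv.toLp 2 (Fin 2 → ℝ))
  have hΦ : MeasurePreserving Φ :=
    (PiLp.volume_preserving_toLp (Fin 2)).comp (volume_preserving_finTwoArrow ℝ).symm
  have hint : IntegrableOn (fun p => g (Φ p)) (Φ ⁻¹' refTri) :=
    (hΦ.integrableOn_comp_preimage Φ.measurableEmbedding).2
      (hg.continuousOn.integrableOn_compact isCompact_refTri)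
  have hms : MeasurableSet (Φ ⁻¹' refTri) := Φ.measurable isCompact_refTri.measurableSet
  have hval (p : ℝ × ℝ) : Φ p = !₂[p.1, p.2] := by apply plane_ext <;> rfl
  rw [← hΦ.setIntegral_preimage_emb Φ.measurableEmbedding, ← integral_indicator hms,
    Measure.volume_eq_prod, integral_prod_symm _ ((integrable_indicator_iff hms).2 hint)]
  simp only [show ⇑Φ = fun p => !₂[p.1, p.2] from funext hval,
    indicator_refTri fun s t => g !₂[s, t]]
  rw [intervalIntegral.integral_of_le zero_le_one, ← integral_Icc_eq_integral_Ioc,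
    ← integral_indicator measurableSet_Icc]
  congr 1 with t
  by_cases ht : t ∈ Set.Icc (0 : ℝ) 1
  · simp only [Set.indicator_of_mem ht]
    rw [intervalIntegral.integral_of_le (by linarith [ht.2]), ← integral_Icc_eq_integral_Ioc,
      integral_indicator measurableSet_Icc]
  · simp only [Set.indicator_of_notMem ht, integral_zero]

theorem integral_refTri_fderiv {f : Plane → ℝ} (hf : ContDiff ℝ 1 f) :
    ∫ y in refTri, fderiv ℝ f y (EuclideanSpace.single 0 1)
      = (∫ t in (0 : ℝ)..1, f !₂[1 - t, t]) - ∫ t in (0 : ℝ)..1, f !₂[0, t] := by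
  have hc : Continuous fun y => fderiv ℝ f y (EuclideanSpace.single 0 1) :=
    (hf.continuous_fderiv one_ne_zero).clm_apply continuous_const
  have hderiv (s t : ℝ) :
      HasDerivAt (fun s => f !₂[s, t]) (fderiv ℝ f !₂[s, t] (EuclideanSpace.single 0 1)) s := by
    have hline : HasDerivAt (fun s : ℝ => (!₂[s, t] : Plane)) (EuclideanSpace.single 0 1) s := by
      have e : (fun s : ℝ => (!₂[s, t] : Plane))
          = fun s => !₂[0, t] + s • EuclideanSpace.single 0 1 := by
        funext r
        apply plane_ext <;> simp
      rw [e]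
      simpa using ((hasDerivAt_id s).smul_const
        (EuclideanSpace.single (0 : Fin 2) (1 : ℝ))).const_add (!₂[0, t] : Plane)
    exact ((hf.differentiable one_ne_zero) _).hasFDerivAt.comp_hasDerivAt s hline
  have hint {γ : ℝ → Plane} (hγ : Continuous γ) :
      IntervalIntegrable (fun t => f (γ t)) volume 0 1 :=
    (hf.continuous.comp hγ).intervalIntegrable _ _
  rw [integral_refTri hc, ← intervalIntegral.integral_sub (hint (by fun_prop))
    (hint (by fun_prop))]
  exact intervalIntegral.integral_congr fun t _ =>
    intervalIntegral.integral_eq_sub_of_hasDerivAt (fun s _ => hderiv s t)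
      ((hc.comp (by fun_prop)).intervalIntegrable _ _)

/-- The scalar curl `∂₁ u₀ - ∂₀ u₁` of a plane vector field, with the sign convention of
`polyCurl`. -/
def curlAt (u : Plane → Plane) (x : Plane) : ℝ :=
  fderiv ℝ u x (EuclideanSpace.single 1 1) 0 - fderiv ℝ u x (EuclideanSpace.single 0 1) 1

/-- The field `Curl ψ = (-∂₁ ψ, ∂₀ ψ)`. -/
def vecCurl (ψ : Poly) : Fin 2 → Poly :=
  ![-MvPolynomial.pderiv 1 ψ, MvPolynomial.pderiv 0 ψ]

/-- The divergence of a polynomial field. -/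
def polyDiv (q : Fin 2 → Poly) : Poly := MvPolynomial.pderiv 0 (q 0) + MvPolynomial.pderiv 1 (q 1)

theorem fderiv_apply_coord {u : Plane → Plane} {x : Plane} (hu : DifferentiableAt ℝ u x)
    (v : Plane) (i : Fin 2) : fderiv ℝ u x v i = fderiv ℝ (fun y => u y i) x v := by
  have h := ((EuclideanSpace.proj i : Plane →L[ℝ] ℝ).hasFDerivAt.comp x hu.hasFDerivAt).fderiv
  exact (congrArg (fun L => L v) h).symm

theorem fderiv_inner_sub_fderiv_inner {u : Plane → Plane} {x : Plane}
    (hu : DifferentiableAt ℝ u x) (v w : Plane) :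
    fderiv ℝ (fun x => ⟪u x, w⟫) x v - fderiv ℝ (fun x => ⟪u x, v⟫) x w
      = -(cross v w * curlAt u x) := by
  have h (v w : Plane) : fderiv ℝ (fun x => ⟪u x, w⟫) x v
      = ⟪v 0 • fderiv ℝ u x (EuclideanSpace.single 0 1)
        + v 1 • fderiv ℝ u x (EuclideanSpace.single 1 1), w⟫ := by
    conv_lhs => rw [fderiv_inner_apply ℝ hu (differentiableAt_const w), plane_eq_sum v]
    simp
  rw [h, h]
  simp only [plane_inner, curlAt, cross, PiLp.add_apply, PiLp.smul_apply, smul_eq_mul]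
  ring

theorem inner_gradient (φ : Plane → ℝ) (x v : Plane) : ⟪gradient φ x, v⟫ = fderiv ℝ φ x v := by
  rw [gradient, InnerProductSpace.toDual_symm_apply]

theorem gradient_apply (φ : Plane → ℝ) (x : Plane) (i : Fin 2) :
    gradient φ x i = fderiv ℝ φ x (EuclideanSpace.single i 1) := by
  rw [← inner_gradient, EuclideanSpace.inner_single_right, one_mul, conj_trivial]

theorem contDiff_gradient {φ : Plane → ℝ} (hφ : ContDiff ℝ 2 φ) : ContDiff ℝ 1 (gradient φ) :=
  (InnerProductSpace.toDual ℝ Plane).symm.toContinuousLinearEquiv.contDiff.comp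
    (hφ.fderiv_right (by norm_num))

theorem gradient_evalAt (p : Poly) (x : Plane) :
    gradient p.evalAt x = vecAt (polyGrad p) x := by
  apply plane_ext
  · rw [gradient_apply, Poly.fderiv_single]; rfl
  · rw [gradient_apply, Poly.fderiv_single]; rfl

theorem curlAt_vecAt (q : Fin 2 → Poly) (x : Plane) :
    curlAt (vecAt q) x = (polyCurl q).evalAt x := by
  have hd : DifferentiableAt ℝ (vecAt q) x := (contDiff_vecAt q).differentiable one_ne_zero x
  rw [curlAt, fderiv_apply_coord hd, fderiv_apply_coord hd]
  simp only [vecAt_zero, vecAt_one, polyCurl, Poly.evalAt_sub]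
  rw [← Poly.fderiv_single, ← Poly.fderiv_single]

theorem curlAt_gradient {φ : Plane → ℝ} (hφ : ContDiff ℝ 2 φ) (x : Plane) :
    curlAt (gradient φ) x = 0 := by
  have hd := (contDiff_gradient hφ).differentiable one_ne_zero x
  have hd' : DifferentiableAt ℝ (fderiv ℝ φ) x :=
    (hφ.fderiv_right (m := 1) (by norm_num)).differentiable one_ne_zero x
  have hsnd (i : Fin 2) (v : Plane) : fderiv ℝ (fun y => gradient φ y i) x v
      = fderiv ℝ (fderiv ℝ φ) x v (EuclideanSpace.single i 1) := by
    simp only [gradient_apply]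
    rw [fderiv_clm_apply hd' (differentiableAt_const _)]
    simp
  rw [curlAt, fderiv_apply_coord hd, fderiv_apply_coord hd, hsnd, hsnd, sub_eq_zero]
  exact hφ.contDiffAt.isSymmSndFDerivAt (by simp) _ _

theorem curlAt_smul (ψ : Poly) {u : Plane → Plane} (hu : ContDiff ℝ 1 u) (x : Plane) :
    curlAt (fun x => ψ.evalAt x • u x) x
      = ψ.evalAt x * curlAt u x - ⟪vecAt (vecCurl ψ) x, u x⟫ := by
  rw [curlAt, fderiv_fun_smul (ψ.differentiableAt x) (hu.differentiable one_ne_zero x)]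
  simp [curlAt, plane_inner, vecCurl, Poly.fderiv_single]
  ring

namespace Tri

theorem integral_fderiv_edge {T : Tri} (h : T.det ≠ 0) {g : Plane → ℝ} (hg : ContDiff ℝ 1 g) :
    ∫ x in T.carrier, fderiv ℝ g x (T 1 - T 0)
      = |T.det| * ((∫ t in (0 : ℝ)..1, g (AffineMap.lineMap (T 1) (T 2) t))
        - ∫ t in (0 : ℝ)..1, g (AffineMap.lineMap (T 0) (T 2) t)) := by
  have hchain (y : Plane) : fderiv ℝ g (T.toPlane y) (T 1 - T 0)
      = fderiv ℝ (g ∘ T.toPlane) y (EuclideanSpace.single 0 1) := by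
    rw [((hg.differentiable one_ne_zero _).hasFDerivAt.comp y (T.hasFDerivAt_toPlane y)).fderiv]
    simp [lin]
  have h12 (t : ℝ) : T.toPlane !₂[1 - t, t] = AffineMap.lineMap (T 1) (T 2) t := by
    apply plane_ext <;> simp [toPlane, AffineMap.lineMap_apply] <;> ring
  have h02 (t : ℝ) : T.toPlane !₂[0, t] = AffineMap.lineMap (T 0) (T 2) t := by
    apply plane_ext <;> simp [toPlane, AffineMap.lineMap_apply] <;> ring
  rw [integral_carrier h]
  simp only [hchain]
  rw [integral_refTri_fderiv (hg.comp T.contDiff_toPlane)]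
  simp only [Function.comp_apply, h12, h02]

/-- The same triangle with its last two vertices exchanged. -/
def swap (T : Tri) : Tri := ![T 0, T 2, T 1]

theorem det_swap (T : Tri) : T.swap.det = -T.det := by
  simp [swap, det, cross]
  ring

theorem carrier_swap (T : Tri) : T.swap.carrier = T.carrier := by
  rw [carrier, carrier, range_eq, range_eq, Set.pair_comm (T 1)]
  rfl

/-- The circulation of a vector field along the boundary, in the direction of the cyclic order of
the vertices. -/
def circulation (T : Tri) (u : Plane → Plane) : ℝ :=
  ∑ i, ∫ t in (0 : ℝ)..1,
    ⟪u (AffineMap.lineMap (T.edgeA i) (T.edgeB i) t), T.edgeB i - T.edgeA i⟫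

theorem circulation_eq {T : Tri} {u : Plane → Plane} (hu : Continuous u) :
    T.circulation u = (∫ t in (0 : ℝ)..1, ⟪u (AffineMap.lineMap (T 1) (T 2) t), T 2 - T 0⟫)
      - (∫ t in (0 : ℝ)..1, ⟪u (AffineMap.lineMap (T 0) (T 2) t), T 2 - T 0⟫)
      - ((∫ t in (0 : ℝ)..1, ⟪u (AffineMap.lineMap (T 2) (T 1) t), T 1 - T 0⟫)
      - ∫ t in (0 : ℝ)..1, ⟪u (AffineMap.lineMap (T 0) (T 1) t), T 1 - T 0⟫) := by
  have hrev (A B v : Plane) : ∫ t in (0 : ℝ)..1, ⟪u (AffineMap.lineMap A B t), v⟫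
      = ∫ t in (0 : ℝ)..1, ⟪u (AffineMap.lineMap B A t), v⟫ := by
    simpa [AffineMap.lineMap_apply_one_sub] using (intervalIntegral.integral_comp_sub_left
      (fun t => ⟪u (AffineMap.lineMap A B t), v⟫) (a := 0) (b := 1) 1).symm
  have hint (A B v : Plane) : IntervalIntegrable
      (fun t => ⟪u (AffineMap.lineMap A B t), v⟫) volume 0 1 :=
    ((hu.comp AffineMap.lineMap_continuous).inner continuous_const).intervalIntegrable _ _
  rw [circulation, Fin.sum_univ_three]
  simp only [edgeA, edgeB, Fin.isValue, zero_add, Fin.reduceAdd]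
  rw [hrev (T 2) (T 1), hrev (T 2) (T 0), ← neg_sub (T 2) (T 0),
    show T 2 - T 1 = (T 2 - T 0) - (T 1 - T 0) by abel]
  simp only [inner_sub_right _ (T 2 - T 0) (T 1 - T 0), inner_neg_right,
    intervalIntegral.integral_neg]
  rw [intervalIntegral.integral_sub (hint _ _ _) (hint _ _ _)]
  ring

theorem integral_curlAt {T : Tri} (h : T.det ≠ 0) {u : Plane → Plane} (hu : ContDiff ℝ 1 u) :
    ∫ x in T.carrier, curlAt u x = -(SignType.sign T.det * T.circulation u) := by
  have hC (v : Plane) : ContDiff ℝ 1 fun x => ⟪u x, v⟫ := hu.inner ℝ contDiff_const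
  have hint (v w : Plane) : IntegrableOn (fun x => fderiv ℝ (fun x => ⟪u x, v⟫) x w) T.carrier :=
    (((hC v).continuous_fderiv one_ne_zero).clm_apply
      continuous_const).continuousOn.integrableOn_compact T.isCompact_carrier
  have hT := integral_fderiv_edge h (hC (T 2 - T 0))
  have hswap : ∫ x in T.carrier, fderiv ℝ (fun x => ⟪u x, T 1 - T 0⟫) x (T 2 - T 0)
      = |T.det| * ((∫ t in (0 : ℝ)..1, ⟪u (AffineMap.lineMap (T 2) (T 1) t), T 1 - T 0⟫)
        - ∫ t in (0 : ℝ)..1, ⟪u (AffineMap.lineMap (T 0) (T 1) t), T 1 - T 0⟫) := by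
    rw [← carrier_swap, ← abs_neg, ← det_swap]
    exact integral_fderiv_edge (T := T.swap) (by rwa [det_swap, neg_ne_zero]) (hC (T 1 - T 0))
  have hkey : -T.det * ∫ x in T.carrier, curlAt u x = |T.det| * T.circulation u := by
    rw [← integral_const_mul, circulation_eq hu.continuous]
    simp only [det, neg_mul, ← fderiv_inner_sub_fderiv_inner (hu.differentiable one_ne_zero _)]
    rw [integral_sub (hint _ _) (hint _ _), hT, hswap, ← mul_sub]
    rfl
  rw [← self_mul_sign, mul_assoc] at hkey
  exact mul_left_cancel₀ (neg_ne_zero.2 h) (by rw [hkey]; ring)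

/-- A polynomial vanishes on the line that carries the `i`-th edge of `T`. -/
def VanishesOnEdge (T : Tri) (i : Fin 3) (ψ : Poly) : Prop :=
  ∀ t : ℝ, ψ.evalAt (AffineMap.lineMap (T.edgeA i) (T.edgeB i) t) = 0

theorem integral_inner_vecCurl {T : Tri} (h : T.det ≠ 0) (ψ : Poly) {u : Plane → Plane}
    (hu : ContDiff ℝ 1 u) :
    ∫ x in T.carrier, ⟪vecAt (vecCurl ψ) x, u x⟫ = (∫ x in T.carrier, ψ.evalAt x * curlAt u x)
      + SignType.sign T.det * T.circulation (fun x => ψ.evalAt x • u x) := by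
  have hψu : ContDiff ℝ 1 fun x => ψ.evalAt x • u x := ψ.contDiff.smul hu
  have hcurl : Continuous (curlAt u) := by
    have _hd := hu.continuous_fderiv one_ne_zero
    unfold curlAt
    fun_prop
  have hint {f : Plane → ℝ} (hf : Continuous f) : IntegrableOn f T.carrier :=
    hf.continuousOn.integrableOn_compact T.isCompact_carrier
  have hψcurl : IntegrableOn (fun x => ψ.evalAt x * curlAt u x) T.carrier :=
    hint (ψ.continuous.mul hcurl)
  have hinner : IntegrableOn (fun x => ⟪vecAt (vecCurl ψ) x, u x⟫) T.carrier :=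
    hint ((continuous_vecAt _).inner hu.continuous)
  have hstokes := integral_curlAt h hψu
  simp only [curlAt_smul ψ hu] at hstokes
  rw [integral_sub hψcurl hinner] at hstokes
  linarith

theorem integral_fderiv_eq_zero {T : Tri} (h : T.det ≠ 0) {f : Plane → ℝ} (hf : ContDiff ℝ 1 f)
    (hzero : ∀ i, ∀ t : ℝ, f (AffineMap.lineMap (T.edgeA i) (T.edgeB i) t) = 0) (v : Plane) :
    ∫ x in T.carrier, fderiv ℝ f x v = 0 := by
  let w : Plane := !₂[v 1, -v 0]
  have hcurl (x : Plane) : curlAt (fun x => f x • w) x = fderiv ℝ f x v := by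
    rw [curlAt, ((hf.differentiable one_ne_zero x).hasFDerivAt.smul_const w).fderiv]
    conv_rhs => rw [plane_eq_sum v]
    simp [w]
    ring
  have hcirc : T.circulation (fun x => f x • w) = 0 := by
    simp [circulation, hzero]
  have hfw : ContDiff ℝ 1 fun x => f x • w := hf.smul contDiff_const
  simpa only [hcurl, hcirc, mul_zero, neg_zero] using integral_curlAt h hfw

theorem integral_inner_gradient {T : Tri} (h : T.det ≠ 0) {Ψ : Fin 2 → Poly} {g : Plane → ℝ}
    (hg : ContDiff ℝ 1 g) (hΨ : ∀ j i, T.VanishesOnEdge i (Ψ j)) :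
    ∫ x in T.carrier, ⟪vecAt Ψ x, gradient g x⟫
      = -∫ x in T.carrier, (polyDiv Ψ).evalAt x * g x := by
  have hΨg (j : Fin 2) : ContDiff ℝ 1 fun x => (Ψ j).evalAt x * g x := (Ψ j).contDiff.mul hg
  have hint {f : Plane → ℝ} (hf : Continuous f) : IntegrableOn f T.carrier :=
    hf.continuousOn.integrableOn_compact T.isCompact_carrier
  have hdiv (j : Fin 2) (x : Plane) :
      fderiv ℝ (fun x => (Ψ j).evalAt x * g x) x (EuclideanSpace.single j 1)
        = (Ψ j).evalAt x * gradient g x j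
          + Poly.evalAt (MvPolynomial.pderiv j (Ψ j)) x * g x := by
    rw [fderiv_fun_mul ((Ψ j).differentiableAt x) (hg.differentiable one_ne_zero x),
      gradient_apply, ← Poly.fderiv_single]
    simp [mul_comm]
  have hzero (j : Fin 2) := integral_fderiv_eq_zero h (hΨg j)
    (fun i t => by rw [hΨ j i t, zero_mul]) (EuclideanSpace.single j 1)
  have hcont (j : Fin 2) : Continuous fun x =>
      fderiv ℝ (fun x => (Ψ j).evalAt x * g x) x (EuclideanSpace.single j 1) :=
    ((hΨg j).continuous_fderiv one_ne_zero).clm_apply continuous_const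
  have hgrad : Continuous (gradient g) :=
    (InnerProductSpace.toDual ℝ Plane).symm.continuous.comp (hg.continuous_fderiv one_ne_zero)
  have hinner : IntegrableOn (fun x => ⟪vecAt Ψ x, gradient g x⟫) T.carrier :=
    hint ((continuous_vecAt Ψ).inner hgrad)
  have hmul : IntegrableOn (fun x => (polyDiv Ψ).evalAt x * g x) T.carrier :=
    hint ((polyDiv Ψ).continuous.mul hg.continuous)
  have hsum : (fun x => ⟪vecAt Ψ x, gradient g x⟫ + (polyDiv Ψ).evalAt x * g x)
      = fun x => fderiv ℝ (fun x => (Ψ 0).evalAt x * g x) x (EuclideanSpace.single 0 1)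
        + fderiv ℝ (fun x => (Ψ 1).evalAt x * g x) x (EuclideanSpace.single 1 1) := by
    funext x
    simp only [hdiv, plane_inner, polyDiv, Poly.evalAt_add, vecAt_zero, vecAt_one]
    ring
  rw [← add_eq_zero_iff_eq_neg, ← integral_add hinner hmul, hsum,
    integral_add (hint (hcont 0)) (hint (hcont 1)), hzero, hzero, add_zero]

end Tri

/-! ### Bubble functions and inverse estimates -/

theorem memLp_of_isCompact {X E : Type*} [MeasurableSpace X] [TopologicalSpace X]
    [OpensMeasurableSpace X] [TopologicalSpace.PseudoMetrizableSpace X] [T2Space X]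
    {μ : Measure X} [IsFiniteMeasureOnCompacts μ] [NormedAddCommGroup E] {f : X → E}
    (hf : Continuous f) {s : Set X} (hs : IsCompact s) {p : ENNReal} :
    MemLp f p (μ.restrict s) := by
  have : IsFiniteMeasure (μ.restrict s) := ⟨by
    rw [Measure.restrict_apply_univ]
    exact hs.measure_lt_top⟩
  obtain ⟨C, hC⟩ := hs.exists_bound_of_continuousOn hf.continuousOn
  refine MemLp.of_bound (hf.continuousOn.aestronglyMeasurable_of_isCompact hs hs.measurableSet) C ?_
  filter_upwards [ae_restrict_mem hs.measurableSet] with x hx using hC x hx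

section LpNorms

variable {X Y E F V : Type*} [MeasurableSpace X] [MeasurableSpace Y]
  {μ : Measure X} {ν : Measure Y}
  [NormedAddCommGroup E] [InnerProductSpace ℝ E] [NormedAddCommGroup F] [InnerProductSpace ℝ F]

theorem norm_toLp_sq {f : X → E} (hf : MemLp f 2 μ) : ‖hf.toLp‖ ^ 2 = ∫ x, ‖f x‖ ^ 2 ∂μ := by
  rw [← real_inner_self_eq_norm_sq, L2.inner_def]
  refine integral_congr_ae ?_
  filter_upwards [hf.coeFn_toLp] with x hx
  rw [hx, real_inner_self_eq_norm_sq]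

variable [AddCommGroup V] [Module ℝ V]

/-- A linear family of square integrable functions as a linear map to `L²`. -/
def toLpLin (L : V →ₗ[ℝ] X → E) (h : ∀ v, MemLp (L v) 2 μ) : V →ₗ[ℝ] Lp E 2 μ where
  toFun v := (h v).toLp
  map_add' v w := by
    rw [← MemLp.toLp_add]
    exact MemLp.toLp_congr _ _ (by rw [map_add])
  map_smul' c v := by
    rw [RingHom.id_apply, ← MemLp.toLp_const_smul]
    exact MemLp.toLp_congr _ _ (by rw [map_smul])

/-- All norms on a finite dimensional space are equivalent. -/
theorem exists_integral_norm_sq_le [FiniteDimensional ℝ V] {L₁ : V →ₗ[ℝ] X → E}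
    {L₂ : V →ₗ[ℝ] Y → F} (h₁ : ∀ v, MemLp (L₁ v) 2 μ) (h₂ : ∀ v, MemLp (L₂ v) 2 ν)
    (hinj : ∀ v, L₁ v =ᵐ[μ] 0 → v = 0) :
    ∃ C : ℝ, 0 < C ∧ ∀ v, ∫ y, ‖L₂ v y‖ ^ 2 ∂ν ≤ C * ∫ x, ‖L₁ v x‖ ^ 2 ∂μ := by
  have hker : LinearMap.ker (toLpLin L₁ h₁) = ⊥ := LinearMap.ker_eq_bot'.2 fun v hv =>
    hinj v ((h₁ v).coeFn_toLp.symm.trans ((Lp.eq_zero_iff_ae_eq_zero).1 hv))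
  let e := LinearEquiv.ofInjective (toLpLin L₁ h₁) (LinearMap.ker_eq_bot.1 hker)
  let g := LinearMap.toContinuousLinearMap
    (toLpLin L₂ h₂ ∘ₗ (e.symm : LinearMap.range (toLpLin L₁ h₁) →ₗ[ℝ] V))
  refine ⟨‖g‖ ^ 2 + 1, by positivity, fun v => ?_⟩
  have hle : ‖(h₂ v).toLp‖ ≤ ‖g‖ * ‖(h₁ v).toLp‖ := by
    have hg : g (e v) = toLpLin L₂ h₂ v := by simp [g]
    exact (congrArg norm hg).ge.trans (g.le_opNorm (e v))
  calc ∫ y, ‖L₂ v y‖ ^ 2 ∂ν = ‖(h₂ v).toLp‖ ^ 2 := (norm_toLp_sq _).symm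
    _ ≤ ‖g‖ ^ 2 * ‖(h₁ v).toLp‖ ^ 2 := by rw [← mul_pow]; gcongr
    _ ≤ (‖g‖ ^ 2 + 1) * ‖(h₁ v).toLp‖ ^ 2 := by gcongr; linarith
    _ = _ := by rw [norm_toLp_sq]

end LpNorms

instance (K : ℕ) : FiniteDimensional ℝ (polyLE K) :=
  inferInstanceAs (Module.Finite ℝ (MvPolynomial.restrictTotalDegree (Fin 2) ℝ K))

instance (K : ℕ) : FiniteDimensional ℝ (Polynomial.degreeLE ℝ (K : WithBot ℕ)) := by
  classical
  rw [Polynomial.degreeLE_eq_span_X_pow]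
  exact FiniteDimensional.span_finset ℝ _

namespace Poly

/-- Evaluation of polynomials, as a linear map. -/
def evalLin : Poly →ₗ[ℝ] Plane → ℝ where
  toFun p := p.evalAt
  map_add' p q := by ext x; simp
  map_smul' c p := by ext x; simp

/-- The gradient of polynomials, as a linear map. -/
def gradLin : Poly →ₗ[ℝ] Plane → Plane where
  toFun p := vecAt (polyGrad p)
  map_add' p q := by ext x i; fin_cases i <;> simp [polyGrad]
  map_smul' c p := by ext x i; fin_cases i <;> simp [polyGrad]

theorem eq_zero_of_ae_refTri {p : Poly} (h : p.evalAt =ᵐ[volume.restrict refTri] 0) : p = 0 :=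
  eq_zero_of_forall_openRefTri <| Measure.eqOn_open_of_ae_eq
    (ae_restrict_of_ae_restrict_of_subset openRefTri_subset_refTri h) isOpen_openRefTri
    p.continuous.continuousOn continuousOn_const

theorem exists_integral_refTri_sq_le (K : ℕ) (B : Poly →ₗ[ℝ] Poly) :
    ∃ C : ℝ, 0 < C ∧ ∀ p ∈ polyLE K,
      ∫ y in refTri, (B p).evalAt y ^ 2 ≤ C * ∫ y in refTri, p.evalAt y ^ 2 := by
  obtain ⟨C, hC, h⟩ := exists_integral_norm_sq_le
    (μ := volume.restrict refTri) (ν := volume.restrict refTri)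
    (L₁ := evalLin ∘ₗ (polyLE K).subtype) (L₂ := evalLin ∘ₗ B ∘ₗ (polyLE K).subtype)
    (fun p => memLp_of_isCompact p.1.continuous isCompact_refTri)
    (fun p => memLp_of_isCompact (B p).continuous isCompact_refTri)
    fun p hp => Subtype.ext (eq_zero_of_ae_refTri hp)
  exact ⟨C, hC, fun p hp => by simpa [evalLin] using h ⟨p, hp⟩⟩

theorem exists_integral_refTri_grad_sq_le (K : ℕ) (B : Poly →ₗ[ℝ] Poly) :
    ∃ C : ℝ, 0 < C ∧ ∀ p ∈ polyLE K,
      ∫ y in refTri, ‖vecAt (polyGrad (B p)) y‖ ^ 2 ≤ C * ∫ y in refTri, p.evalAt y ^ 2 := by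
  obtain ⟨C, hC, h⟩ := exists_integral_norm_sq_le
    (μ := volume.restrict refTri) (ν := volume.restrict refTri)
    (L₁ := evalLin ∘ₗ (polyLE K).subtype) (L₂ := gradLin ∘ₗ B ∘ₗ (polyLE K).subtype)
    (fun p => memLp_of_isCompact p.1.continuous isCompact_refTri)
    (fun p => memLp_of_isCompact (continuous_vecAt _) isCompact_refTri)
    fun p hp => Subtype.ext (eq_zero_of_ae_refTri hp)
  exact ⟨C, hC, fun p hp => by simpa [evalLin, gradLin] using h ⟨p, hp⟩⟩

theorem exists_integral_refTri_sq_le_mul (K : ℕ) {b : Poly} (hb : b ≠ 0) :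
    ∃ C : ℝ, 0 < C ∧ ∀ p ∈ polyLE K,
      ∫ y in refTri, p.evalAt y ^ 2 ≤ C * ∫ y in refTri, (b * p).evalAt y ^ 2 := by
  obtain ⟨C, hC, h⟩ := exists_integral_norm_sq_le
    (μ := volume.restrict refTri) (ν := volume.restrict refTri)
    (L₁ := evalLin ∘ₗ LinearMap.mulLeft ℝ b ∘ₗ (polyLE K).subtype)
    (L₂ := evalLin ∘ₗ (polyLE K).subtype)
    (fun p => memLp_of_isCompact (b * p.1).continuous isCompact_refTri)
    (fun p => memLp_of_isCompact p.1.continuous isCompact_refTri)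
    fun p hp => Subtype.ext ((mul_eq_zero.1 (eq_zero_of_ae_refTri hp)).resolve_left hb)
  exact ⟨C, hC, fun p hp => by simpa [evalLin, mul_pow] using h ⟨p, hp⟩⟩

end Poly

/-- Evaluation of univariate polynomials, as a linear map. -/
def polynomialEvalLin : Polynomial ℝ →ₗ[ℝ] ℝ → ℝ where
  toFun p := fun s => p.eval s
  map_add' p q := by ext x; simp
  map_smul' c p := by ext x; simp

theorem memLp_polynomial_eval (p : Polynomial ℝ) :
    MemLp (fun s => p.eval s) 2 (volume.restrict (Set.Ioc (0 : ℝ) 1)) :=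
  (memLp_of_isCompact p.continuous isCompact_Icc).mono_measure
    (Measure.restrict_mono Set.Ioc_subset_Icc_self le_rfl)

theorem polynomial_eq_zero_of_ae {p : Polynomial ℝ}
    (h : (fun s => p.eval s) =ᵐ[volume.restrict (Set.Ioc (0 : ℝ) 1)] 0) : p = 0 := by
  have hIoo := Measure.eqOn_open_of_ae_eq
    (ae_restrict_of_ae_restrict_of_subset Set.Ioo_subset_Ioc_self h) isOpen_Ioo
    p.continuous.continuousOn continuousOn_const
  exact Polynomial.eq_zero_of_infinite_isRoot p
    ((Set.Ioo_infinite zero_lt_one).mono fun s hs => hIoo hs)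

theorem exists_integral_edge_sq_le_mul (K : ℕ) {b : Polynomial ℝ} (hb : b ≠ 0) :
    ∃ C : ℝ, 0 < C ∧ ∀ J ∈ Polynomial.degreeLE ℝ (K : WithBot ℕ),
      ∫ s in (0 : ℝ)..1, J.eval s ^ 2 ≤ C * ∫ s in (0 : ℝ)..1, (b * J).eval s ^ 2 := by
  obtain ⟨C, hC, h⟩ := exists_integral_norm_sq_le
    (L₁ := polynomialEvalLin ∘ₗ LinearMap.mulLeft ℝ b
      ∘ₗ (Polynomial.degreeLE ℝ (K : WithBot ℕ)).subtype)
    (L₂ := polynomialEvalLin ∘ₗ (Polynomial.degreeLE ℝ (K : WithBot ℕ)).subtype)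
    (fun J => memLp_polynomial_eval (b * J.1)) (fun J => memLp_polynomial_eval J.1)
    fun J hJ => Subtype.ext ((mul_eq_zero.1 (polynomial_eq_zero_of_ae hJ)).resolve_left hb)
  simp only [intervalIntegral.integral_of_le zero_le_one]
  exact ⟨C, hC, fun J hJ => by simpa [polynomialEvalLin, mul_pow] using h ⟨J, hJ⟩⟩

theorem exists_integral_refTri_sq_le_edge (K : ℕ) (B : Polynomial ℝ →ₗ[ℝ] Poly) :
    ∃ C : ℝ, 0 < C ∧ ∀ J ∈ Polynomial.degreeLE ℝ (K : WithBot ℕ),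
      ∫ y in refTri, (B J).evalAt y ^ 2 ≤ C * ∫ s in (0 : ℝ)..1, J.eval s ^ 2 := by
  obtain ⟨C, hC, h⟩ := exists_integral_norm_sq_le (ν := volume.restrict refTri)
    (L₁ := polynomialEvalLin ∘ₗ (Polynomial.degreeLE ℝ (K : WithBot ℕ)).subtype)
    (L₂ := Poly.evalLin ∘ₗ B ∘ₗ (Polynomial.degreeLE ℝ (K : WithBot ℕ)).subtype)
    (fun J => memLp_polynomial_eval J.1)
    (fun J => memLp_of_isCompact (B J).continuous isCompact_refTri)
    fun J hJ => Subtype.ext (polynomial_eq_zero_of_ae hJ)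
  simp only [intervalIntegral.integral_of_le zero_le_one]
  exact ⟨C, hC, fun J hJ => by simpa [polynomialEvalLin, Poly.evalLin] using h ⟨J, hJ⟩⟩

theorem exists_integral_refTri_grad_sq_le_edge (K : ℕ) (B : Polynomial ℝ →ₗ[ℝ] Poly) :
    ∃ C : ℝ, 0 < C ∧ ∀ J ∈ Polynomial.degreeLE ℝ (K : WithBot ℕ),
      ∫ y in refTri, ‖vecAt (polyGrad (B J)) y‖ ^ 2
        ≤ C * ∫ s in (0 : ℝ)..1, J.eval s ^ 2 := by
  obtain ⟨C, hC, h⟩ := exists_integral_norm_sq_le (ν := volume.restrict refTri)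
    (L₁ := polynomialEvalLin ∘ₗ (Polynomial.degreeLE ℝ (K : WithBot ℕ)).subtype)
    (L₂ := Poly.gradLin ∘ₗ B ∘ₗ (Polynomial.degreeLE ℝ (K : WithBot ℕ)).subtype)
    (fun J => memLp_polynomial_eval J.1)
    (fun J => memLp_of_isCompact (continuous_vecAt _) isCompact_refTri)
    fun J hJ => Subtype.ext (polynomial_eq_zero_of_ae hJ)
  simp only [intervalIntegral.integral_of_le zero_le_one]
  exact ⟨C, hC, fun J hJ => by simpa [polynomialEvalLin, Poly.gradLin] using h ⟨J, hJ⟩⟩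

/-- The cubic bubble function of the reference triangle. -/
def bubble : Poly :=
  MvPolynomial.X 0 * MvPolynomial.X 1 * (1 - MvPolynomial.X 0 - MvPolynomial.X 1)

theorem evalAt_bubble (y : Plane) : bubble.evalAt y = y 0 * y 1 * (1 - y 0 - y 1) := by
  simp [bubble]

theorem bubble_ne_zero : bubble ≠ 0 := by
  intro h
  have hval := evalAt_bubble !₂[1 / 4, 1 / 4]
  rw [h] at hval
  norm_num at hval

/-- The extension of a polynomial on the edge from `(0, 0)` to `(1, 0)` to a function on the
reference triangle, weighted with the square of the bubble function of this edge. -/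
def edgeBubble : Polynomial ℝ →ₗ[ℝ] Poly :=
  LinearMap.mulLeft ℝ (((1 - MvPolynomial.X 0 - MvPolynomial.X 1) * MvPolynomial.X 0) ^ 2)
    ∘ₗ (Polynomial.aeval (MvPolynomial.X 0 : Poly)).toLinearMap

theorem evalAt_edgeBubble (J : Polynomial ℝ) (y : Plane) :
    (edgeBubble J).evalAt y = ((1 - y 0 - y 1) * y 0) ^ 2 * J.eval (y 0) := by
  have haeval : Poly.evalAt (Polynomial.aeval (MvPolynomial.X 0 : Poly) J) y = J.eval (y 0) := by
    induction J using Polynomial.induction_on' with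
    | add p q hp hq => simp only [map_add, Poly.evalAt_add, hp, hq, Polynomial.eval_add]
    | monomial n a => simp [Polynomial.aeval_monomial, MvPolynomial.algebraMap_eq]
  simp [edgeBubble, haeval]

namespace Tri

theorem dist_le_diam (T : Tri) (i j : Fin 3) : dist (T i) (T j) ≤ T.diam :=
  Metric.dist_le_diam_of_mem T.isCompact_carrier.isBounded
    (subset_convexHull ℝ _ (Set.mem_range_self i)) (subset_convexHull ℝ _ (Set.mem_range_self j))

theorem norm_sub_sq_le_diam_sq (T : Tri) (i j : Fin 3) : ‖T i - T j‖ ^ 2 ≤ T.diam ^ 2 := by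
  rw [← dist_eq_norm]
  exact pow_le_pow_left₀ dist_nonneg (T.dist_le_diam i j) 2

theorem abs_det_le (T : Tri) : |T.det| ≤ T.diam ^ 2 := by
  have h1 := T.norm_sub_sq_le_diam_sq 1 0
  have h2 := T.norm_sub_sq_le_diam_sq 2 0
  rw [plane_norm_sq] at h1 h2
  rw [det, cross, abs_le]
  constructor <;>
    nlinarith [sq_nonneg ((T 1 - T 0) 0 - (T 2 - T 0) 1), sq_nonneg ((T 1 - T 0) 1 - (T 2 - T 0) 0),
      sq_nonneg ((T 1 - T 0) 0 + (T 2 - T 0) 1), sq_nonneg ((T 1 - T 0) 1 + (T 2 - T 0) 0)]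

theorem norm_sq_grad_push_le {T : Tri} (h : T.det ≠ 0) (p : Poly) (x : Plane) :
    T.det ^ 2 * ‖vecAt (polyGrad (T.push p)) x‖ ^ 2
      ≤ 2 * T.diam ^ 2 * ‖vecAt (polyGrad p) (T.coord x)‖ ^ 2 := by
  have hdir (i : Fin 2) : (T.det * T.coordDir i 0) ^ 2 + (T.det * T.coordDir i 1) ^ 2
      = (T 2 - T 0) (1 - i) ^ 2 + (T 1 - T 0) (1 - i) ^ 2 := by
    fin_cases i <;> simp [coordDir, cross, mul_div_cancel₀ _ h] <;> ring
  have hrow (i : Fin 2) : T.det ^ 2 * Poly.evalAt (MvPolynomial.pderiv i (T.push p)) x ^ 2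
      ≤ ((T 2 - T 0) (1 - i) ^ 2 + (T 1 - T 0) (1 - i) ^ 2)
        * ‖vecAt (polyGrad p) (T.coord x)‖ ^ 2 := by
    rw [evalAt_pderiv_push, ← hdir, plane_norm_sq, vecAt_zero, vecAt_one, polyGrad, polyGrad]
    set P₀ := Poly.evalAt (MvPolynomial.pderiv 0 p) (T.coord x)
    set P₁ := Poly.evalAt (MvPolynomial.pderiv 1 p) (T.coord x)
    linarith [sq_nonneg (T.det * T.coordDir i 0 * P₁ - T.det * T.coordDir i 1 * P₀)]
  have h1 := T.norm_sub_sq_le_diam_sq 1 0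
  have h2 := T.norm_sub_sq_le_diam_sq 2 0
  calc T.det ^ 2 * ‖vecAt (polyGrad (T.push p)) x‖ ^ 2
      ≤ (‖T 2 - T 0‖ ^ 2 + ‖T 1 - T 0‖ ^ 2) * ‖vecAt (polyGrad p) (T.coord x)‖ ^ 2 := by
        have hr0 := hrow 0
        have hr1 := hrow 1
        simp only [sub_zero, sub_self] at hr0 hr1
        rw [plane_norm_sq (vecAt _ x), plane_norm_sq (T 2 - T 0), plane_norm_sq (T 1 - T 0)]
        simp only [vecAt_zero, vecAt_one, polyGrad] at hr0 hr1 ⊢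
        linarith
    _ ≤ _ := by gcongr; linarith

theorem integral_norm_sq_grad_push_le {T : Tri} (h : T.det ≠ 0) (p : Poly) :
    |T.det| * ∫ x in T.carrier, ‖vecAt (polyGrad (T.push p)) x‖ ^ 2
      ≤ 2 * T.diam ^ 2 * ∫ y in refTri, ‖vecAt (polyGrad p) y‖ ^ 2 := by
  have hint {f : Plane → Plane} (hf : Continuous f) :
      IntegrableOn (fun y => ‖f y‖ ^ 2) refTri :=
    (hf.norm.pow 2).continuousOn.integrableOn_compact isCompact_refTri
  rw [integral_carrier h, ← mul_assoc, abs_mul_abs_self, ← sq, ← integral_const_mul,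
    ← integral_const_mul]
  refine integral_mono ((hint ((continuous_vecAt _).comp T.continuous_toPlane)).const_mul _)
    ((hint (continuous_vecAt _)).const_mul _) fun y => ?_
  simpa only [coord_toPlane h] using norm_sq_grad_push_le h p (T.toPlane y)

theorem coord_lineMap {T : Tri} (h : T.det ≠ 0) (s : ℝ) :
    T.coord (AffineMap.lineMap (T.edgeA 0) (T.edgeB 0) s) = !₂[1 - s, s]
      ∧ T.coord (AffineMap.lineMap (T.edgeA 1) (T.edgeB 1) s) = !₂[0, 1 - s]
      ∧ T.coord (AffineMap.lineMap (T.edgeA 2) (T.edgeB 2) s) = !₂[s, 0] := by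
  have hpt {x y : Plane} (hxy : x = T.toPlane y) : T.coord x = y := by rw [hxy, coord_toPlane h]
  refine ⟨hpt ?_, hpt ?_, hpt ?_⟩ <;>
    apply plane_ext <;> simp [toPlane, AffineMap.lineMap_apply, edgeA, edgeB] <;> ring

/-- The product of a polynomial with the square of the cubic bubble function of `T`. -/
def bubbleMul (T : Tri) (r : Poly) : Poly := T.push (bubble ^ 2 * T.pull r)

/-- A polynomial that vanishes on the edges of `T` other than the one from `T 0` to `T 1`, where it
is the product of `J` with the square of the quadratic bubble function. -/
def edgeLift (T : Tri) (J : Polynomial ℝ) : Poly := T.push (edgeBubble J)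

theorem vanishesOnEdge_bubbleMul {T : Tri} (h : T.det ≠ 0) (r : Poly) (i : Fin 3) :
    T.VanishesOnEdge i (T.bubbleMul r) := by
  intro t
  rw [bubbleMul, evalAt_push, Poly.evalAt_mul, Poly.evalAt_pow, evalAt_bubble]
  obtain ⟨h0, h1, h2⟩ := coord_lineMap h t
  fin_cases i <;> simp [h0, h1, h2]

theorem vanishesOnEdge_edgeLift {T : Tri} (h : T.det ≠ 0) (J : Polynomial ℝ) {i : Fin 3}
    (hi : i ≠ 2) : T.VanishesOnEdge i (T.edgeLift J) := by
  intro t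
  rw [edgeLift, evalAt_push, evalAt_edgeBubble]
  obtain ⟨h0, h1, -⟩ := coord_lineMap h t
  fin_cases i <;> simp_all

theorem evalAt_edgeLift_lineMap {T : Tri} (h : T.det ≠ 0) (J : Polynomial ℝ) (t : ℝ) :
    (T.edgeLift J).evalAt (AffineMap.lineMap (T.edgeA 2) (T.edgeB 2) t)
      = ((1 - t) * t) ^ 2 * J.eval t := by
  rw [edgeLift, evalAt_push, evalAt_edgeBubble, (coord_lineMap h t).2.2]
  simp

section Scaling

variable (K : ℕ)

theorem exists_integral_sq_le_bubbleMul : ∃ C : ℝ, 0 < C ∧ ∀ T : Tri, T.det ≠ 0 →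
    ∀ r ∈ polyLE K, ∫ x in T.carrier, r.evalAt x ^ 2
      ≤ C * ∫ x in T.carrier, (T.bubbleMul r).evalAt x * r.evalAt x := by
  obtain ⟨C, hC, hle⟩ := Poly.exists_integral_refTri_sq_le_mul K bubble_ne_zero
  refine ⟨C, hC, fun T h r hr => ?_⟩
  have hpull (y : Plane) : (T.bubbleMul r).evalAt (T.toPlane y) * r.evalAt (T.toPlane y)
      = (bubble * T.pull r).evalAt y ^ 2 := by
    simp only [bubbleMul, evalAt_push, coord_toPlane h, Poly.evalAt_mul, Poly.evalAt_pow,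
      evalAt_pull]
    ring
  simp only [integral_carrier h, hpull, mul_left_comm C]
  simp only [← evalAt_pull]
  gcongr
  exact hle _ (T.pull_mem_polyLE hr)

theorem exists_integral_bubbleMul_sq_le : ∃ C : ℝ, 0 < C ∧ ∀ T : Tri, T.det ≠ 0 →
    ∀ r ∈ polyLE K, ∫ x in T.carrier, (T.bubbleMul r).evalAt x ^ 2
      ≤ C * ∫ x in T.carrier, r.evalAt x ^ 2 := by
  obtain ⟨C, hC, hle⟩ := Poly.exists_integral_refTri_sq_le K (LinearMap.mulLeft ℝ (bubble ^ 2))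
  refine ⟨C, hC, fun T h r hr => ?_⟩
  simp only [integral_carrier h, bubbleMul, evalAt_push, coord_toPlane h, ← evalAt_pull,
    mul_left_comm C]
  gcongr
  exact hle _ (T.pull_mem_polyLE hr)

theorem exists_integral_grad_bubbleMul_sq_le : ∃ C : ℝ, 0 < C ∧ ∀ (T : Tri) (κ : ℝ), T.det ≠ 0 →
    T.diam ^ 2 ≤ κ * |T.det| → ∀ r ∈ polyLE K,
      T.diam ^ 2 * ∫ x in T.carrier, ‖vecAt (polyGrad (T.bubbleMul r)) x‖ ^ 2
        ≤ C * κ ^ 2 * ∫ x in T.carrier, r.evalAt x ^ 2 := by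
  obtain ⟨C, hC, hle⟩ := Poly.exists_integral_refTri_grad_sq_le K (LinearMap.mulLeft ℝ (bubble ^ 2))
  refine ⟨2 * C, by positivity, fun T κ h hκ r hr => ?_⟩
  have hκ0 : 0 ≤ κ := nonneg_of_mul_nonneg_left ((sq_nonneg _).trans hκ) (abs_pos.2 h)
  calc T.diam ^ 2 * ∫ x in T.carrier, ‖vecAt (polyGrad (T.bubbleMul r)) x‖ ^ 2
      ≤ κ * |T.det| * ∫ x in T.carrier, ‖vecAt (polyGrad (T.bubbleMul r)) x‖ ^ 2 := by gcongr
    _ = κ * (|T.det| * ∫ x in T.carrier, ‖vecAt (polyGrad (T.bubbleMul r)) x‖ ^ 2) := by ring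
    _ ≤ κ * (2 * T.diam ^ 2 * ∫ y in refTri, ‖vecAt (polyGrad (bubble ^ 2 * T.pull r)) y‖ ^ 2) :=
        mul_le_mul_of_nonneg_left (integral_norm_sq_grad_push_le h _) hκ0
    _ ≤ κ * (2 * (κ * |T.det|) * (C * ∫ y in refTri, (T.pull r).evalAt y ^ 2)) := by
        gcongr
        exact hle _ (T.pull_mem_polyLE hr)
    _ = 2 * C * κ ^ 2 * ∫ x in T.carrier, r.evalAt x ^ 2 := by
        simp only [integral_carrier h, evalAt_pull]
        ring

theorem exists_integral_edgeLift_sq_le : ∃ C : ℝ, 0 < C ∧ ∀ T : Tri, T.det ≠ 0 →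
    ∀ J ∈ Polynomial.degreeLE ℝ (K : WithBot ℕ), ∫ x in T.carrier, (T.edgeLift J).evalAt x ^ 2
      ≤ C * T.diam ^ 2 * ∫ s in (0 : ℝ)..1, J.eval s ^ 2 := by
  obtain ⟨C, hC, hle⟩ := exists_integral_refTri_sq_le_edge K edgeBubble
  refine ⟨C, hC, fun T h J hJ => ?_⟩
  simp only [integral_carrier h, edgeLift, evalAt_push, coord_toPlane h]
  calc |T.det| * ∫ y in refTri, (edgeBubble J).evalAt y ^ 2
      ≤ T.diam ^ 2 * (C * ∫ s in (0 : ℝ)..1, J.eval s ^ 2) :=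
        mul_le_mul T.abs_det_le (hle J hJ) (integral_nonneg fun _ => sq_nonneg _) (sq_nonneg _)
    _ = _ := by ring

theorem exists_integral_grad_edgeLift_sq_le : ∃ C : ℝ, 0 < C ∧ ∀ (T : Tri) (κ : ℝ), T.det ≠ 0 →
    T.diam ^ 2 ≤ κ * |T.det| → ∀ J ∈ Polynomial.degreeLE ℝ (K : WithBot ℕ),
      ∫ x in T.carrier, ‖vecAt (polyGrad (T.edgeLift J)) x‖ ^ 2
        ≤ C * κ * ∫ s in (0 : ℝ)..1, J.eval s ^ 2 := by
  obtain ⟨C, hC, hle⟩ := exists_integral_refTri_grad_sq_le_edge K edgeBubble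
  refine ⟨2 * C, by positivity, fun T κ h hκ J hJ => ?_⟩
  refine le_of_mul_le_mul_left ?_ (abs_pos.2 h)
  calc |T.det| * ∫ x in T.carrier, ‖vecAt (polyGrad (T.edgeLift J)) x‖ ^ 2
      ≤ 2 * T.diam ^ 2 * ∫ y in refTri, ‖vecAt (polyGrad (edgeBubble J)) y‖ ^ 2 :=
        integral_norm_sq_grad_push_le h _
    _ ≤ 2 * (κ * |T.det|) * (C * ∫ s in (0 : ℝ)..1, J.eval s ^ 2) :=
        mul_le_mul (by gcongr) (hle J hJ) (integral_nonneg fun _ => sq_nonneg _)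
          (mul_nonneg zero_le_two ((sq_nonneg _).trans hκ))
    _ = _ := by ring

end Scaling

end Tri

/-! ### Shape regularity and conforming meshes -/

namespace Tri

/-- The squared length of the refinement edge plus four times the squared length of the median on
it. Like the area, this number is halved by newest vertex bisection. -/
def quad (T : Tri) : ℝ := ‖T 1 - T 0‖ ^ 2 + 4 * ‖T 2 - midpoint ℝ (T 0) (T 1)‖ ^ 2

theorem midpoint_apply (a b : Plane) (i : Fin 2) : midpoint ℝ a b i = (a i + b i) / 2 := by
  simp only [midpoint_eq_smul_add, invOf_eq_inv, PiLp.smul_apply, PiLp.add_apply, smul_eq_mul]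
  ring

theorem quad_child₁ (T : Tri) : T.child₁.quad = T.quad / 2 := by
  simp [quad, child₁, plane_norm_sq, midpoint_apply]
  ring

theorem quad_child₂ (T : Tri) : T.child₂.quad = T.quad / 2 := by
  simp [quad, child₂, plane_norm_sq, midpoint_apply]
  ring

theorem abs_det_child₁ (T : Tri) : |T.child₁.det| = |T.det| / 2 := by
  have h : T.child₁.det = -(T.det / 2) := by
    simp [det, child₁, cross]
    ring
  rw [h, abs_neg, abs_div, abs_two]

theorem abs_det_child₂ (T : Tri) : |T.child₂.det| = |T.det| / 2 := by
  have h : T.child₂.det = T.det / 2 := by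
    simp [det, child₂, cross]
    ring
  rw [h, abs_div, abs_two]

theorem quad_nonneg (T : Tri) : 0 ≤ T.quad := by
  unfold quad
  positivity

theorem diam_sq_le_quad (T : Tri) : T.diam ^ 2 ≤ T.quad := by
  have hdist (i j : Fin 3) : dist (T i) (T j) ≤ √T.quad := by
    refine Real.le_sqrt_of_sq_le ?_
    rw [dist_eq_norm, plane_norm_sq]
    simp only [quad, plane_norm_sq, PiLp.sub_apply, midpoint_apply]
    fin_cases i <;> fin_cases j <;> simp only [Fin.zero_eta, Fin.mk_one, Fin.reduceFinMk] <;>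
      nlinarith [sq_nonneg (T 1 0 - T 0 0), sq_nonneg (T 1 1 - T 0 1),
        sq_nonneg (T 2 0 - T 0 0), sq_nonneg (T 2 1 - T 0 1),
        sq_nonneg (T 2 0 - T 1 0), sq_nonneg (T 2 1 - T 1 1),
        sq_nonneg (T 2 0 - (T 0 0 + T 1 0) / 2), sq_nonneg (T 2 1 - (T 0 1 + T 1 1) / 2)]
  refine (Real.le_sqrt Metric.diam_nonneg T.quad_nonneg).1 ?_
  rw [carrier, convexHull_diam]
  refine Metric.diam_le_of_forall_dist_le (Real.sqrt_nonneg _) ?_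
  rintro _ ⟨i, rfl⟩ _ ⟨j, rfl⟩
  exact hdist i j

theorem vertex_mem (T : Tri) (i : Fin 3) : T i ∈ T.carrier := subset_convexHull _ _ ⟨i, rfl⟩

theorem carrier_subset {T S : Tri} (h : ∀ i, S i ∈ T.carrier) : S.carrier ⊆ T.carrier :=
  convexHull_min (Set.range_subset_iff.2 h) T.convex_carrier

theorem carrier_child₁_subset (T : Tri) : T.child₁.carrier ⊆ T.carrier := by
  refine carrier_subset fun i => ?_
  fin_cases i
  exacts [T.vertex_mem 0, T.vertex_mem 2,
    T.convex_carrier.midpoint_mem (T.vertex_mem 0) (T.vertex_mem 1)]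

theorem carrier_child₂_subset (T : Tri) : T.child₂.carrier ⊆ T.carrier := by
  refine carrier_subset fun i => ?_
  fin_cases i
  exacts [T.vertex_mem 1, T.vertex_mem 2,
    T.convex_carrier.midpoint_mem (T.vertex_mem 0) (T.vertex_mem 1)]

theorem carrier_child₁_union_carrier_child₂ (T : Tri) :
    T.child₁.carrier ∪ T.child₂.carrier = T.carrier := by
  refine (Set.union_subset T.carrier_child₁_subset T.carrier_child₂_subset).antisymm ?_
  rw [T.carrier_eq_image, T.child₁.carrier_eq_image, T.child₂.carrier_eq_image]
  rintro _ ⟨y, ⟨h0, h1, h2⟩, rfl⟩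
  rcases le_total (y 0) (1 - y 0 - y 1) with h | h
  · refine .inl ⟨!₂[y 1, 2 * y 0], ⟨by simpa using h1, by simpa using h0, ?_⟩, ?_⟩
    · simp only [Matrix.cons_val_zero, Matrix.cons_val_one]
      linarith
    · apply plane_ext <;> simp [toPlane, child₁] <;> ring
  · refine .inr ⟨!₂[y 1, 2 * (1 - y 0 - y 1)], ⟨by simpa using h1, ?_, ?_⟩, ?_⟩
    · change 0 ≤ 2 * (1 - y 0 - y 1)
      linarith
    · simp only [Matrix.cons_val_zero, Matrix.cons_val_one]
      linarith
    · apply plane_ext <;> simp [toPlane, child₂] <;> ring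

end Tri

namespace BisectionRefines

variable {𝒯₀ 𝒯 : Finset Tri}

theorem forall_mem (h : BisectionRefines 𝒯₀ 𝒯) {P : Tri → Prop}
    (h₁ : ∀ T, P T → P T.child₁) (h₂ : ∀ T, P T → P T.child₂) (h₀ : ∀ T ∈ 𝒯₀, P T) :
    ∀ T ∈ 𝒯, P T := by
  induction h with
  | refl => exact h₀
  | @step 𝒯 T _ hT ih =>
    simp only [Finset.mem_insert, forall_eq_or_imp]
    exact ⟨h₁ T (ih T hT), h₂ T (ih T hT), fun S hS => ih S (Finset.mem_of_mem_erase hS)⟩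

theorem iUnion_carrier (h : BisectionRefines 𝒯₀ 𝒯) :
    ⋃ T ∈ 𝒯, T.carrier = ⋃ T ∈ 𝒯₀, T.carrier := by
  classical
  induction h with
  | refl => rfl
  | @step 𝒯 T _ hT ih =>
    rw [← ih, Finset.set_biUnion_insert, Finset.set_biUnion_insert, ← Set.union_assoc,
      Tri.carrier_child₁_union_carrier_child₂, ← Finset.set_biUnion_insert,
      Finset.insert_erase hT]

theorem quad_le_mul_abs_det (h : BisectionRefines 𝒯₀ 𝒯) {κ : ℝ}
    (h₀ : ∀ T ∈ 𝒯₀, T.quad ≤ κ * |T.det|) : ∀ T ∈ 𝒯, T.quad ≤ κ * |T.det| :=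
  h.forall_mem (fun T hT => by rw [T.quad_child₁, T.abs_det_child₁]; linarith)
    (fun T hT => by rw [T.quad_child₂, T.abs_det_child₂]; linarith) h₀

theorem quad_le (h : BisectionRefines 𝒯₀ 𝒯) {Q : ℝ} (h₀ : ∀ T ∈ 𝒯₀, T.quad ≤ Q) :
    ∀ T ∈ 𝒯, T.quad ≤ Q :=
  h.forall_mem (fun T hT => by rw [T.quad_child₁]; linarith [T.quad_nonneg])
    (fun T hT => by rw [T.quad_child₂]; linarith [T.quad_nonneg]) h₀

end BisectionRefines

theorem IsConforming.det_ne_zero {𝒯 : Finset Tri} (h : IsConforming 𝒯) {T : Tri} (hT : T ∈ 𝒯) :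
    T.det ≠ 0 :=
  Tri.det_ne_zero (h.nondegenerate T hT)

theorem IsTriangulation.of_mem_admissibleMeshes {Ω : Set Plane} {𝒯₀ 𝒯 : Finset Tri}
    (h₀ : IsTriangulation Ω 𝒯₀) (h : 𝒯 ∈ admissibleMeshes 𝒯₀) : IsTriangulation Ω 𝒯 :=
  ⟨h.2, by rw [h.1.iUnion_carrier]; exact h₀.interior_eq⟩

theorem exists_diam_sq_le_mul_abs_det {𝒯₀ : Finset Tri} (h₀ : IsConforming 𝒯₀) :
    ∃ κ > 0, ∀ 𝒯 ∈ admissibleMeshes 𝒯₀, ∀ T ∈ 𝒯, T.diam ^ 2 ≤ κ * |T.det| := by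
  have hnn : ∀ T ∈ 𝒯₀, 0 ≤ T.quad / |T.det| := fun T _ => div_nonneg T.quad_nonneg (abs_nonneg _)
  refine ⟨1 + ∑ T ∈ 𝒯₀, T.quad / |T.det|, by linarith [Finset.sum_nonneg hnn],
    fun 𝒯 h𝒯 T hT => T.diam_sq_le_quad.trans (h𝒯.1.quad_le_mul_abs_det (fun S hS => ?_) T hT)⟩
  rw [← div_le_iff₀ (abs_pos.2 (h₀.det_ne_zero hS))]
  linarith [Finset.single_le_sum hnn hS]

theorem exists_diam_sq_le (𝒯₀ : Finset Tri) :
    ∃ Q > 0, ∀ 𝒯 ∈ admissibleMeshes 𝒯₀, ∀ T ∈ 𝒯, T.diam ^ 2 ≤ Q := by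
  have hnn : ∀ T ∈ 𝒯₀, 0 ≤ T.quad := fun T _ => T.quad_nonneg
  refine ⟨1 + ∑ T ∈ 𝒯₀, T.quad, by linarith [Finset.sum_nonneg hnn],
    fun 𝒯 h𝒯 T hT => T.diam_sq_le_quad.trans (h𝒯.1.quad_le (fun S hS => ?_) T hT)⟩
  linarith [Finset.single_le_sum hnn hS]

namespace Tri

/-- The triangle `T` with its vertices permuted so that the edge from `T j` to `T l` comes first.
The third index is `-(j + l)` because the elements of `Fin 3` add up to zero. -/
def reorder (T : Tri) (j l : Fin 3) : Tri := T ∘ ![j, l, -(j + l)]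

theorem carrier_reorder (T : Tri) {j l : Fin 3} (h : j ≠ l) :
    (T.reorder j l).carrier = T.carrier := by
  have hsurj : ∀ j l : Fin 3, j ≠ l → Function.Surjective ![j, l, -(j + l)] := by decide
  rw [carrier, carrier, reorder, (hsurj j l h).range_comp]

theorem abs_det_reorder (T : Tri) {j l : Fin 3} (h : j ≠ l) :
    |(T.reorder j l).det| = |T.det| := by
  have hneg : (-1 : Fin 3) = 2 ∧ (-2 : Fin 3) = 1 := ⟨rfl, rfl⟩
  rw [abs_eq_abs]
  fin_cases j <;> fin_cases l <;> first
    | exact absurd rfl h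
    | (left; rfl)
    | (left; simp [reorder, det, cross, hneg]; ring1)
    | (right; simp [reorder, det, cross, hneg]; ring1)

/-- The triangle `T` with its vertices permuted so that the edge opposite to vertex `i`
comes first. -/
def edgeFirst (T : Tri) (i : Fin 3) : Tri := T.reorder (i + 1) (i + 2)

theorem carrier_edgeFirst (T : Tri) (i : Fin 3) : (T.edgeFirst i).carrier = T.carrier :=
  T.carrier_reorder (by decide +revert)

theorem abs_det_edgeFirst (T : Tri) (i : Fin 3) : |(T.edgeFirst i).det| = |T.det| :=
  T.abs_det_reorder (by decide +revert)

theorem edgeA_ne_edgeB {T : Tri} (h : T.det ≠ 0) (i : Fin 3) : T.edgeA i ≠ T.edgeB i := by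
  intro he
  rw [← abs_pos, ← T.abs_det_edgeFirst i, abs_pos] at h
  exact h (by simp [edgeFirst, reorder, det, cross, show T (i + 1) = T (i + 2) from he])

theorem det_mul_det_neg {V W : Tri} (hV : V.det ≠ 0) (hW : W.det ≠ 0) (h0 : V 0 = W 0)
    (h1 : V 1 = W 1) (hd : Disjoint (interior V.carrier) (interior W.carrier)) :
    V.det * W.det < 0 := by
  by_contra hcon
  have hpos : 0 < V.det * W.det := (not_lt.1 hcon).lt_of_ne (mul_ne_zero hV hW).symm
  set y := W.coord (V 2) with hy
  have hy1 : 0 < y 1 := by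
    have he : y 1 = V.det / W.det := by
      simp only [hy, coord, ← h0, ← h1]
      rfl
    rw [he, ← mul_div_mul_right _ _ hW]
    exact div_pos hpos (mul_self_pos.2 hW)
  have he (δ : ℝ) : V.toPlane !₂[1 / 2, δ] = W.toPlane !₂[1 / 2 + δ * y 0, δ * y 1] := by
    have h2 : V 2 = W.toPlane y := (toPlane_coord hW _).symm
    unfold toPlane at h2 ⊢
    rw [h2, h0, h1]
    apply plane_ext <;> simp <;> ring
  have ev {f : ℝ → ℝ} (hf : Continuous f) (hf0 : 0 < f 0) :
      ∀ᶠ δ in nhdsWithin 0 (Set.Ioi 0), 0 < f δ :=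
    nhdsWithin_le_nhds (hf.continuousAt.eventually_const_lt hf0)
  obtain ⟨δ, ⟨⟨hV', hW0⟩, hW1⟩, hδ⟩ := (((ev (f := fun δ => 1 - (1 / 2 + δ)) (by fun_prop)
    (by norm_num)).and (ev (f := fun δ => 1 / 2 + δ * y 0) (by fun_prop) (by norm_num))).and
    (ev (f := fun δ => 1 - (1 / 2 + δ * y 0 + δ * y 1)) (by fun_prop) (by norm_num))).and
      self_mem_nhdsWithin |>.exists
  have hδV : !₂[1 / 2, δ] ∈ openRefTri := ⟨by simp, hδ, sub_pos.1 hV'⟩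
  have hδW : !₂[1 / 2 + δ * y 0, δ * y 1] ∈ openRefTri := ⟨hW0, mul_pos hδ hy1, sub_pos.1 hW1⟩
  exact Set.disjoint_left.1 hd (toPlane_mem_interior hV hδV)
    (he δ ▸ toPlane_mem_interior hW hδW)

theorem lineMap_notMem_interior {T : Tri} (hT : AffineIndependent ℝ T) (i : Fin 3) (s : ℝ) :
    AffineMap.lineMap (T.edgeA i) (T.edgeB i) s ∉ interior T.carrier := by
  let b : AffineBasis (Fin 3) ℝ Plane :=
    ⟨T, hT, hT.affineSpan_eq_top_iff_card_eq_finrank_add_one.2 (by simp)⟩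
  have hc (j : Fin 3) (h : i ≠ j) : b.coord i (T j) = 0 := b.coord_apply_ne h
  intro hx
  have hx : 0 < b.coord i (AffineMap.lineMap (T.edgeA i) (T.edgeB i) s) := by
    change _ ∈ interior (convexHull ℝ (Set.range b)) at hx
    rw [b.interior_convexHull] at hx
    exact hx i
  have hidx : ∀ i : Fin 3, i ≠ i + 1 ∧ i ≠ i + 2 := by decide
  rw [AffineMap.apply_lineMap, edgeA, edgeB, hc _ (hidx i).1, hc _ (hidx i).2] at hx
  simp at hx

theorem segment_inter_convexHull {T : Tri} (hT : AffineIndependent ℝ T) (i j : Fin 3)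
    {R : Set Plane} (hR : R ⊆ Set.range T) :
    segment ℝ (T i) (T j) ∩ convexHull ℝ R = convexHull ℝ ({T i, T j} ∩ R) := by
  classical
  have hs : AffineIndependent ℝ ((↑) : (Set.finite_range T).toFinset → Plane) :=
    hT.range.mono (by simp)
  have hR' := (Set.finite_range T).subset hR
  have hpair : ({T i, T j} : Finset Plane) ⊆ (Set.finite_range T).toFinset := by
    simp [Finset.insert_subset_iff]
  rw [← convexHull_pair]
  simpa using (hs.convexHull_inter hpair (Set.Finite.toFinset_mono (hs := hR') hR)).symm

end Tri

theorem mem_neighbors {𝒯 : Finset Tri} {T T' : Tri} {i : Fin 3} :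
    T' ∈ neighbors 𝒯 T i ↔
      T' ∈ 𝒯 ∧ T' ≠ T ∧ T.edgeA i ∈ Set.range T' ∧ T.edgeB i ∈ Set.range T' := by
  classical
  simp [neighbors]

namespace IsConforming

variable {𝒯 : Finset Tri} {T T' : Tri} {i j l : Fin 3}

theorem det_reorder_ne_zero (h : IsConforming 𝒯) (hT : T ∈ 𝒯) (hjl : j ≠ l) :
    (T.reorder j l).det ≠ 0 := by
  rw [← abs_pos, Tri.abs_det_reorder _ hjl, abs_pos]
  exact h.det_ne_zero hT

theorem det_edgeFirst_ne_zero (h : IsConforming 𝒯) (hT : T ∈ 𝒯) (i : Fin 3) :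
    (T.edgeFirst i).det ≠ 0 :=
  h.det_reorder_ne_zero hT (by decide +revert)

theorem exists_reorder_eq (h : IsConforming 𝒯) (hT : T ∈ 𝒯) (hT' : T' ∈ neighbors 𝒯 T i) :
    ∃ j l : Fin 3, j ≠ l ∧ T' j = T.edgeA i ∧ T' l = T.edgeB i := by
  obtain ⟨-, -, ⟨j, hj⟩, ⟨l, hl⟩⟩ := mem_neighbors.1 hT'
  refine ⟨j, l, ?_, hj, hl⟩
  rintro rfl
  exact Tri.edgeA_ne_edgeB (h.det_ne_zero hT) i (hj.symm.trans hl)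

theorem det_edgeFirst_mul_det_reorder_neg (h : IsConforming 𝒯) (hT : T ∈ 𝒯)
    (hT' : T' ∈ neighbors 𝒯 T i) (hjl : j ≠ l) (h0 : T' j = T.edgeA i) (h1 : T' l = T.edgeB i) :
    (T.edgeFirst i).det * (T'.reorder j l).det < 0 := by
  have hm := mem_neighbors.1 hT'
  refine Tri.det_mul_det_neg (h.det_edgeFirst_ne_zero hT i) (h.det_reorder_ne_zero hm.1 hjl)
    h0.symm h1.symm ?_
  rw [Tri.carrier_edgeFirst, Tri.carrier_reorder _ hjl]
  exact h.disjoint_interior T hT T' hm.1 hm.2.1.symm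

/-- Otherwise two of the three triangles at the edge would lie on the same side of it. -/
theorem card_neighbors_le_one (h : IsConforming 𝒯) (hT : T ∈ 𝒯) (i : Fin 3) :
    (neighbors 𝒯 T i).card ≤ 1 := by
  refine Finset.card_le_one.2 fun T₁ h₁ T₂ h₂ => by_contra fun hne => ?_
  obtain ⟨j₁, l₁, hjl₁, a₁, b₁⟩ := h.exists_reorder_eq hT h₁
  obtain ⟨j₂, l₂, hjl₂, a₂, b₂⟩ := h.exists_reorder_eq hT h₂
  have m₁ := (mem_neighbors.1 h₁).1
  have m₂ := (mem_neighbors.1 h₂).1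
  have n₁ := h.det_edgeFirst_mul_det_reorder_neg hT h₁ hjl₁ a₁ b₁
  have n₂ := h.det_edgeFirst_mul_det_reorder_neg hT h₂ hjl₂ a₂ b₂
  have n₃ : (T₁.reorder j₁ l₁).det * (T₂.reorder j₂ l₂).det < 0 :=
    Tri.det_mul_det_neg (h.det_reorder_ne_zero m₁ hjl₁) (h.det_reorder_ne_zero m₂ hjl₂)
      (a₁.trans a₂.symm) (b₁.trans b₂.symm) (by
        rw [Tri.carrier_reorder _ hjl₁, Tri.carrier_reorder _ hjl₂]
        exact h.disjoint_interior T₁ m₁ T₂ m₂ hne)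
  nlinarith [mul_pos_of_neg_of_neg n₁ n₂, mul_self_nonneg (T.edgeFirst i).det]

theorem exists_mem_neighbors_symm (h : IsConforming 𝒯) (hT : T ∈ 𝒯)
    (hT' : T' ∈ neighbors 𝒯 T i) : ∃ j, T ∈ neighbors 𝒯 T' j := by
  obtain ⟨j, l, hjl, h0, h1⟩ := h.exists_reorder_eq hT hT'
  have m0 : T' j ∈ Set.range T := h0 ▸ ⟨_, rfl⟩
  have m1 : T' l ∈ Set.range T := h1 ▸ ⟨_, rfl⟩
  refine ⟨-(j + l), mem_neighbors.2 ⟨hT, (mem_neighbors.1 hT').2.1.symm, ?_⟩⟩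
  have hidx : ∀ j l : Fin 3, j ≠ l → -(j + l) + 1 = j ∧ -(j + l) + 2 = l
      ∨ -(j + l) + 1 = l ∧ -(j + l) + 2 = j := by decide
  unfold Tri.edgeA Tri.edgeB
  rcases hidx j l hjl with ⟨ha, hb⟩ | ⟨ha, hb⟩ <;> rw [ha, hb]
  exacts [⟨m0, m1⟩, ⟨m1, m0⟩]

theorem mem_neighbors_of_lineMap_mem (h : IsConforming 𝒯) (hT : T ∈ 𝒯) (hT' : T' ∈ 𝒯)
    (hne : T' ≠ T) {s : ℝ} (hs : s ∈ Set.Ioo (0 : ℝ) 1)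
    (hx : AffineMap.lineMap (T.edgeA i) (T.edgeB i) s ∈ T'.carrier) : T' ∈ neighbors 𝒯 T i := by
  set x : Plane := AffineMap.lineMap (T.edgeA i) (T.edgeB i) s with hxdef
  have hAB := Tri.edgeA_ne_edgeB (h.det_ne_zero hT) i
  have hseg : x ∈ segment ℝ (T.edgeA i) (T.edgeB i) := by
    rw [segment_eq_image_lineMap]
    exact ⟨s, ⟨hs.1.le, hs.2.le⟩, rfl⟩
  have hxT : x ∈ T.carrier := T.convex_carrier.segment_subset (T.vertex_mem _) (T.vertex_mem _) hseg
  have hx' : x ∈ convexHull ℝ ({T.edgeA i, T.edgeB i} ∩ (Set.range T ∩ Set.range T')) := by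
    rw [Tri.edgeA, Tri.edgeB, ← Tri.segment_inter_convexHull (h.nondegenerate T hT) _ _
      Set.inter_subset_left, ← h.inter_eq T hT T' hT' hne.symm]
    exact ⟨hseg, hxT, hx⟩
  refine mem_neighbors.2 ⟨hT', hne, by_contra fun hA => ?_, by_contra fun hB => ?_⟩
  · have hsub : {T.edgeA i, T.edgeB i} ∩ (Set.range T ∩ Set.range T') ⊆ {T.edgeB i} := by
      rintro v ⟨rfl | rfl, -, hv⟩
      exacts [absurd hv hA, rfl]
    have hxB : x = T.edgeB i := by simpa using convexHull_mono hsub hx'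
    rw [hxdef, AffineMap.lineMap_eq_right_iff] at hxB
    exact hxB.elim hAB hs.2.ne
  · have hsub : {T.edgeA i, T.edgeB i} ∩ (Set.range T ∩ Set.range T') ⊆ {T.edgeA i} := by
      rintro v ⟨rfl | rfl, -, hv⟩
      exacts [rfl, absurd hv hB]
    have hxA : x = T.edgeA i := by simpa using convexHull_mono hsub hx'
    rw [hxdef, AffineMap.lineMap_eq_left_iff] at hxA
    exact hxA.elim hAB hs.1.ne'

end IsConforming

namespace IsTriangulation

variable {Ω : Set Plane} {𝒯 : Finset Tri} {T : Tri}

theorem isOpen (h : IsTriangulation Ω 𝒯) : IsOpen Ω := h.interior_eq ▸ isOpen_interior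

theorem mem_interior_carrier (h : IsTriangulation Ω 𝒯) {x : Plane} (hx : x ∈ Ω)
    (hother : ∀ T' ∈ 𝒯, T' ≠ T → x ∉ T'.carrier) : x ∈ interior T.carrier := by
  classical
  have hclosed : IsClosed (⋃ T' ∈ 𝒯.erase T, T'.carrier) :=
    (Finset.finite_toSet _).isClosed_biUnion fun T' _ => T'.isCompact_carrier.isClosed
  refine mem_interior.2 ⟨Ω \ ⋃ T' ∈ 𝒯.erase T, T'.carrier, ?_, h.isOpen.sdiff hclosed, hx, ?_⟩
  · rintro z ⟨hz, hz'⟩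
    obtain ⟨S, hS, hzS⟩ := Set.mem_iUnion₂.1 (interior_subset (h.interior_eq.symm ▸ hz))
    rcases eq_or_ne S T with rfl | hne
    · exact hzS
    · exact absurd (Set.mem_biUnion (Finset.mem_erase.2 ⟨hne, hS⟩) hzS) hz'
  · simp only [Set.mem_iUnion, Finset.mem_erase, not_exists]
    exact fun T' ⟨hne, hT'⟩ => hother T' hT' hne

theorem lineMap_notMem (h : IsTriangulation Ω 𝒯) (hT : T ∈ 𝒯) {i : Fin 3}
    (hn : neighbors 𝒯 T i = ∅) {s : ℝ} (hs : s ∈ Set.Ioo (0 : ℝ) 1) :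
    AffineMap.lineMap (T.edgeA i) (T.edgeB i) s ∉ Ω := by
  refine fun hx => Tri.lineMap_notMem_interior (h.conforming.nondegenerate T hT) i s
    (h.mem_interior_carrier hx fun T' hT' hne hxT' => ?_)
  have := h.conforming.mem_neighbors_of_lineMap_mem hT hT' hne hs hxT'
  simp [hn] at this

end IsTriangulation

/-! ### Test fields assembled from triangles -/

section InnerProducts

variable {X E : Type*} [MeasurableSpace X] {μ : Measure X} [NormedAddCommGroup E]
  [InnerProductSpace ℝ E] {f g : X → E}

theorem integrable_inner_of_memLp (hf : MemLp f 2 μ) (hg : MemLp g 2 μ) :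
    Integrable (fun x => ⟪f x, g x⟫) μ := by
  refine (L2.integrable_inner (𝕜 := ℝ) hf.toLp hg.toLp).congr ?_
  filter_upwards [hf.coeFn_toLp, hg.coeFn_toLp] with x h1 h2
  rw [h1, h2]

theorem inner_toLp (hf : MemLp f 2 μ) (g : Lp E 2 μ) : ⟪hf.toLp, g⟫ = ∫ x, ⟪f x, g x⟫ ∂μ := by
  rw [L2.inner_def]
  refine integral_congr_ae ?_
  filter_upwards [hf.coeFn_toLp] with x hx
  rw [hx]

theorem sq_integral_inner_le (hf : MemLp f 2 μ) (hg : MemLp g 2 μ) :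
    (∫ x, ⟪f x, g x⟫ ∂μ) ^ 2 ≤ (∫ x, ‖f x‖ ^ 2 ∂μ) * ∫ x, ‖g x‖ ^ 2 ∂μ := by
  have inner_eq : ⟪hf.toLp, hg.toLp⟫ = ∫ x, ⟪f x, g x⟫ ∂μ := by
    rw [inner_toLp]
    refine integral_congr_ae ?_
    filter_upwards [hg.coeFn_toLp] with x hx
    rw [hx]
  rw [← inner_eq, ← norm_toLp_sq hf, ← norm_toLp_sq hg, ← mul_pow]
  exact sq_le_sq' (neg_le_of_abs_le (abs_real_inner_le_norm _ _)) (real_inner_le_norm _ _)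

end InnerProducts

theorem integrable_mul_of_memLp {X : Type*} [MeasurableSpace X] {μ : Measure X} {f g : X → ℝ}
    (hf : MemLp f 2 μ) (hg : MemLp g 2 μ) : Integrable (fun x => f x * g x) μ :=
  hf.integrable_mul hg

theorem sq_integral_mul_le {X : Type*} [MeasurableSpace X] {μ : Measure X} {f g : X → ℝ}
    (hf : MemLp f 2 μ) (hg : MemLp g 2 μ) :
    (∫ x, f x * g x ∂μ) ^ 2 ≤ (∫ x, f x ^ 2 ∂μ) * ∫ x, g x ^ 2 ∂μ := by
  simpa [mul_comm] using sq_integral_inner_le hf hg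

theorem mul_le_of_mul_mul_le {c R M : ℝ} (hR : 0 ≤ R) (hM : 0 ≤ M) (h : c * R * R ≤ M * R) :
    c * R ≤ M := by
  rcases hR.eq_or_lt with rfl | hR
  · rwa [mul_zero]
  · exact le_of_mul_le_mul_right h hR

/-- The function that equals `F T` on each triangle `T` of `𝒩` and vanishes elsewhere; the test
fields of the residual bounds are of this form. On edges the values of the adjacent triangles
add up, which does not matter almost everywhere. -/
def patch {E : Type*} [AddCommMonoid E] (𝒩 : Finset Tri) (F : Tri → Plane → E) (x : Plane) : E :=
  ∑ T ∈ 𝒩, T.carrier.indicator (F T) x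

namespace IsTriangulation

variable {Ω : Set Plane} {𝒯 𝒩 : Finset Tri} {T : Tri}

theorem interior_subset (h : IsTriangulation Ω 𝒯) (hT : T ∈ 𝒯) : interior T.carrier ⊆ Ω := by
  rw [← h.interior_eq]
  exact interior_mono (Set.subset_biUnion_of_mem (u := fun T : Tri => T.carrier) hT)

theorem restrict_restrict (h : IsTriangulation Ω 𝒯) (hT : T ∈ 𝒯) :
    (volume.restrict Ω).restrict T.carrier = volume.restrict T.carrier := by
  rw [Measure.restrict_restrict T.measurableSet_carrier]
  refine Measure.restrict_congr_set (Filter.EventuallyLE.antisymm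
    (Filter.Eventually.of_forall fun _ hx => hx.1) ?_)
  have hfrontier : volume (frontier T.carrier) = 0 := T.convex_carrier.addHaar_frontier volume
  filter_upwards [measure_eq_zero_iff_ae_notMem.1 hfrontier] with x hx hxT
  have hxi : x ∈ interior T.carrier := by_contra fun hi => hx ⟨subset_closure hxT, hi⟩
  exact ⟨hxT, h.interior_subset hT hxi⟩

section Functions

variable {E : Type*} [NormedAddCommGroup E] {F : Tri → Plane → E} {g : Plane → E}

theorem memLp_carrier (h : IsTriangulation Ω 𝒯) (hT : T ∈ 𝒯) (hg : MemLp g 2 (volume.restrict Ω)) :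
    MemLp g 2 (volume.restrict T.carrier) :=
  h.restrict_restrict hT ▸ hg.restrict _

theorem memLp_patch (h : IsTriangulation Ω 𝒯) (h𝒩 : 𝒩 ⊆ 𝒯) (hF : ∀ T, Continuous (F T)) :
    MemLp (patch 𝒩 F) 2 (volume.restrict Ω) := by
  refine memLp_finsetSum _ fun T hT => ?_
  rw [memLp_indicator_iff_restrict T.measurableSet_carrier, h.restrict_restrict (h𝒩 hT)]
  exact memLp_of_isCompact (hF T) T.isCompact_carrier

theorem integral_inner_patch [InnerProductSpace ℝ E] (h : IsTriangulation Ω 𝒯) (h𝒩 : 𝒩 ⊆ 𝒯)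
    (hF : ∀ T, Continuous (F T)) (hg : MemLp g 2 (volume.restrict Ω)) :
    ∫ x in Ω, ⟪patch 𝒩 F x, g x⟫ = ∑ T ∈ 𝒩, ∫ x in T.carrier, ⟪F T x, g x⟫ := by
  have inner_patch (x : Plane) : ⟪patch 𝒩 F x, g x⟫
      = ∑ T ∈ 𝒩, T.carrier.indicator (fun x => ⟪F T x, g x⟫) x := by
    rw [patch, sum_inner]
    refine Finset.sum_congr rfl fun T _ => ?_
    by_cases hx : x ∈ T.carrier
    · simp only [Set.indicator_of_mem hx]
    · simp only [Set.indicator_of_notMem hx, inner_zero_left]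
  simp only [inner_patch]
  rw [integral_finsetSum _ fun T hT => ?_]
  · refine Finset.sum_congr rfl fun T hT => ?_
    rw [integral_indicator T.measurableSet_carrier, h.restrict_restrict (h𝒩 hT)]
  · rw [integrable_indicator_iff T.measurableSet_carrier, IntegrableOn,
      h.restrict_restrict (h𝒩 hT)]
    exact integrable_inner_of_memLp (memLp_of_isCompact (hF T) T.isCompact_carrier)
      (h.memLp_carrier (h𝒩 hT) hg)

theorem integral_inner_toLp_patch [InnerProductSpace ℝ E] (h : IsTriangulation Ω 𝒯)
    (h𝒩 : 𝒩 ⊆ 𝒯) (hF : ∀ T, Continuous (F T)) (hg : MemLp g 2 (volume.restrict Ω)) :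
    ∫ x in Ω, ⟪(h.memLp_patch h𝒩 hF).toLp _ x, g x⟫
      = ∑ T ∈ 𝒩, ∫ x in T.carrier, ⟪F T x, g x⟫ := by
  rw [← h.integral_inner_patch h𝒩 hF hg]
  refine integral_congr_ae ?_
  filter_upwards [(h.memLp_patch h𝒩 hF).coeFn_toLp] with x hx
  rw [hx]

end Functions

variable {Y : Tri → Plane → Plane} {d : Tri → Plane → ℝ}

theorem hasWeakDiv_patch (h : IsTriangulation Ω 𝒯) (h𝒩 : 𝒩 ⊆ 𝒯) (hY : ∀ T, Continuous (Y T))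
    (hd : ∀ T, Continuous (d T))
    (hYd : ∀ φ : Plane → ℝ, ContDiff ℝ ∞ φ → HasCompactSupport φ → tsupport φ ⊆ Ω →
      ∑ T ∈ 𝒩, ∫ x in T.carrier, ⟪Y T x, gradient φ x⟫
        = -∑ T ∈ 𝒩, ∫ x in T.carrier, ⟪d T x, φ x⟫) :
    HasWeakDiv Ω (h.memLp_patch h𝒩 hY).toLp (h.memLp_patch h𝒩 hd).toLp := by
  intro φ hφ hc hs
  have memLp_φ : MemLp φ 2 (volume.restrict Ω) :=
    (hφ.continuous.memLp_of_hasCompactSupport (μ := volume) (p := 2) hc).restrict Ω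
  rw [h.integral_inner_toLp_patch h𝒩 hY (memLp_gradient Ω hφ hc), hYd φ hφ hc hs,
    ← h.integral_inner_toLp_patch h𝒩 hd memLp_φ]
  simp only [RCLike.inner_apply', conj_trivial]

end IsTriangulation

namespace IsG

variable {Ω : Set Plane} {𝒯 𝒩 : Finset Tri} {T : Tri} {u : L2 Ω} {σ : L2v Ω}

theorem sum_integral_inner (hG : IsG Ω (Hdiv Ω) u σ) (h : IsTriangulation Ω 𝒯) (h𝒩 : 𝒩 ⊆ 𝒯)
    {Y : Tri → Plane → Plane} {d : Tri → Plane → ℝ} (hY : ∀ T, Continuous (Y T))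
    (hd : ∀ T, Continuous (d T))
    (hYd : ∀ φ : Plane → ℝ, ContDiff ℝ ∞ φ → HasCompactSupport φ → tsupport φ ⊆ Ω →
      ∑ T ∈ 𝒩, ∫ x in T.carrier, ⟪Y T x, gradient φ x⟫
        = -∑ T ∈ 𝒩, ∫ x in T.carrier, ⟪d T x, φ x⟫) :
    ∑ T ∈ 𝒩, ∫ x in T.carrier, ⟪Y T x, σ x⟫
      = -∑ T ∈ 𝒩, ∫ x in T.carrier, ⟪d T x, u x⟫ := by
  have hw := h.hasWeakDiv_patch h𝒩 hY hd hYd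
  have weak_form := hG.2 _ ⟨_, hw⟩
  rw [aForm, bForm, hw.weakDiv_eq h.isOpen, real_inner_comm, L2.inner_def, L2.inner_def,
    h.integral_inner_toLp_patch h𝒩 hY (Lp.memLp σ),
    h.integral_inner_toLp_patch h𝒩 hd (Lp.memLp u)] at weak_form
  exact eq_neg_of_add_eq_zero_left weak_form

end IsG

/-! ### Curl and gradient residuals -/

namespace Tri

theorem memLp_evalAt (T : Tri) (p : Poly) : MemLp p.evalAt 2 (volume.restrict T.carrier) :=
  memLp_of_isCompact p.continuous T.isCompact_carrier

theorem memLp_vecAt (T : Tri) (q : Fin 2 → Poly) :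
    MemLp (vecAt q) 2 (volume.restrict T.carrier) :=
  memLp_of_isCompact (continuous_vecAt q) T.isCompact_carrier

theorem integrable_of_continuous (T : Tri) {f : Plane → ℝ} (hf : Continuous f) :
    Integrable f (volume.restrict T.carrier) :=
  hf.continuousOn.integrableOn_compact T.isCompact_carrier

theorem integral_inner_vecAt (T : Tri) (p q : Fin 2 → Poly) :
    ∫ x in T.carrier, ⟪vecAt p x, vecAt q x⟫
      = ∑ j, ∫ x in T.carrier, (p j).evalAt x * (q j).evalAt x := by
  rw [← integral_finsetSum _ fun j _ =>
    integrable_mul_of_memLp (T.memLp_evalAt (p j)) (T.memLp_evalAt (q j))]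
  simp only [plane_inner, vecAt_zero, vecAt_one, Fin.sum_univ_two]

theorem integral_norm_vecAt_sq (T : Tri) (q : Fin 2 → Poly) :
    ∫ x in T.carrier, ‖vecAt q x‖ ^ 2 = ∑ j, ∫ x in T.carrier, (q j).evalAt x ^ 2 := by
  simpa only [real_inner_self_eq_norm_sq, ← sq] using T.integral_inner_vecAt q q

theorem integral_polyDiv_sq_le (T : Tri) (Ψ : Fin 2 → Poly) :
    ∫ x in T.carrier, (polyDiv Ψ).evalAt x ^ 2
      ≤ 2 * ∑ j, ∫ x in T.carrier, ‖vecAt (polyGrad (Ψ j)) x‖ ^ 2 := by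
  have integrable_grad (j : Fin 2) : Integrable (fun x => ‖vecAt (polyGrad (Ψ j)) x‖ ^ 2)
      (volume.restrict T.carrier) :=
    T.integrable_of_continuous ((continuous_vecAt _).norm.pow 2)
  rw [← integral_finsetSum _ fun j _ => integrable_grad j, ← integral_const_mul]
  refine integral_mono (T.integrable_of_continuous ((polyDiv Ψ).continuous.pow 2))
    ((integrable_finsetSum _ fun j _ => integrable_grad j).const_mul 2) fun x => ?_
  simp only [polyDiv, Poly.evalAt_add, Fin.sum_univ_two, plane_norm_sq, vecAt_zero, vecAt_one,
    polyGrad]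
  nlinarith [sq_nonneg (Poly.evalAt (MvPolynomial.pderiv 0 (Ψ 0)) x
    - Poly.evalAt (MvPolynomial.pderiv 1 (Ψ 1)) x),
    sq_nonneg (Poly.evalAt (MvPolynomial.pderiv 1 (Ψ 0)) x),
    sq_nonneg (Poly.evalAt (MvPolynomial.pderiv 0 (Ψ 1)) x)]

theorem circulation_smul_eq_zero {T : Tri} {ψ : Poly} (hψ : ∀ i, T.VanishesOnEdge i ψ)
    (u : Plane → Plane) : T.circulation (fun x => ψ.evalAt x • u x) = 0 :=
  Finset.sum_eq_zero fun i _ => by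
    simp only [hψ i _, zero_smul, inner_zero_left, intervalIntegral.integral_zero]

end Tri

theorem norm_vecAt_vecCurl (ψ : Poly) (x : Plane) :
    ‖vecAt (vecCurl ψ) x‖ = ‖vecAt (polyGrad ψ) x‖ := by
  rw [← sq_eq_sq₀ (norm_nonneg _) (norm_nonneg _), plane_norm_sq, plane_norm_sq]
  simp [vecCurl, polyGrad, add_comm]

namespace IsG

variable {Ω : Set Plane} {𝒯 : Finset Tri} {T : Tri} {u : L2 Ω} {σ : L2v Ω}

theorem integral_inner_vecCurl_sub (hG : IsG Ω (Hdiv Ω) u σ) (h : IsTriangulation Ω 𝒯)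
    (hT : T ∈ 𝒯) {ψ : Poly} (hψ : ∀ i, T.VanishesOnEdge i ψ) (q : Fin 2 → Poly) :
    ∫ x in T.carrier, ⟪vecAt (vecCurl ψ) x, vecAt q x - σ x⟫
      = ∫ x in T.carrier, ψ.evalAt x * (polyCurl q).evalAt x := by
  have hdet := h.conforming.det_ne_zero hT
  have integral_σ : ∫ x in T.carrier, ⟪vecAt (vecCurl ψ) x, σ x⟫ = 0 := by
    have weak_form := hG.sum_integral_inner h (Finset.singleton_subset_iff.2 hT)
      (Y := fun _ => vecAt (vecCurl ψ)) (d := fun _ _ => 0) (fun _ => continuous_vecAt _)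
      (fun _ => continuous_const) fun φ hφ _ _ => by
        have hφ2 : ContDiff ℝ 2 φ := hφ.of_le (WithTop.coe_le_coe.2 le_top)
        rw [Finset.sum_singleton, Tri.integral_inner_vecCurl hdet ψ (contDiff_gradient hφ2),
          Tri.circulation_smul_eq_zero hψ]
        simp [curlAt_gradient hφ2]
    simpa using weak_form
  simp only [inner_sub_right]
  rw [integral_sub (integrable_inner_of_memLp (T.memLp_vecAt _) (T.memLp_vecAt q))
    (integrable_inner_of_memLp (T.memLp_vecAt _) (h.memLp_carrier hT (Lp.memLp σ))),
    integral_σ, sub_zero, Tri.integral_inner_vecCurl hdet ψ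
      ((contDiff_vecAt q).of_le (by exact_mod_cast le_top)),
    Tri.circulation_smul_eq_zero hψ, mul_zero, add_zero]
  simp only [curlAt_vecAt]

theorem integral_inner_sub_polyGrad (hG : IsG Ω (Hdiv Ω) u σ) (h : IsTriangulation Ω 𝒯)
    (hT : T ∈ 𝒯) {Ψ : Fin 2 → Poly} (hΨ : ∀ j i, T.VanishesOnEdge i (Ψ j))
    (q : Fin 2 → Poly) (w : Poly) :
    ∫ x in T.carrier, ⟪vecAt Ψ x, vecAt q x - vecAt (polyGrad w) x⟫
      = (∫ x in T.carrier, ⟪vecAt Ψ x, vecAt q x - σ x⟫)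
        + ∫ x in T.carrier, (polyDiv Ψ).evalAt x * (w.evalAt x - u x) := by
  have hdet := h.conforming.det_ne_zero hT
  have memLp_σ := h.memLp_carrier hT (Lp.memLp σ)
  have memLp_u := h.memLp_carrier hT (Lp.memLp u)
  have integral_σ : ∫ x in T.carrier, ⟪vecAt Ψ x, σ x⟫
      = -∫ x in T.carrier, (polyDiv Ψ).evalAt x * u x := by
    have weak_form := hG.sum_integral_inner h (Finset.singleton_subset_iff.2 hT)
      (Y := fun _ => vecAt Ψ) (d := fun _ => (polyDiv Ψ).evalAt) (fun _ => continuous_vecAt _)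
      (fun _ => (polyDiv Ψ).continuous) fun φ hφ _ _ => by
        simpa [mul_comm] using Tri.integral_inner_gradient hdet
          (hφ.of_le (by exact_mod_cast le_top)) hΨ
    simpa [mul_comm] using weak_form
  have integral_grad : ∫ x in T.carrier, ⟪vecAt Ψ x, vecAt (polyGrad w) x⟫
      = -∫ x in T.carrier, (polyDiv Ψ).evalAt x * w.evalAt x := by
    simpa only [gradient_evalAt] using Tri.integral_inner_gradient hdet
      (w.contDiff.of_le (by exact_mod_cast le_top)) hΨ
  simp only [inner_sub_right, mul_sub]
  rw [integral_sub (integrable_inner_of_memLp (T.memLp_vecAt _) (T.memLp_vecAt _))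
      (integrable_inner_of_memLp (T.memLp_vecAt _) (T.memLp_vecAt _)),
    integral_sub (integrable_inner_of_memLp (T.memLp_vecAt _) (T.memLp_vecAt _))
      (integrable_inner_of_memLp (T.memLp_vecAt _) memLp_σ),
    integral_sub (integrable_mul_of_memLp (T.memLp_evalAt _) (T.memLp_evalAt _))
      (integrable_mul_of_memLp (T.memLp_evalAt _) memLp_u),
    integral_σ, integral_grad]
  ring

theorem sq_integral_inner_sub_polyGrad_le (hG : IsG Ω (Hdiv Ω) u σ) (h : IsTriangulation Ω 𝒯)
    (hT : T ∈ 𝒯) {Ψ : Fin 2 → Poly} (hΨ : ∀ j i, T.VanishesOnEdge i (Ψ j))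
    (q : Fin 2 → Poly) (w : Poly) :
    (∫ x in T.carrier, ⟪vecAt Ψ x, vecAt q x - vecAt (polyGrad w) x⟫) ^ 2
      ≤ 2 * ((∫ x in T.carrier, ‖vecAt Ψ x‖ ^ 2) * (∫ x in T.carrier, ‖vecAt q x - σ x‖ ^ 2)
        + (∫ x in T.carrier, (polyDiv Ψ).evalAt x ^ 2)
          * ∫ x in T.carrier, (w.evalAt x - u x) ^ 2) := by
  rw [hG.integral_inner_sub_polyGrad h hT hΨ q w]
  refine add_sq_le.trans (mul_le_mul_of_nonneg_left (add_le_add ?_ ?_) zero_le_two)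
  · exact sq_integral_inner_le (T.memLp_vecAt Ψ)
      ((T.memLp_vecAt q).sub (h.memLp_carrier hT (Lp.memLp σ)))
  · exact sq_integral_mul_le (T.memLp_evalAt (polyDiv Ψ))
      ((T.memLp_evalAt w).sub (h.memLp_carrier hT (Lp.memLp u)))

end IsG

theorem exists_curl_residual_le (K : ℕ) : ∃ C : ℝ, 0 < C ∧
    ∀ {Ω : Set Plane} {𝒯 : Finset Tri}, IsTriangulation Ω 𝒯 → ∀ {u : L2 Ω} {σ : L2v Ω},
      IsG Ω (Hdiv Ω) u σ → ∀ T ∈ 𝒯, ∀ κ : ℝ, T.diam ^ 2 ≤ κ * |T.det| →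
      ∀ q : Fin 2 → Poly, (∀ i, q i ∈ polyLE K) →
      T.diam ^ 2 * ∫ x in T.carrier, (polyCurl q).evalAt x ^ 2
        ≤ C * κ ^ 2 * ∫ x in T.carrier, ‖vecAt q x - σ x‖ ^ 2 := by
  obtain ⟨C₁, hC₁, le_bubbleMul⟩ := Tri.exists_integral_sq_le_bubbleMul K
  obtain ⟨C₂, hC₂, grad_le⟩ := Tri.exists_integral_grad_bubbleMul_sq_le K
  refine ⟨C₁ ^ 2 * C₂, by positivity, fun {Ω 𝒯} h {u σ} hG T hT κ hκ q hq => ?_⟩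
  have hdet := h.conforming.det_ne_zero hT
  have hcurl : polyCurl q ∈ polyLE K := Submodule.sub_mem _
    (Poly.pderiv_mem_polyLE (hq 0) 1) (Poly.pderiv_mem_polyLE (hq 1) 0)
  set ψ := T.bubbleMul (polyCurl q)
  have residual_le := le_bubbleMul T hdet _ hcurl
  rw [← hG.integral_inner_vecCurl_sub h hT (Tri.vanishesOnEdge_bubbleMul hdet _)]
    at residual_le
  have cauchy_schwarz := sq_integral_inner_le (T.memLp_vecAt (vecCurl ψ))
    ((T.memLp_vecAt q).sub (h.memLp_carrier hT (Lp.memLp σ)))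
  have grad_le := grad_le T κ hdet hκ _ hcurl
  simp only [norm_vecAt_vecCurl, Pi.sub_apply] at cauchy_schwarz
  set R := ∫ x in T.carrier, (polyCurl q).evalAt x ^ 2
  set A := ∫ x in T.carrier, ‖vecAt q x - σ x‖ ^ 2
  set G := ∫ x in T.carrier, ‖vecAt (polyGrad ψ) x‖ ^ 2
  set X := ∫ x in T.carrier, ⟪vecAt (vecCurl ψ) x, vecAt q x - σ x⟫
  have hR : 0 ≤ R := integral_nonneg fun _ => sq_nonneg _
  have : 0 ≤ A := integral_nonneg fun _ => sq_nonneg _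
  refine mul_le_of_mul_mul_le hR (by positivity) ?_
  calc T.diam ^ 2 * R * R = T.diam ^ 2 * R ^ 2 := by ring
    _ ≤ T.diam ^ 2 * (C₁ * X) ^ 2 := by gcongr
    _ = C₁ ^ 2 * T.diam ^ 2 * X ^ 2 := by ring
    _ ≤ C₁ ^ 2 * T.diam ^ 2 * (G * A) := by gcongr
    _ = C₁ ^ 2 * A * (T.diam ^ 2 * G) := by ring
    _ ≤ C₁ ^ 2 * A * (C₂ * κ ^ 2 * R) := by gcongr
    _ = C₁ ^ 2 * C₂ * κ ^ 2 * A * R := by ring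

/-- The polynomial field obtained by multiplying a field componentwise by the bubble function
of `T`, the test field of the gradient residual. -/
def Tri.bubbleField (T : Tri) (r : Fin 2 → Poly) : Fin 2 → Poly :=
  fun j => T.bubbleMul (r j)

namespace Tri

variable (K : ℕ)

theorem exists_integral_norm_sq_le_bubbleField : ∃ C : ℝ, 0 < C ∧ ∀ T : Tri, T.det ≠ 0 →
    ∀ r : Fin 2 → Poly, (∀ j, r j ∈ polyLE K) → ∫ x in T.carrier, ‖vecAt r x‖ ^ 2
      ≤ C * ∫ x in T.carrier, ⟪vecAt (T.bubbleField r) x, vecAt r x⟫ := by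
  obtain ⟨C, hC, hle⟩ := exists_integral_sq_le_bubbleMul K
  refine ⟨C, hC, fun T hdet r hr => ?_⟩
  rw [integral_norm_vecAt_sq, integral_inner_vecAt, Finset.mul_sum]
  exact Finset.sum_le_sum fun j _ => hle T hdet _ (hr j)

theorem exists_integral_norm_bubbleField_sq_le : ∃ C : ℝ, 0 < C ∧ ∀ T : Tri, T.det ≠ 0 →
    ∀ r : Fin 2 → Poly, (∀ j, r j ∈ polyLE K) →
      ∫ x in T.carrier, ‖vecAt (T.bubbleField r) x‖ ^ 2
        ≤ C * ∫ x in T.carrier, ‖vecAt r x‖ ^ 2 := by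
  obtain ⟨C, hC, hle⟩ := exists_integral_bubbleMul_sq_le K
  refine ⟨C, hC, fun T hdet r hr => ?_⟩
  rw [integral_norm_vecAt_sq, integral_norm_vecAt_sq, Finset.mul_sum]
  exact Finset.sum_le_sum fun j _ => hle T hdet _ (hr j)

theorem exists_integral_polyDiv_bubbleField_sq_le : ∃ C : ℝ, 0 < C ∧ ∀ (T : Tri) (κ : ℝ),
    T.det ≠ 0 → T.diam ^ 2 ≤ κ * |T.det| → ∀ r : Fin 2 → Poly, (∀ j, r j ∈ polyLE K) →
      T.diam ^ 2 * ∫ x in T.carrier, (polyDiv (T.bubbleField r)).evalAt x ^ 2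
        ≤ C * κ ^ 2 * ∫ x in T.carrier, ‖vecAt r x‖ ^ 2 := by
  obtain ⟨C, hC, hle⟩ := exists_integral_grad_bubbleMul_sq_le K
  refine ⟨2 * C, by positivity, fun T κ hdet hκ r hr => ?_⟩
  calc T.diam ^ 2 * ∫ x in T.carrier, (polyDiv (T.bubbleField r)).evalAt x ^ 2
      ≤ T.diam ^ 2 * (2 * ∑ j, ∫ x in T.carrier, ‖vecAt (polyGrad (T.bubbleMul (r j))) x‖ ^ 2) :=
        mul_le_mul_of_nonneg_left (T.integral_polyDiv_sq_le _) (sq_nonneg _)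
    _ = 2 * ∑ j, T.diam ^ 2 * ∫ x in T.carrier, ‖vecAt (polyGrad (T.bubbleMul (r j))) x‖ ^ 2 := by
        rw [← Finset.mul_sum]
        ring
    _ ≤ 2 * ∑ j, C * κ ^ 2 * ∫ x in T.carrier, (r j).evalAt x ^ 2 :=
        mul_le_mul_of_nonneg_left (Finset.sum_le_sum fun j _ => hle T κ hdet hκ _ (hr j))
          zero_le_two
    _ = 2 * C * κ ^ 2 * ∫ x in T.carrier, ‖vecAt r x‖ ^ 2 := by
        rw [← Finset.mul_sum, integral_norm_vecAt_sq]
        ring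

end Tri

theorem exists_gradient_residual_le (K : ℕ) : ∃ C : ℝ, 0 < C ∧
    ∀ {Ω : Set Plane} {𝒯 : Finset Tri}, IsTriangulation Ω 𝒯 → ∀ {u : L2 Ω} {σ : L2v Ω},
      IsG Ω (Hdiv Ω) u σ → ∀ T ∈ 𝒯, ∀ κ : ℝ, T.diam ^ 2 ≤ κ * |T.det| →
      ∀ (q : Fin 2 → Poly) (w : Poly), (∀ i, q i ∈ polyLE K) → w ∈ polyLE K →
      T.diam ^ 2 * ∫ x in T.carrier, ‖vecAt q x - vecAt (polyGrad w) x‖ ^ 2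
        ≤ C * (T.diam ^ 2 * (∫ x in T.carrier, ‖vecAt q x - σ x‖ ^ 2)
          + κ ^ 2 * ∫ x in T.carrier, (w.evalAt x - u x) ^ 2) := by
  obtain ⟨C₁, hC₁, le_bubble⟩ := Tri.exists_integral_norm_sq_le_bubbleField K
  obtain ⟨C₂, hC₂, bubble_le⟩ := Tri.exists_integral_norm_bubbleField_sq_le K
  obtain ⟨C₃, hC₃, div_le⟩ := Tri.exists_integral_polyDiv_bubbleField_sq_le K
  refine ⟨2 * C₁ ^ 2 * (C₂ + C₃), by positivity, fun {Ω 𝒯} h {u σ} hG T hT κ hκ q w hq hw => ?_⟩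
  have hdet := h.conforming.det_ne_zero hT
  have vecAt_sub (x : Plane) : vecAt q x - vecAt (polyGrad w) x = vecAt (q - polyGrad w) x := by
    apply plane_ext <;> simp
  have hr (j : Fin 2) : (q - polyGrad w) j ∈ polyLE K :=
    Submodule.sub_mem _ (hq j) (Poly.pderiv_mem_polyLE hw j)
  set Ψ := T.bubbleField (q - polyGrad w)
  have residual_le := le_bubble T hdet _ hr
  have consistency := hG.sq_integral_inner_sub_polyGrad_le h hT (Ψ := Ψ)
    (fun j => Tri.vanishesOnEdge_bubbleMul hdet _) q w
  have bubble_le := bubble_le T hdet _ hr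
  have div_le := div_le T κ hdet hκ _ hr
  simp only [vecAt_sub] at consistency ⊢
  set R := ∫ x in T.carrier, ‖vecAt (q - polyGrad w) x‖ ^ 2
  set A := ∫ x in T.carrier, ‖vecAt q x - σ x‖ ^ 2
  set B := ∫ x in T.carrier, (w.evalAt x - u x) ^ 2
  set P := ∫ x in T.carrier, ‖vecAt Ψ x‖ ^ 2
  set D := ∫ x in T.carrier, (polyDiv Ψ).evalAt x ^ 2
  set X := ∫ x in T.carrier, ⟪vecAt Ψ x, vecAt (q - polyGrad w) x⟫
  have hR : 0 ≤ R := integral_nonneg fun _ => sq_nonneg _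
  have : 0 ≤ A := integral_nonneg fun _ => sq_nonneg _
  have : 0 ≤ B := integral_nonneg fun _ => sq_nonneg _
  refine mul_le_of_mul_mul_le hR (by positivity) ?_
  calc T.diam ^ 2 * R * R = T.diam ^ 2 * R ^ 2 := by ring
    _ ≤ T.diam ^ 2 * (C₁ * X) ^ 2 := by gcongr
    _ = C₁ ^ 2 * T.diam ^ 2 * X ^ 2 := by ring
    _ ≤ C₁ ^ 2 * T.diam ^ 2 * (2 * (P * A + D * B)) := by gcongr
    _ = 2 * C₁ ^ 2 * (T.diam ^ 2 * A * P + B * (T.diam ^ 2 * D)) := by ring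
    _ ≤ 2 * C₁ ^ 2 * (T.diam ^ 2 * A * (C₂ * R) + B * (C₃ * κ ^ 2 * R)) := by gcongr
    _ = 2 * C₁ ^ 2 * (C₂ * (T.diam ^ 2 * A) + C₃ * (κ ^ 2 * B)) * R := by ring
    _ ≤ 2 * C₁ ^ 2 * ((C₂ + C₃) * (T.diam ^ 2 * A) + (C₂ + C₃) * (κ ^ 2 * B)) * R := by
        gcongr <;> linarith
    _ = 2 * C₁ ^ 2 * (C₂ + C₃) * (T.diam ^ 2 * A + κ ^ 2 * B) * R := by ring

/-! ### Jump residual -/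

namespace Tri

theorem circulation_edgeLift_smul {V : Tri} (h : V.det ≠ 0) (J : Polynomial ℝ)
    (u : Plane → Plane) :
    V.circulation (fun x => (V.edgeLift J).evalAt x • u x)
      = ∫ t in (0 : ℝ)..1, ((1 - t) * t) ^ 2 * J.eval t
        * ⟪u (AffineMap.lineMap (V.edgeA 2) (V.edgeB 2) t), V.edgeB 2 - V.edgeA 2⟫ := by
  have vanish {i : Fin 3} (hi : i ≠ 2) (t : ℝ) := V.vanishesOnEdge_edgeLift h J hi t
  simp only [circulation, Fin.sum_univ_three, vanish (i := 0) (by decide),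
    vanish (i := 1) (by decide), evalAt_edgeLift_lineMap h, real_inner_smul_left, zero_mul,
    intervalIntegral.integral_zero, zero_add]

theorem nonneg_of_diam_sq_le {T : Tri} (h : T.det ≠ 0) {κ : ℝ} (hκ : T.diam ^ 2 ≤ κ * |T.det|) :
    0 ≤ κ :=
  nonneg_of_mul_nonneg_left ((sq_nonneg _).trans hκ) (abs_pos.2 h)

theorem exists_sq_edgeLift_residual_le (K : ℕ) : ∃ C : ℝ, 0 < C ∧ ∀ (V : Tri) (κ : ℝ),
    V.det ≠ 0 → V.diam ^ 2 ≤ κ * |V.det| → ∀ J ∈ Polynomial.degreeLE ℝ (K : WithBot ℕ),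
    ∀ (q : Fin 2 → Poly) {σ : Plane → Plane}, MemLp σ 2 (volume.restrict V.carrier) →
      ((∫ x in V.carrier, ⟪vecAt (vecCurl (V.edgeLift J)) x, vecAt q x - σ x⟫)
        - ∫ x in V.carrier, (V.edgeLift J).evalAt x * (polyCurl q).evalAt x) ^ 2
      ≤ C * (κ + 1) * (∫ s in (0 : ℝ)..1, J.eval s ^ 2)
        * ((∫ x in V.carrier, ‖vecAt q x - σ x‖ ^ 2)
          + V.diam ^ 2 * ∫ x in V.carrier, (polyCurl q).evalAt x ^ 2) := by
  obtain ⟨C₁, hC₁, lift_le⟩ := exists_integral_edgeLift_sq_le K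
  obtain ⟨C₂, hC₂, grad_le⟩ := exists_integral_grad_edgeLift_sq_le K
  refine ⟨2 * (C₁ + C₂), by positivity, fun V κ hdet hκ J hJ q σ hσ => ?_⟩
  have cauchy_flux := sq_integral_inner_le (V.memLp_vecAt (vecCurl (V.edgeLift J)))
    ((V.memLp_vecAt q).sub hσ)
  have cauchy_curl := sq_integral_mul_le (V.memLp_evalAt (V.edgeLift J))
    (V.memLp_evalAt (polyCurl q))
  have lift_le := lift_le V hdet J hJ
  have grad_le := grad_le V κ hdet hκ J hJ
  simp only [norm_vecAt_vecCurl, Pi.sub_apply] at cauchy_flux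
  have hκ0 : 0 ≤ κ := nonneg_of_diam_sq_le hdet hκ
  have hR : 0 ≤ ∫ s in (0 : ℝ)..1, J.eval s ^ 2 :=
    intervalIntegral.integral_nonneg zero_le_one fun _ _ => sq_nonneg _
  set R := ∫ s in (0 : ℝ)..1, J.eval s ^ 2
  set A := ∫ x in V.carrier, ‖vecAt q x - σ x‖ ^ 2
  set D := ∫ x in V.carrier, (polyCurl q).evalAt x ^ 2
  set X := ∫ x in V.carrier, ⟪vecAt (vecCurl (V.edgeLift J)) x, vecAt q x - σ x⟫
  set Y := ∫ x in V.carrier, (V.edgeLift J).evalAt x * (polyCurl q).evalAt x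
  have hA : 0 ≤ A := integral_nonneg fun _ => sq_nonneg _
  have hD : 0 ≤ D := integral_nonneg fun _ => sq_nonneg _
  calc (X - Y) ^ 2 ≤ 2 * (X ^ 2 + Y ^ 2) := by nlinarith [sq_nonneg (X + Y)]
    _ ≤ 2 * (C₂ * κ * R * A + C₁ * V.diam ^ 2 * R * D) := by
        gcongr
        · exact cauchy_flux.trans (mul_le_mul_of_nonneg_right grad_le hA)
        · exact cauchy_curl.trans (mul_le_mul_of_nonneg_right lift_le hD)
    _ = 2 * R * (C₂ * κ * A + C₁ * 1 * (V.diam ^ 2 * D)) := by ring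
    _ ≤ 2 * R * ((C₁ + C₂) * (κ + 1) * A + (C₁ + C₂) * (κ + 1) * (V.diam ^ 2 * D)) := by
        gcongr <;> linarith
    _ = 2 * (C₁ + C₂) * (κ + 1) * R * (A + V.diam ^ 2 * D) := by ring

end Tri

/-- The component in the direction `t` of a polynomial field, as a polynomial in the parameter
of the line through `A` and `B`. -/
def traceOn (A B t : Plane) (q : Fin 2 → Poly) : Polynomial ℝ :=
  Poly.onLine A B (t 0 • q 0 + t 1 • q 1)

theorem eval_traceOn (A B t : Plane) (q : Fin 2 → Poly) (s : ℝ) :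
    (traceOn A B t q).eval s = ⟪vecAt q (AffineMap.lineMap A B s), t⟫ := by
  rw [traceOn, Poly.eval_onLine, plane_inner]
  simp [mul_comm]

theorem traceOn_mem_degreeLE (A B t : Plane) {q : Fin 2 → Poly} {K : ℕ}
    (hq : ∀ i, q i ∈ polyLE K) : traceOn A B t q ∈ Polynomial.degreeLE ℝ (K : WithBot ℕ) :=
  Poly.onLine_mem_degreeLE _ _
    (Submodule.add_mem _ (Submodule.smul_mem _ _ (hq 0)) (Submodule.smul_mem _ _ (hq 1)))

/-- The tangential jump over the edge `i` of `T` of the piecewise polynomial field `q`, as a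
polynomial in the edge parameter. -/
def jumpPoly (𝒯 : Finset Tri) (T : Tri) (i : Fin 3) (q : Tri → Fin 2 → Poly) : Polynomial ℝ :=
  traceOn (T.edgeA i) (T.edgeB i) (T.tangent i) (q T)
    - ∑ S ∈ neighbors 𝒯 T i, traceOn (T.edgeA i) (T.edgeB i) (T.tangent i) (q S)

theorem eval_jumpPoly (𝒯 : Finset Tri) (T : Tri) (i : Fin 3) (q : Tri → Fin 2 → Poly) (s : ℝ) :
    (jumpPoly 𝒯 T i q).eval s
      = ⟪vecAt (q T) (AffineMap.lineMap (T.edgeA i) (T.edgeB i) s), T.tangent i⟫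
        - ∑ S ∈ neighbors 𝒯 T i,
          ⟪vecAt (q S) (AffineMap.lineMap (T.edgeA i) (T.edgeB i) s), T.tangent i⟫ := by
  simp only [jumpPoly, Polynomial.eval_sub, Polynomial.eval_finsetSum, eval_traceOn]

theorem jumpPoly_mem_degreeLE {𝒯 : Finset Tri} {T : Tri} (hT : T ∈ 𝒯) (i : Fin 3)
    {q : Tri → Fin 2 → Poly} {K : ℕ} (hq : ∀ T ∈ 𝒯, ∀ j, q T j ∈ polyLE K) :
    jumpPoly 𝒯 T i q ∈ Polynomial.degreeLE ℝ (K : WithBot ℕ) :=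
  Submodule.sub_mem _ (traceOn_mem_degreeLE _ _ _ (hq T hT)) (Submodule.sum_mem _ fun S hS =>
    traceOn_mem_degreeLE _ _ _ (hq S (mem_neighbors.1 hS).1))

open Classical in
/-- The triangles sharing the edge `i` of `T`, including `T` itself. -/
def edgePatch (𝒯 : Finset Tri) (T : Tri) (i : Fin 3) : Finset Tri :=
  insert T (neighbors 𝒯 T i)

section EdgePatch

variable {𝒯 : Finset Tri} {T S : Tri} {i : Fin 3}

theorem mem_edgePatch : S ∈ edgePatch 𝒯 T i ↔ S = T ∨ S ∈ neighbors 𝒯 T i := by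
  simp only [edgePatch, Finset.mem_insert]

theorem edgePatch_subset (hT : T ∈ 𝒯) : edgePatch 𝒯 T i ⊆ 𝒯 := by
  intro S hS
  rcases mem_edgePatch.1 hS with rfl | hS
  exacts [hT, (mem_neighbors.1 hS).1]

theorem notMem_neighbors_self : T ∉ neighbors 𝒯 T i := fun h => (mem_neighbors.1 h).2.1 rfl

theorem sum_edgePatch {M : Type*} [AddCommMonoid M] (f : Tri → M) :
    ∑ S ∈ edgePatch 𝒯 T i, f S = f T + ∑ S ∈ neighbors 𝒯 T i, f S :=
  Finset.sum_insert notMem_neighbors_self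

theorem IsConforming.card_edgePatch_le (h : IsConforming 𝒯) (hT : T ∈ 𝒯) (i : Fin 3) :
    (edgePatch 𝒯 T i).card ≤ 2 :=
  (Finset.card_insert_le _ _).trans (Nat.succ_le_succ (h.card_neighbors_le_one hT i))

end EdgePatch

/-- `V` renumbers the vertices of the triangles sharing the edge `i` of `T` in such a way that
this edge, with the direction it has in `T`, becomes their edge `2`. The orientations of the two
triangles are then opposite, since they lie on different sides of the edge. -/
structure IsEdgeNumbering (𝒯 : Finset Tri) (T : Tri) (i : Fin 3) (V : Tri → Tri) : Prop where
  edgeA_eq : ∀ S ∈ edgePatch 𝒯 T i, (V S).edgeA 2 = T.edgeA i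
  edgeB_eq : ∀ S ∈ edgePatch 𝒯 T i, (V S).edgeB 2 = T.edgeB i
  carrier_eq : ∀ S ∈ edgePatch 𝒯 T i, (V S).carrier = S.carrier
  abs_det_eq : ∀ S ∈ edgePatch 𝒯 T i, |(V S).det| = |S.det|
  det_ne_zero : ∀ S ∈ edgePatch 𝒯 T i, (V S).det ≠ 0
  sign_det : ∀ S ∈ neighbors 𝒯 T i, SignType.sign (V S).det = -SignType.sign (V T).det

theorem sign_eq_neg_sign_of_mul_neg {a b : ℝ} (h : a * b < 0) :
    SignType.sign b = -SignType.sign a := by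
  rcases mul_neg_iff.1 h with ⟨ha, hb⟩ | ⟨ha, hb⟩
  · rw [sign_pos ha, sign_neg hb]
  · rw [sign_neg ha, sign_pos hb, neg_neg]

theorem IsConforming.exists_isEdgeNumbering {𝒯 : Finset Tri} (h : IsConforming 𝒯) {T : Tri}
    (hT : T ∈ 𝒯) (i : Fin 3) : ∃ V, IsEdgeNumbering 𝒯 T i V := by
  classical
  choose! j l hjl edgeA_eq edgeB_eq using fun S (hS : S ∈ neighbors 𝒯 T i) =>
    h.exists_reorder_eq hT hS
  let V (S : Tri) : Tri := if S = T then T.edgeFirst i else S.reorder (j S) (l S)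
  have V_self : V T = T.edgeFirst i := if_pos rfl
  have V_neighbor {S : Tri} (hS : S ∈ neighbors 𝒯 T i) : V S = S.reorder (j S) (l S) :=
    if_neg (mem_neighbors.1 hS).2.1
  have forall_edgePatch {P : Tri → Tri → Prop} (hself : P T (T.edgeFirst i))
      (hneighbor : ∀ S ∈ neighbors 𝒯 T i, P S (S.reorder (j S) (l S))) :
      ∀ S ∈ edgePatch 𝒯 T i, P S (V S) := by
    intro S hS
    rcases mem_edgePatch.1 hS with rfl | hS
    · rwa [V_self]
    · rw [V_neighbor hS]
      exact hneighbor S hS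
  refine ⟨V, forall_edgePatch (P := fun _ W => W.edgeA 2 = _) rfl edgeA_eq,
    forall_edgePatch (P := fun _ W => W.edgeB 2 = _) rfl edgeB_eq,
    forall_edgePatch (P := fun S W => W.carrier = S.carrier) (T.carrier_edgeFirst i)
      fun S hS => S.carrier_reorder (hjl S hS),
    forall_edgePatch (P := fun S W => |W.det| = |S.det|) (T.abs_det_edgeFirst i)
      fun S hS => S.abs_det_reorder (hjl S hS),
    forall_edgePatch (P := fun _ W => W.det ≠ 0) (h.det_edgeFirst_ne_zero hT i)
      fun S hS => h.det_reorder_ne_zero (mem_neighbors.1 hS).1 (hjl S hS),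
    fun S hS => ?_⟩
  rw [V_self, V_neighbor hS]
  exact sign_eq_neg_sign_of_mul_neg
    (h.det_edgeFirst_mul_det_reorder_neg hT hS (hjl S hS) (edgeA_eq S hS) (edgeB_eq S hS))

namespace IsEdgeNumbering

variable {𝒯 : Finset Tri} {T S : Tri} {i : Fin 3} {V : Tri → Tri}

theorem diam_eq (hV : IsEdgeNumbering 𝒯 T i V) (hS : S ∈ edgePatch 𝒯 T i) :
    (V S).diam = S.diam := by
  rw [Tri.diam, Tri.diam, hV.carrier_eq S hS]

theorem sum_sign_det_mul (hV : IsEdgeNumbering 𝒯 T i V) (f : Tri → ℝ) :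
    ∑ S ∈ edgePatch 𝒯 T i, (SignType.sign (V S).det : ℝ) * f S
      = SignType.sign (V T).det * (f T - ∑ S ∈ neighbors 𝒯 T i, f S) := by
  rw [sum_edgePatch, mul_sub, Finset.mul_sum, sub_eq_add_neg, ← Finset.sum_neg_distrib]
  congr 1
  refine Finset.sum_congr rfl fun S hS => ?_
  rw [hV.sign_det S hS, SignType.coe_neg, neg_mul]

theorem integral_inner_vecCurl_edgeLift (hV : IsEdgeNumbering 𝒯 T i V)
    (hS : S ∈ edgePatch 𝒯 T i) (J : Polynomial ℝ) {u : Plane → Plane} (hu : ContDiff ℝ 1 u) :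
    ∫ x in S.carrier, ⟪vecAt (vecCurl ((V S).edgeLift J)) x, u x⟫
      = (∫ x in S.carrier, ((V S).edgeLift J).evalAt x * curlAt u x)
        + SignType.sign (V S).det * ∫ t in (0 : ℝ)..1, ((1 - t) * t) ^ 2 * J.eval t
          * ⟪u (AffineMap.lineMap (T.edgeA i) (T.edgeB i) t), T.edgeB i - T.edgeA i⟫ := by
  rw [← hV.carrier_eq S hS, Tri.integral_inner_vecCurl (hV.det_ne_zero S hS) _ hu,
    Tri.circulation_edgeLift_smul (hV.det_ne_zero S hS), hV.edgeA_eq S hS, hV.edgeB_eq S hS]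

end IsEdgeNumbering

theorem gradient_eq_zero_of_notMem_tsupport {φ : Plane → ℝ} {x : Plane} (hx : x ∉ tsupport φ) :
    gradient φ x = 0 := by
  rw [gradient, fderiv_of_notMem_tsupport ℝ hx, map_zero]

section JumpResidual

variable {Ω : Set Plane} {𝒯 : Finset Tri} {T : Tri} {i : Fin 3} {V : Tri → Tri}

theorem IsTriangulation.integral_mul_inner_gradient_eq_zero (h : IsTriangulation Ω 𝒯)
    (hT : T ∈ 𝒯) (hn : neighbors 𝒯 T i = ∅) {φ : Plane → ℝ} (hφ : tsupport φ ⊆ Ω) (b : ℝ → ℝ)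
    (v : Plane) :
    ∫ t in (0 : ℝ)..1,
      b t * ⟪gradient φ (AffineMap.lineMap (T.edgeA i) (T.edgeB i) t), v⟫ = 0 := by
  rw [intervalIntegral.integral_of_le zero_le_one, integral_Ioc_eq_integral_Ioo]
  refine setIntegral_eq_zero_of_forall_eq_zero fun t ht => ?_
  rw [gradient_eq_zero_of_notMem_tsupport fun hmem => h.lineMap_notMem hT hn ht (hφ hmem),
    inner_zero_left, mul_zero]

namespace IsEdgeNumbering

theorem sum_integral_inner_vecCurl_edgeLift_gradient (hV : IsEdgeNumbering 𝒯 T i V)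
    (h : IsTriangulation Ω 𝒯) (hT : T ∈ 𝒯) (J : Polynomial ℝ) {φ : Plane → ℝ}
    (hφ : ContDiff ℝ 2 φ) (hsupp : tsupport φ ⊆ Ω) :
    ∑ S ∈ edgePatch 𝒯 T i,
      ∫ x in S.carrier, ⟪vecAt (vecCurl ((V S).edgeLift J)) x, gradient φ x⟫ = 0 := by
  rw [Finset.sum_congr rfl fun S hS =>
    hV.integral_inner_vecCurl_edgeLift hS J (contDiff_gradient hφ)]
  simp only [curlAt_gradient hφ, mul_zero, integral_zero, zero_add]
  rw [hV.sum_sign_det_mul, Finset.sum_const]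
  rcases Nat.le_one_iff_eq_zero_or_eq_one.1 (h.conforming.card_neighbors_le_one hT i)
    with hcard | hcard
  · rw [h.integral_mul_inner_gradient_eq_zero hT (Finset.card_eq_zero.1 hcard) hsupp, hcard,
      zero_smul, sub_zero, mul_zero]
  · rw [hcard, one_smul, sub_self, mul_zero]

theorem sum_integral_inner_vecCurl_edgeLift (hV : IsEdgeNumbering 𝒯 T i V)
    (h : IsTriangulation Ω 𝒯) (hT : T ∈ 𝒯) (J : Polynomial ℝ) {u : L2 Ω} {σ : L2v Ω}
    (hG : IsG Ω (Hdiv Ω) u σ) :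
    ∑ S ∈ edgePatch 𝒯 T i,
      ∫ x in S.carrier, ⟪vecAt (vecCurl ((V S).edgeLift J)) x, σ x⟫ = 0 := by
  have weak_form := hG.sum_integral_inner h (edgePatch_subset hT)
    (Y := fun S => vecAt (vecCurl ((V S).edgeLift J))) (d := fun _ _ => 0)
    (fun _ => continuous_vecAt _) (fun _ => continuous_const) fun φ hφ _ hsupp => by
      rw [hV.sum_integral_inner_vecCurl_edgeLift_gradient h hT J
        (hφ.of_le (WithTop.coe_le_coe.2 le_top)) hsupp]
      simp
  simpa using weak_form

theorem sum_integral_inner_vecCurl_edgeLift_vecAt (hV : IsEdgeNumbering 𝒯 T i V)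
    (hT : T.det ≠ 0) (J : Polynomial ℝ) (q : Tri → Fin 2 → Poly) :
    ∑ S ∈ edgePatch 𝒯 T i,
      ((∫ x in S.carrier, ⟪vecAt (vecCurl ((V S).edgeLift J)) x, vecAt (q S) x⟫)
        - ∫ x in S.carrier, ((V S).edgeLift J).evalAt x * (polyCurl (q S)).evalAt x)
      = SignType.sign (V T).det * (T.edgeLen i * ∫ t in (0 : ℝ)..1,
        ((1 - t) * t) ^ 2 * (J.eval t * (jumpPoly 𝒯 T i q).eval t)) := by
  have hL : T.edgeLen i ≠ 0 := dist_ne_zero.2 (Tri.edgeA_ne_edgeB hT i)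
  have edge_eq : T.edgeB i - T.edgeA i = T.edgeLen i • T.tangent i := by
    rw [Tri.tangent, smul_inv_smul₀ hL]
  let g (S : Tri) (t : ℝ) : ℝ := ((1 - t) * t) ^ 2 * J.eval t
    * ⟪vecAt (q S) (AffineMap.lineMap (T.edgeA i) (T.edgeB i) t), T.edgeB i - T.edgeA i⟫
  have hg (S : Tri) : Continuous (g S) := by
    refine .mul (by fun_prop) ?_
    exact ((continuous_vecAt (q S)).comp AffineMap.lineMap_continuous).inner continuous_const
  rw [Finset.sum_congr rfl fun S hS => by
    rw [hV.integral_inner_vecCurl_edgeLift hS J ((contDiff_vecAt (q S)).of_le le_top)]]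
  simp only [curlAt_vecAt, add_sub_cancel_left]
  rw [hV.sum_sign_det_mul fun S => ∫ t in (0 : ℝ)..1, g S t,
    ← intervalIntegral.integral_finsetSum fun S _ => (hg S).intervalIntegrable 0 1,
    ← intervalIntegral.integral_sub ((hg T).intervalIntegrable 0 1)
      ((continuous_finsetSum _ fun S _ => hg S).intervalIntegrable 0 1),
    ← intervalIntegral.integral_const_mul (T.edgeLen i)]
  congr 1
  refine intervalIntegral.integral_congr fun t _ => ?_
  simp only [g, edge_eq, real_inner_smul_right, eval_jumpPoly, mul_sub, Finset.mul_sum]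
  congr 1
  · ring
  · exact Finset.sum_congr rfl fun S _ => by ring

theorem sum_integral_inner_vecCurl_edgeLift_sub (hV : IsEdgeNumbering 𝒯 T i V)
    (h : IsTriangulation Ω 𝒯) (hT : T ∈ 𝒯) (J : Polynomial ℝ) {u : L2 Ω} {σ : L2v Ω}
    (hG : IsG Ω (Hdiv Ω) u σ) (q : Tri → Fin 2 → Poly) :
    ∑ S ∈ edgePatch 𝒯 T i,
      ((∫ x in S.carrier, ⟪vecAt (vecCurl ((V S).edgeLift J)) x, vecAt (q S) x - σ x⟫)
        - ∫ x in S.carrier, ((V S).edgeLift J).evalAt x * (polyCurl (q S)).evalAt x)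
      = SignType.sign (V T).det * (T.edgeLen i * ∫ t in (0 : ℝ)..1,
        ((1 - t) * t) ^ 2 * (J.eval t * (jumpPoly 𝒯 T i q).eval t)) := by
  have split_σ (S : Tri) (hS : S ∈ edgePatch 𝒯 T i) :
      (∫ x in S.carrier, ⟪vecAt (vecCurl ((V S).edgeLift J)) x, vecAt (q S) x - σ x⟫)
        = (∫ x in S.carrier, ⟪vecAt (vecCurl ((V S).edgeLift J)) x, vecAt (q S) x⟫)
          - ∫ x in S.carrier, ⟪vecAt (vecCurl ((V S).edgeLift J)) x, σ x⟫ := by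
    simp only [inner_sub_right]
    exact integral_sub (integrable_inner_of_memLp (S.memLp_vecAt _) (S.memLp_vecAt _))
      (integrable_inner_of_memLp (S.memLp_vecAt _)
        (h.memLp_carrier (edgePatch_subset hT hS) (Lp.memLp σ)))
  rw [← hV.sum_integral_inner_vecCurl_edgeLift_vecAt (h.conforming.det_ne_zero hT),
    Finset.sum_sub_distrib, Finset.sum_congr rfl split_σ, Finset.sum_sub_distrib,
    hV.sum_integral_inner_vecCurl_edgeLift h hT J hG, sub_zero, Finset.sum_sub_distrib]

end IsEdgeNumbering

theorem mul_mul_le_of_sq_mul_le {L R X M c : ℝ} (hL : 0 ≤ L) (hR : 0 ≤ R) (hM : 0 ≤ M)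
    (hRX : R ≤ c * X) (hLX : (L * X) ^ 2 ≤ M * R) : L * (L * R) ≤ c ^ 2 * M := by
  rw [← mul_assoc]
  refine mul_le_of_mul_mul_le hR (by positivity) ?_
  calc L * L * R * R = (L * R) ^ 2 := by ring
    _ ≤ (L * (c * X)) ^ 2 := by gcongr
    _ = c ^ 2 * (L * X) ^ 2 := by ring
    _ ≤ c ^ 2 * (M * R) := by gcongr
    _ = c ^ 2 * M * R := by ring

theorem exists_integral_edgeLift_residual_le (K : ℕ) : ∃ C : ℝ, 0 < C ∧
    ∀ {Ω : Set Plane} {𝒯 : Finset Tri}, IsTriangulation Ω 𝒯 → ∀ {u : L2 Ω} {σ : L2v Ω},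
      IsG Ω (Hdiv Ω) u σ → ∀ κ : ℝ, (∀ T ∈ 𝒯, T.diam ^ 2 ≤ κ * |T.det|) →
      ∀ q : Tri → Fin 2 → Poly, (∀ T ∈ 𝒯, ∀ j, q T j ∈ polyLE K) → ∀ T ∈ 𝒯, ∀ i,
      (T.edgeLen i * ∫ t in (0 : ℝ)..1, ((1 - t) * t) ^ 2 * (jumpPoly 𝒯 T i q).eval t ^ 2) ^ 2
        ≤ C * (κ + 1) * (∑ S ∈ edgePatch 𝒯 T i, ((∫ x in S.carrier, ‖vecAt (q S) x - σ x‖ ^ 2)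
            + S.diam ^ 2 * ∫ x in S.carrier, (polyCurl (q S)).evalAt x ^ 2))
          * ∫ t in (0 : ℝ)..1, (jumpPoly 𝒯 T i q).eval t ^ 2 := by
  obtain ⟨C, hC, residual_le⟩ := Tri.exists_sq_edgeLift_residual_le K
  refine ⟨2 * C, by positivity, fun {Ω 𝒯} h {u σ} hG κ hκ q hq T hT i => ?_⟩
  obtain ⟨V, hV⟩ := h.conforming.exists_isEdgeNumbering hT i
  have green := hV.sum_integral_inner_vecCurl_edgeLift_sub h hT (jumpPoly 𝒯 T i q) hG q
  have residual_le (S : Tri) (hS : S ∈ edgePatch 𝒯 T i) := residual_le (V S) κ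
    (hV.det_ne_zero S hS)
    (by rw [hV.diam_eq hS, hV.abs_det_eq S hS]; exact hκ S (edgePatch_subset hT hS)) _
    (jumpPoly_mem_degreeLE hT i hq) (q S) (hV.carrier_eq S hS ▸
      h.memLp_carrier (edgePatch_subset hT hS) (Lp.memLp σ))
  have hcard : ((edgePatch 𝒯 T i).card : ℝ) ≤ 2 := by
    exact_mod_cast h.conforming.card_edgePatch_le hT i
  have sign_sq : (SignType.sign (V T).det : ℝ) ^ 2 = 1 := by
    rcases (hV.det_ne_zero T (mem_edgePatch.2 (.inl rfl))).lt_or_gt with hneg | hpos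
    · simp [sign_neg hneg]
    · simp [sign_pos hpos]
  have sq_green := congrArg (fun r : ℝ => r ^ 2) green
  simp only [← sq] at sq_green
  rw [mul_pow, sign_sq, one_mul] at sq_green
  rw [← sq_green]
  refine sq_sum_le_card_mul_sum_sq.trans ?_
  calc _ ≤ 2 * ∑ S ∈ edgePatch 𝒯 T i, C * (κ + 1)
        * (∫ t in (0 : ℝ)..1, (jumpPoly 𝒯 T i q).eval t ^ 2)
        * ((∫ x in S.carrier, ‖vecAt (q S) x - σ x‖ ^ 2)
          + S.diam ^ 2 * ∫ x in S.carrier, (polyCurl (q S)).evalAt x ^ 2) := by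
        refine mul_le_mul hcard (Finset.sum_le_sum fun S hS => ?_)
          (Finset.sum_nonneg fun _ _ => sq_nonneg _) zero_le_two
        have residual_le := residual_le S hS
        rwa [hV.diam_eq hS, hV.carrier_eq S hS] at residual_le
    _ = _ := by rw [← Finset.mul_sum]; ring

theorem exists_jump_residual_le (K : ℕ) : ∃ C : ℝ, 0 < C ∧
    ∀ {Ω : Set Plane} {𝒯 : Finset Tri}, IsTriangulation Ω 𝒯 → ∀ {u : L2 Ω} {σ : L2v Ω},
      IsG Ω (Hdiv Ω) u σ → ∀ κ : ℝ, (∀ T ∈ 𝒯, T.diam ^ 2 ≤ κ * |T.det|) →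
      ∀ q : Tri → Fin 2 → Poly, (∀ T ∈ 𝒯, ∀ j, q T j ∈ polyLE K) → ∀ T ∈ 𝒯, ∀ i,
      T.edgeLen i * edgeNormSq T i (fun x => ⟪vecAt (q T) x, T.tangent i⟫
          - ∑ S ∈ neighbors 𝒯 T i, ⟪vecAt (q S) x, T.tangent i⟫)
        ≤ C * (κ + 1) * ∑ S ∈ edgePatch 𝒯 T i,
          ((∫ x in S.carrier, ‖vecAt (q S) x - σ x‖ ^ 2)
            + S.diam ^ 2 * ∫ x in S.carrier, (polyCurl (q S)).evalAt x ^ 2) := by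
  obtain ⟨C₀, hC₀, bubble_le⟩ := exists_integral_edge_sq_le_mul K
    (b := (1 - .X) * .X)
    (mul_ne_zero (sub_ne_zero.2 (Polynomial.X_ne_C 1).symm) Polynomial.X_ne_zero)
  obtain ⟨C₁, hC₁, flux_le⟩ := exists_integral_edgeLift_residual_le K
  refine ⟨C₀ ^ 2 * C₁, by positivity, fun {Ω 𝒯} h {u σ} hG κ hκ q hq T hT i => ?_⟩
  have hκ0 := Tri.nonneg_of_diam_sq_le (h.conforming.det_ne_zero hT) (hκ T hT)
  have flux_le := flux_le h hG κ hκ q hq T hT i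
  have bubble_le := bubble_le _ (jumpPoly_mem_degreeLE hT i hq)
  simp only [Polynomial.eval_mul, Polynomial.eval_sub, Polynomial.eval_one, Polynomial.eval_X,
    mul_pow _ (Polynomial.eval _ (jumpPoly 𝒯 T i q))] at bubble_le
  simp only [edgeNormSq, ← eval_jumpPoly]
  have patch_nonneg : 0 ≤ ∑ S ∈ edgePatch 𝒯 T i, ((∫ x in S.carrier, ‖vecAt (q S) x - σ x‖ ^ 2)
      + S.diam ^ 2 * ∫ x in S.carrier, (polyCurl (q S)).evalAt x ^ 2) :=
    Finset.sum_nonneg fun S _ => add_nonneg (integral_nonneg fun _ => sq_nonneg _)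
      (mul_nonneg (sq_nonneg _) (integral_nonneg fun _ => sq_nonneg _))
  have hM := mul_nonneg (mul_nonneg hC₁.le (add_nonneg hκ0 zero_le_one)) patch_nonneg
  refine (mul_mul_le_of_sq_mul_le dist_nonneg
    (intervalIntegral.integral_nonneg zero_le_one fun _ _ => sq_nonneg _) hM bubble_le
    flux_le).trans_eq ?_
  ring

end JumpResidual

/-! ### Piecewise polynomials and summation over the mesh -/

theorem polyLE_mono {K L : ℕ} (h : K ≤ L) : polyLE K ≤ polyLE L := fun _ hp =>
  (MvPolynomial.mem_restrictTotalDegree _ _ _).2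
    (((MvPolynomial.mem_restrictTotalDegree _ _ _).1 hp).trans h)

theorem mem_polyLE_of_mem_localSpace {fam : Family} {k : ℕ} {T : Tri} {q : Fin 2 → Poly}
    (hq : q ∈ localSpace fam k T) (i : Fin 2) : q i ∈ polyLE (k + 1) := by
  cases fam with
  | RT =>
    obtain ⟨p, hp, r, hr, hqpr⟩ := hq
    rw [hqpr i]
    refine Submodule.add_mem _ (polyLE_mono k.le_succ (hp i (Set.mem_univ _))) ?_
    rw [polyLE, MvPolynomial.mem_restrictTotalDegree] at hr ⊢
    refine (MvPolynomial.totalDegree_mul _ _).trans ?_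
    rw [MvPolynomial.totalDegree_X]
    omega
  | BDM => exact hq i (Set.mem_univ _)
  | BDFM => exact hq.1 i (Set.mem_univ _)

theorem Tri.eq_of_evalAt_ae_eq {T : Tri} (h : T.det ≠ 0) {p p' : Poly}
    (hp : p.evalAt =ᵐ[volume.restrict T.carrier] p'.evalAt) : p = p' := by
  have hp_int : Set.EqOn p.evalAt p'.evalAt (interior T.carrier) :=
    Measure.eqOn_open_of_ae_eq (ae_restrict_of_ae_restrict_of_subset interior_subset hp)
      isOpen_interior p.continuous.continuousOn p'.continuous.continuousOn
  have hpull : T.pull (p - p') = 0 := Poly.eq_zero_of_forall_openRefTri fun y hy => by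
    rw [evalAt_pull, Poly.evalAt_sub, sub_eq_zero]
    exact hp_int (toPlane_mem_interior h hy)
  refine sub_eq_zero.1 (MvPolynomial.funext fun z => ?_)
  have := T.evalAt_pull (p - p') (T.coord (WithLp.toLp 2 z))
  rw [hpull, toPlane_coord h, Poly.evalAt_zero] at this
  rw [map_zero]
  exact this.symm

section Representatives

variable {Ω : Set Plane} {𝒯 : Finset Tri} {T : Tri} {w : L2 Ω} {s : L2v Ω}

theorem RepOn.repOn_polyOn {p : Poly} (h : RepOn Ω T w p) : RepOn Ω T w (polyOn Ω T w) := by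
  have hex : ∃ p, RepOn Ω T w p := ⟨p, h⟩
  rw [polyOn, dif_pos hex]
  exact hex.choose_spec

theorem VecRepOn.vecRepOn_vecOn {q : Fin 2 → Poly} (h : VecRepOn Ω T s q) :
    VecRepOn Ω T s (vecOn Ω T s) := by
  have hex : ∃ q, VecRepOn Ω T s q := ⟨q, h⟩
  rw [vecOn, dif_pos hex]
  exact hex.choose_spec

namespace IsTriangulation

theorem ae_carrier (h : IsTriangulation Ω 𝒯) (hT : T ∈ 𝒯) {P : Plane → Prop}
    (hP : ∀ᵐ x ∂(volume.restrict Ω), x ∈ T.carrier → P x) :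
    ∀ᵐ x ∂(volume.restrict T.carrier), P x := by
  rw [← h.restrict_restrict hT]
  exact (ae_restrict_iff' T.measurableSet_carrier).2 hP

theorem polyOn_eq (h : IsTriangulation Ω 𝒯) (hT : T ∈ 𝒯) {p : Poly} (hp : RepOn Ω T w p) :
    polyOn Ω T w = p := by
  refine Tri.eq_of_evalAt_ae_eq (h.conforming.det_ne_zero hT) ?_
  filter_upwards [h.ae_carrier hT hp.repOn_polyOn, h.ae_carrier hT hp] with x hx hpx
  exact hx.symm.trans hpx

theorem vecOn_eq (h : IsTriangulation Ω 𝒯) (hT : T ∈ 𝒯) {q : Fin 2 → Poly}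
    (hq : VecRepOn Ω T s q) : vecOn Ω T s = q := by
  refine funext fun i => Tri.eq_of_evalAt_ae_eq (h.conforming.det_ne_zero hT) ?_
  filter_upwards [h.ae_carrier hT hq.vecRepOn_vecOn, h.ae_carrier hT hq] with x hx hqx
  have hxi := congrArg (fun v : Plane => v i) (hx.symm.trans hqx)
  fin_cases i <;> exact hxi

theorem polyOn_mem_polyLE (h : IsTriangulation Ω 𝒯) {k : ℕ} (hw : w ∈ Mh Ω k 𝒯) (hT : T ∈ 𝒯) :
    polyOn Ω T w ∈ polyLE k := by
  obtain ⟨p, hp, hwp⟩ := hw T hT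
  rwa [h.polyOn_eq hT hwp]

theorem vecOn_mem_polyLE (h : IsTriangulation Ω 𝒯) {fam : Family} {k : ℕ}
    (hs : s ∈ brokenSpace Ω fam k 𝒯) (hT : T ∈ 𝒯) (i : Fin 2) :
    vecOn Ω T s i ∈ polyLE (k + 1) := by
  obtain ⟨q, hq, hsq⟩ := hs T hT
  rw [h.vecOn_eq hT hsq]
  exact mem_polyLE_of_mem_localSpace hq i

theorem ae_eq_polyOn (h : IsTriangulation Ω 𝒯) {k : ℕ} (hw : w ∈ Mh Ω k 𝒯) (hT : T ∈ 𝒯) :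
    w =ᵐ[volume.restrict T.carrier] (polyOn Ω T w).evalAt := by
  obtain ⟨_, _, hwp⟩ := hw T hT
  exact h.ae_carrier hT hwp.repOn_polyOn

theorem ae_eq_vecOn (h : IsTriangulation Ω 𝒯) {fam : Family} {k : ℕ}
    (hs : s ∈ brokenSpace Ω fam k 𝒯) (hT : T ∈ 𝒯) :
    s =ᵐ[volume.restrict T.carrier] vecAt (vecOn Ω T s) := by
  obtain ⟨_, _, hsq⟩ := hs T hT
  exact h.ae_carrier hT hsq.vecRepOn_vecOn

end IsTriangulation

end Representatives

theorem gradOp_mem (Ω : Set Plane) (S : Submodule ℝ (L2v Ω)) (w : L2 Ω) : gradOp Ω S w ∈ S := by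
  rw [gradOp]
  split_ifs with h
  · exact h.choose_spec.1
  · exact S.zero_mem

theorem DiscreteEigensystem.Lam_mem {Ω : Set Plane} {S : Submodule ℝ (L2v Ω)}
    {M : Submodule ℝ (L2 Ω)} (D : DiscreteEigensystem Ω S M) (n m : ℕ) (lam : ℝ) (g : L2 Ω) :
    D.Lam n m lam g ∈ M := by
  have hle : D.clusterSpace n m ≤ M :=
    (Submodule.span_mono (Set.range_comp_subset_range Subtype.val D.u)).trans_eq D.span_eq
  exact hle (Submodule.starProjection_apply_mem _ _)

section Errors

variable {Ω : Set Plane} {𝒯 : Finset Tri} {T : Tri}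

/-- `‖σ_h - σ‖²` on the triangle `T`, for a piecewise polynomial field `σ_h`. -/
def fluxErrSq (Ω : Set Plane) (σh σ : L2v Ω) (T : Tri) : ℝ :=
  ∫ x in T.carrier, ‖vecAt (vecOn Ω T σh) x - σ x‖ ^ 2

/-- `‖w - u‖²` on the triangle `T`, for a piecewise polynomial function `w`. -/
def scalarErrSq (Ω : Set Plane) (w u : L2 Ω) (T : Tri) : ℝ :=
  ∫ x in T.carrier, ((polyOn Ω T w).evalAt x - u x) ^ 2

theorem fluxErrSq_nonneg (σh σ : L2v Ω) (T : Tri) : 0 ≤ fluxErrSq Ω σh σ T :=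
  integral_nonneg fun _ => sq_nonneg _

theorem scalarErrSq_nonneg (w u : L2 Ω) (T : Tri) : 0 ≤ scalarErrSq Ω w u T :=
  integral_nonneg fun _ => sq_nonneg _

namespace IsTriangulation

theorem sum_integral_norm_sq_le (h : IsTriangulation Ω 𝒯) {E : Type*} [NormedAddCommGroup E]
    [InnerProductSpace ℝ E] (f : Lp E 2 (volume.restrict Ω)) :
    ∑ T ∈ 𝒯, ∫ x in T.carrier, ‖f x‖ ^ 2 ≤ ‖f‖ ^ 2 := by
  have hint : IntegrableOn (fun x => ‖f x‖ ^ 2) Ω volume :=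
    (Lp.memLp f).integrable_norm_pow two_ne_zero
  have hinterior : ∀ T ∈ 𝒯, ∫ x in T.carrier, ‖f x‖ ^ 2 = ∫ x in interior T.carrier, ‖f x‖ ^ 2 :=
    fun T _ => (setIntegral_congr_set
      (interior_ae_eq_of_null_frontier (T.convex_carrier.addHaar_frontier volume))).symm
  have hsub : (⋃ T ∈ 𝒯, interior T.carrier) ⊆ Ω :=
    Set.iUnion₂_subset fun T hT => h.interior_subset hT
  calc ∑ T ∈ 𝒯, ∫ x in T.carrier, ‖f x‖ ^ 2
      = ∫ x in ⋃ T ∈ 𝒯, interior T.carrier, ‖f x‖ ^ 2 := by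
        rw [Finset.sum_congr rfl hinterior, integral_biUnion_finset 𝒯
          (fun T _ => isOpen_interior.measurableSet)
          (fun T hT T' hT' hne => h.conforming.disjoint_interior T hT T' hT' hne)
          (fun T hT => hint.mono_set (h.interior_subset hT))]
    _ ≤ ∫ x in Ω, ‖f x‖ ^ 2 :=
        setIntegral_mono_set hint (.of_forall fun _ => sq_nonneg _) hsub.eventuallyLE
    _ = ‖f‖ ^ 2 := by
        rw [← norm_toLp_sq (Lp.memLp f), Lp.toLp_coeFn]

theorem sum_fluxErrSq_le (h : IsTriangulation Ω 𝒯) {fam : Family} {k : ℕ} {σh : L2v Ω}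
    (hσh : σh ∈ brokenSpace Ω fam k 𝒯) (σ : L2v Ω) :
    ∑ T ∈ 𝒯, fluxErrSq Ω σh σ T ≤ ‖σ - σh‖ ^ 2 := by
  refine (Finset.sum_congr rfl fun T hT => integral_congr_ae ?_).trans_le
    (h.sum_integral_norm_sq_le (σ - σh))
  filter_upwards [h.ae_eq_vecOn hσh hT,
    h.ae_carrier hT ((Lp.coeFn_sub σ σh).mono fun x hx _ => hx)] with x hσhx hsub
  rw [hsub, Pi.sub_apply, ← hσhx, norm_sub_rev]

theorem sum_scalarErrSq_le (h : IsTriangulation Ω 𝒯) {k : ℕ} {w : L2 Ω} (hw : w ∈ Mh Ω k 𝒯)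
    (u : L2 Ω) : ∑ T ∈ 𝒯, scalarErrSq Ω w u T ≤ ‖u - w‖ ^ 2 := by
  refine (Finset.sum_congr rfl fun T hT => integral_congr_ae ?_).trans_le
    (h.sum_integral_norm_sq_le (u - w))
  filter_upwards [h.ae_eq_polyOn hw hT,
    h.ae_carrier hT ((Lp.coeFn_sub u w).mono fun x hx _ => hx)] with x hwx hsub
  rw [hsub, Pi.sub_apply, ← hwx, norm_sub_rev, Real.norm_eq_abs, sq_abs]

end IsTriangulation

end Errors

section Neighborhood

variable {𝒯 : Finset Tri} {T S : Tri}

open Classical in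
/-- The triangle `T` together with its neighbors across all three edges. -/
def neighborhood (𝒯 : Finset Tri) (T : Tri) : Finset Tri :=
  Finset.univ.biUnion (edgePatch 𝒯 T)

theorem mem_neighborhood : S ∈ neighborhood 𝒯 T ↔ ∃ i, S ∈ edgePatch 𝒯 T i := by
  simp only [neighborhood, Finset.mem_biUnion, Finset.mem_univ, true_and]

theorem edgePatch_subset_neighborhood (i : Fin 3) : edgePatch 𝒯 T i ⊆ neighborhood 𝒯 T :=
  fun _ hS => mem_neighborhood.2 ⟨i, hS⟩

theorem self_mem_neighborhood : T ∈ neighborhood 𝒯 T :=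
  mem_neighborhood.2 ⟨0, mem_edgePatch.2 (.inl rfl)⟩

theorem neighborhood_subset (hT : T ∈ 𝒯) : neighborhood 𝒯 T ⊆ 𝒯 := fun _ hS => by
  obtain ⟨i, hSi⟩ := mem_neighborhood.1 hS
  exact edgePatch_subset hT hSi

namespace IsConforming

theorem card_neighborhood_le (h : IsConforming 𝒯) (hT : T ∈ 𝒯) :
    (neighborhood 𝒯 T).card ≤ 6 :=
  Finset.card_biUnion_le_card_mul _ _ 2 fun i _ => h.card_edgePatch_le hT i

theorem mem_neighborhood_symm (h : IsConforming 𝒯) (hT : T ∈ 𝒯) (hS : S ∈ neighborhood 𝒯 T) :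
    T ∈ neighborhood 𝒯 S := by
  obtain ⟨i, hSi⟩ := mem_neighborhood.1 hS
  obtain rfl | hST := mem_edgePatch.1 hSi
  · exact self_mem_neighborhood
  · obtain ⟨j, hj⟩ := h.exists_mem_neighbors_symm hT hST
    exact mem_neighborhood.2 ⟨j, mem_edgePatch.2 (.inr hj)⟩

theorem sum_sum_neighborhood_le (h : IsConforming 𝒯) {a : Tri → ℝ} (ha : ∀ T, 0 ≤ a T) :
    ∑ T ∈ 𝒯, ∑ S ∈ neighborhood 𝒯 T, a S ≤ 6 * ∑ T ∈ 𝒯, a T := by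
  have hcomm : ∀ T S, T ∈ 𝒯 ∧ S ∈ neighborhood 𝒯 T ↔ T ∈ neighborhood 𝒯 S ∧ S ∈ 𝒯 :=
    fun T S => ⟨fun ⟨hT, hS⟩ => ⟨h.mem_neighborhood_symm hT hS, neighborhood_subset hT hS⟩,
      fun ⟨hT, hS⟩ => ⟨neighborhood_subset hS hT, h.mem_neighborhood_symm hS hT⟩⟩
  rw [Finset.sum_comm' hcomm, Finset.mul_sum]
  refine Finset.sum_le_sum fun S hS => ?_
  rw [Finset.sum_const, nsmul_eq_mul]
  exact mul_le_mul_of_nonneg_right (mod_cast h.card_neighborhood_le hS) (ha S)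

end IsConforming

end Neighborhood

theorem etaSq_nonneg (Ω : Set Plane) (S : Submodule ℝ (L2v Ω)) (𝒯 : Finset Tri) (g : L2 Ω)
    (T : Tri) : 0 ≤ etaSq Ω S 𝒯 g T := by
  have hlen : ∀ i, 0 ≤ T.edgeLen i := fun i => dist_nonneg
  exact add_nonneg (add_nonneg (integral_nonneg fun _ => sq_nonneg _)
    (integral_nonneg fun _ => sq_nonneg _)) (Finset.sum_nonneg fun i _ => mul_nonneg (hlen i)
      (mul_nonneg (hlen i) (intervalIntegral.integral_nonneg zero_le_one fun _ _ => sq_nonneg _)))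

theorem etaSq_eq (Ω : Set Plane) (S : Submodule ℝ (L2v Ω)) (𝒯 : Finset Tri) (w : L2 Ω) (T : Tri) :
    etaSq Ω S 𝒯 w T
      = T.diam ^ 2 * (∫ x in T.carrier,
          ‖vecAt (vecOn Ω T (gradOp Ω S w)) x - vecAt (polyGrad (polyOn Ω T w)) x‖ ^ 2)
        + T.diam ^ 2 * (∫ x in T.carrier, (polyCurl (vecOn Ω T (gradOp Ω S w))).evalAt x ^ 2)
        + ∑ i, T.edgeLen i * edgeNormSq T i (tangentialJump Ω 𝒯 (gradOp Ω S w) T i) := by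
  simp only [etaSq, norm_smul, mul_pow, Real.norm_eq_abs, sq_abs, integral_const_mul]

section Efficiency

variable {κ Q : ℝ}

theorem exists_tangentialJump_le (k : ℕ) (hκ : 0 < κ) : ∃ C : ℝ, 0 < C ∧
    ∀ {Ω : Set Plane} {𝒯 : Finset Tri}, IsTriangulation Ω 𝒯 →
      (∀ T ∈ 𝒯, T.diam ^ 2 ≤ κ * |T.det|) → ∀ {u : L2 Ω} {σ : L2v Ω}, IsG Ω (Hdiv Ω) u σ →
      ∀ {fam : Family}, ∀ σh ∈ brokenSpace Ω fam k 𝒯, ∀ T ∈ 𝒯, ∀ i,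
      T.edgeLen i * edgeNormSq T i (tangentialJump Ω 𝒯 σh T i)
        ≤ C * ∑ S ∈ neighborhood 𝒯 T, fluxErrSq Ω σh σ S := by
  obtain ⟨C₁, hC₁, curl_le⟩ := exists_curl_residual_le (k + 1)
  obtain ⟨C₂, hC₂, jump_le⟩ := exists_jump_residual_le (k + 1)
  refine ⟨C₂ * (κ + 1) * (1 + C₁ * κ ^ 2), by positivity,
    fun {Ω 𝒯} h hκ𝒯 {u σ} hG {fam} σh hσh T hT i => ?_⟩
  set q : Tri → Fin 2 → Poly := fun T => vecOn Ω T σh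
  set A : Tri → ℝ := fluxErrSq Ω σh σ
  have hq : ∀ S ∈ 𝒯, ∀ j, q S j ∈ polyLE (k + 1) := fun S hS => h.vecOn_mem_polyLE hσh hS
  have hcurl : ∀ S ∈ 𝒯, S.diam ^ 2 * ∫ x in S.carrier, (polyCurl (q S)).evalAt x ^ 2
      ≤ C₁ * κ ^ 2 * A S := fun S hS => curl_le h hG S hS κ (hκ𝒯 S hS) (q S) (hq S hS)
  calc T.edgeLen i * edgeNormSq T i (tangentialJump Ω 𝒯 σh T i)
      ≤ C₂ * (κ + 1) * ∑ S ∈ edgePatch 𝒯 T i,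
          (A S + S.diam ^ 2 * ∫ x in S.carrier, (polyCurl (q S)).evalAt x ^ 2) :=
        jump_le h hG κ hκ𝒯 q hq T hT i
    _ ≤ C₂ * (κ + 1) * ∑ S ∈ edgePatch 𝒯 T i, (1 + C₁ * κ ^ 2) * A S := by
        gcongr with S hS
        linarith [hcurl S (edgePatch_subset hT hS)]
    _ ≤ C₂ * (κ + 1) * ∑ S ∈ neighborhood 𝒯 T, (1 + C₁ * κ ^ 2) * A S := by
        gcongr
        exacts [fun S _ _ => mul_nonneg (by positivity) (fluxErrSq_nonneg _ _ S),
          edgePatch_subset_neighborhood i]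
    _ = C₂ * (κ + 1) * (1 + C₁ * κ ^ 2) * ∑ S ∈ neighborhood 𝒯 T, A S := by
        rw [← Finset.mul_sum, ← mul_assoc]

theorem exists_etaSq_le (k : ℕ) (hκ : 0 < κ) (hQ : 0 < Q) : ∃ C : ℝ, 0 < C ∧
    ∀ {Ω : Set Plane} {𝒯 : Finset Tri}, IsTriangulation Ω 𝒯 →
      (∀ T ∈ 𝒯, T.diam ^ 2 ≤ κ * |T.det|) → (∀ T ∈ 𝒯, T.diam ^ 2 ≤ Q) →
      ∀ {u : L2 Ω} {σ : L2v Ω}, IsG Ω (Hdiv Ω) u σ →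
      ∀ {fam : Family} {S : Submodule ℝ (L2v Ω)}, S ≤ brokenSpace Ω fam k 𝒯 →
      ∀ w ∈ Mh Ω k 𝒯, ∀ T ∈ 𝒯, etaSq Ω S 𝒯 w T
        ≤ C * (scalarErrSq Ω w u T
          + ∑ T' ∈ neighborhood 𝒯 T, fluxErrSq Ω (gradOp Ω S w) σ T') := by
  obtain ⟨C₁, hC₁, gradient_le⟩ := exists_gradient_residual_le (k + 1)
  obtain ⟨C₂, hC₂, curl_le⟩ := exists_curl_residual_le (k + 1)
  obtain ⟨C₃, hC₃, jump_le⟩ := exists_tangentialJump_le k hκ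
  refine ⟨C₁ * Q + C₁ * κ ^ 2 + C₂ * κ ^ 2 + 3 * C₃, by positivity,
    fun {Ω 𝒯} h hκ𝒯 hQ𝒯 {u σ} hG {fam S} hS w hw T hT => ?_⟩
  have hσh : gradOp Ω S w ∈ brokenSpace Ω fam k 𝒯 := hS (gradOp_mem Ω S w)
  set A : Tri → ℝ := fluxErrSq Ω (gradOp Ω S w) σ
  set P : ℝ := ∑ T' ∈ neighborhood 𝒯 T, A T'
  set B : ℝ := scalarErrSq Ω w u T
  have hA : ∀ T, 0 ≤ A T := fluxErrSq_nonneg _ _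
  have hAP : A T ≤ P := Finset.single_le_sum (fun S _ => hA S) self_mem_neighborhood
  have hP : 0 ≤ P := (hA T).trans hAP
  have hB : 0 ≤ B := scalarErrSq_nonneg _ _ _
  calc etaSq Ω S 𝒯 w T
      ≤ C₁ * (T.diam ^ 2 * A T + κ ^ 2 * B) + C₂ * κ ^ 2 * A T + ∑ _i : Fin 3, C₃ * P := by
        rw [etaSq_eq]
        refine add_le_add (add_le_add ?_ ?_) (Finset.sum_le_sum fun i _ =>
          jump_le h hκ𝒯 hG _ hσh T hT i)
        · exact gradient_le h hG T hT κ (hκ𝒯 T hT) _ _ (h.vecOn_mem_polyLE hσh hT)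
            (polyLE_mono k.le_succ (h.polyOn_mem_polyLE hw hT))
        · exact curl_le h hG T hT κ (hκ𝒯 T hT) _ (h.vecOn_mem_polyLE hσh hT)
    _ ≤ C₁ * (Q * P + κ ^ 2 * B) + C₂ * κ ^ 2 * P + ∑ _i : Fin 3, C₃ * P := by
        gcongr
        exacts [hA T, hQ𝒯 T hT]
    _ ≤ (C₁ * Q + C₁ * κ ^ 2 + C₂ * κ ^ 2 + 3 * C₃) * (B + P) := by
        rw [Finset.sum_const, Finset.card_univ, Fintype.card_fin, nsmul_eq_mul]
        have : 0 ≤ C₁ * κ ^ 2 * P := by positivity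
        have : 0 ≤ (C₁ * Q + C₂ * κ ^ 2 + 3 * C₃) * B := by positivity
        push_cast
        linarith

theorem exists_sum_etaSq_le (k : ℕ) (hκ : 0 < κ) (hQ : 0 < Q) : ∃ C : ℝ, 0 < C ∧
    ∀ {Ω : Set Plane} {𝒯 : Finset Tri}, IsTriangulation Ω 𝒯 →
      (∀ T ∈ 𝒯, T.diam ^ 2 ≤ κ * |T.det|) → (∀ T ∈ 𝒯, T.diam ^ 2 ≤ Q) →
      ∀ {u : L2 Ω} {σ : L2v Ω}, IsG Ω (Hdiv Ω) u σ →
      ∀ {fam : Family} {S : Submodule ℝ (L2v Ω)}, S ≤ brokenSpace Ω fam k 𝒯 →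
      ∀ w ∈ Mh Ω k 𝒯,
      ∑ T ∈ 𝒯, etaSq Ω S 𝒯 w T ≤ C * (‖u - w‖ ^ 2 + ‖σ - gradOp Ω S w‖ ^ 2) := by
  obtain ⟨C, hC, etaSq_le⟩ := exists_etaSq_le k hκ hQ
  refine ⟨6 * C, by positivity, fun {Ω 𝒯} h hκ𝒯 hQ𝒯 {u σ} hG {fam S} hS w hw => ?_⟩
  have hflux := h.conforming.sum_sum_neighborhood_le (fluxErrSq_nonneg (gradOp Ω S w) σ)
  calc ∑ T ∈ 𝒯, etaSq Ω S 𝒯 w T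
      ≤ ∑ T ∈ 𝒯, C * (scalarErrSq Ω w u T
          + ∑ T' ∈ neighborhood 𝒯 T, fluxErrSq Ω (gradOp Ω S w) σ T') :=
        Finset.sum_le_sum (etaSq_le h hκ𝒯 hQ𝒯 hG hS w hw)
    _ ≤ C * (∑ T ∈ 𝒯, scalarErrSq Ω w u T + 6 * ∑ T ∈ 𝒯, fluxErrSq Ω (gradOp Ω S w) σ T) := by
        rw [← Finset.mul_sum, Finset.sum_add_distrib]
        gcongr
    _ ≤ C * (‖u - w‖ ^ 2 + 6 * ‖σ - gradOp Ω S w‖ ^ 2) := by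
        gcongr
        exacts [h.sum_scalarErrSq_le hw u, h.sum_fluxErrSq_le (hS (gradOp_mem Ω S w)) σ]
    _ ≤ 6 * C * (‖u - w‖ ^ 2 + ‖σ - gradOp Ω S w‖ ^ 2) := by
        have : 0 ≤ C * ‖u - w‖ ^ 2 := by positivity
        linarith

end Efficiency

end MixedFEM

end

open MixedFEM in
theorem propositionl_general (Ω : Set Plane) (𝒯₀ : Finset Tri) (h𝒯₀ : IsTriangulation Ω 𝒯₀)
    (k : ℕ) :
    ∃ C : ℝ, 0 < C ∧ ∀ 𝒯 ∈ admissibleMeshes 𝒯₀, ∀ (u : L2 Ω) (σ : L2v Ω), IsG Ω (Hdiv Ω) u σ →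
      ∀ (fam : Family), ∀ S ≤ brokenSpace Ω fam k 𝒯, ∀ w ∈ Mh Ω k 𝒯,
        Real.sqrt (∑ T ∈ 𝒯, etaSeminorm Ω S 𝒯 w T ^ 2) ≤ C * errDist Ω S u w := by
  obtain ⟨κ, hκ, shape_regular⟩ := exists_diam_sq_le_mul_abs_det h𝒯₀.conforming
  obtain ⟨Q, hQ, diam_le⟩ := exists_diam_sq_le 𝒯₀
  obtain ⟨C, hC, sum_etaSq_le⟩ := exists_sum_etaSq_le k hκ hQ
  refine ⟨Real.sqrt C, Real.sqrt_pos.2 hC, fun 𝒯 h𝒯 u σ hG fam S hS w hw => ?_⟩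
  have heta (T : Tri) : etaSeminorm Ω S 𝒯 w T ^ 2 = etaSq Ω S 𝒯 w T :=
    Real.sq_sqrt (etaSq_nonneg Ω S 𝒯 w T)
  simp only [heta, errDist, aForm, hG.gradOp_eq, real_inner_self_eq_norm_sq]
  rw [← Real.sqrt_mul hC.le]
  exact Real.sqrt_le_sqrt (sum_etaSq_le (h𝒯₀.of_mem_admissibleMeshes h𝒯) (shape_regular 𝒯 h𝒯)
    (diam_le 𝒯 h𝒯) hG hS w hw)

theorem propositionl (Ω : Set MixedFEM.Plane) (𝒯₀ : Finset MixedFEM.Tri)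
    (h𝒯₀ : MixedFEM.IsTriangulation Ω 𝒯₀) (fam : MixedFEM.Family) (k n m : ℕ)
    (lam : ℝ) (σ : MixedFEM.L2v Ω) (u : MixedFEM.L2 Ω)
    (hu : MixedFEM.IsEigenpair Ω (MixedFEM.Hdiv Ω) ⊤ lam σ u) :
    ∃ C : ℝ, 0 < C ∧ ∀ 𝒯 ∈ MixedFEM.admissibleMeshes 𝒯₀,
      ∀ D : MixedFEM.DiscreteEigensystem Ω (MixedFEM.Sh Ω fam k 𝒯) (MixedFEM.Mh Ω k 𝒯),
        MixedFEM.mu D 𝒯 n m lam u 𝒯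
          ≤ C * MixedFEM.errDist Ω (MixedFEM.Sh Ω fam k 𝒯) u (D.Lam n m lam u) :=
  (propositionl_general Ω 𝒯₀ h𝒯₀ k).imp fun _ ⟨hC, hle⟩ => ⟨hC, fun 𝒯 h𝒯 D =>
    hle 𝒯 h𝒯 u σ ⟨hu.mem_S, hu.eq_a⟩ fam _ inf_le_right _ (D.Lam_mem n m lam u)⟩
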